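/- Let $(M,g)$ be a simply connected $n$-dimensional Riemannian manifold of constant sectional curvature $c$, let $\xi$ be the unit vector field tangent to the factor $\mathbb{R}$ of the Riemannian product $M\times\mathbb{R}$, and let $\Sigma$ be a connected surface immersed in $M\times\mathbb{R}$, with the induced metric. Let $\sigma$ be its second fundamental form and $\vec H=\frac12\operatorname{trace}\sigma$ its mean curvature vector field. Suppose that $\Sigma$ is a non-minimal pmc surface, i.e. $\nabla^\perp\vec H=0$ and $\vec H\not\equiv 0$. Then $H=|\vec H|$ is a positive constant. Let $A_{\vec H}$ be the operator given by $\langle A_{\vec H}X,Y\rangle=\langle\sigma(X,Y),\vec H\rangle$, and let $S$ be the traceless operator given by $$2H\langle SX,Y\rangle=Q(X,Y)-\frac{\operatorname{trace}Q}{2}\langle X,Y\rangle,\qquad Q(X,Y)=2\langle\sigma(X,Y),\vec H\rangle-c\langle X,\xi\rangle\langle Y,\xi\rangle ,$$ for $X,Y$ tangent to $\Sigma$. Suppose that $$\mu=\sup_\Sigma\Big(|\sigma|^2-\frac{1}{H^2}|A_{\vec H}|^2\Big)<+\infty .$$ Then the function $u=|S|$ (Hilbert--Schmidt norm) is continuous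 on $\Sigma$ and satisfies $$-\Delta u\le a\,u^3+b\,u ,$$ where $a$ and $b$ are real constants which depend only on $c$, $H$ and $\mu$ and $\Delta$ is the Laplace--Beltrami operator of $\Sigma$. The inequality holds pointwise on the open set $\{u>0\}$, where $u$ is smooth, and it holds on all of $\Sigma$ in the sense of distributions: $\int_\Sigma u\,(-\Delta\eta)\,dA\le\int_\Sigma(a u^3+b u)\,\eta\,dA$ for every smooth function $\eta\ge 0$ whose support is a compact subset of the domain of a coordinate chart of the given atlas. -/

import Mathlib

open scoped Manifold ContDiff Topology

noncomputable section

namespace PMC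

/-- Euclidean `n`-space, the model space of `n`-dimensional manifolds. -/
abbrev E (n : ℕ) : Type := EuclideanSpace ℝ (Fin n)

/-- The `i`-th vector of the standard basis. -/
abbrev e {n : ℕ} (i : Fin n) : E n := EuclideanSpace.single i (1 : ℝ)

/-! ### Riemannian geometry in an open subset of Euclidean space

`G` is a metric, given as a function with values in bilinear forms. -/

section Coordinates

variable {n : ℕ}

/-- The matrix `g_{ij}` of the metric. -/
def gram (G : E n → E n →L[ℝ] E n →L[ℝ] ℝ) (y : E n) : Matrix (Fin n) (Fin n) ℝ :=
  Matrix.of fun i j => G y (e i) (e j)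

/-- The Christoffel symbols of the Levi-Civita connection, as a bilinear map:
`Γ(v, w)^k = ½ ∑_l g^{kl} (∂_v g(w, e_l) + ∂_w g(v, e_l) - ∂_{e_l} g(v, w))`. -/
def christoffel (G : E n → E n →L[ℝ] E n →L[ℝ] ℝ) (y v w : E n) : E n :=
  WithLp.toLp 2 fun k => (1 / 2 : ℝ) * ∑ l, (gram G y)⁻¹ k l *
    (fderiv ℝ G y v w (e l) + fderiv ℝ G y w v (e l) - fderiv ℝ G y (e l) v w)

/-- The curvature tensor `R(u, v)w = ∇_u ∇_v w - ∇_v ∇_u w - ∇_{[u, v]} w` of the Levi-Civita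
connection, evaluated on constant vector fields. -/
def curvature (G : E n → E n →L[ℝ] E n →L[ℝ] ℝ) (y u v w : E n) : E n :=
  fderiv ℝ (fun z => christoffel G z v w) y u - fderiv ℝ (fun z => christoffel G z u w) y v
    + christoffel G y u (christoffel G y v w) - christoffel G y v (christoffel G y u w)

end Coordinates

section Ambient

variable {n : ℕ} {M : Type*} [TopologicalSpace M] [ChartedSpace (E n) M]
  [IsManifold 𝓘(ℝ, E n) ∞ M]

/-- Smooth Riemannian metrics on `M`. -/
abbrev Metric (n : ℕ) (M : Type*) [TopologicalSpace M] [ChartedSpace (E n) M]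
    [IsManifold 𝓘(ℝ, E n) ∞ M] :=
  Bundle.ContMDiffRiemannianMetric 𝓘(ℝ, E n) ∞ (E n) (fun x : M => TangentSpace 𝓘(ℝ, E n) x)

/-- The metric `g` written in the chart `φ`: the pull-back of `g` by `φ⁻¹`. -/
def chartMetric (g : Metric n M) (φ : OpenPartialHomeomorph M (E n)) (y : E n) :
    E n →L[ℝ] E n →L[ℝ] ℝ :=
  ContinuousLinearMap.bilinearComp (E := E n) (F := E n) (G := ℝ) (g.inner (φ.symm y))
    (mfderiv 𝓘(ℝ, E n) 𝓘(ℝ, E n) φ.symm y) (mfderiv 𝓘(ℝ, E n) 𝓘(ℝ, E n) φ.symm y)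

/-- `(M, g)` has constant sectional curvature `c`:
`⟨R(u, v)v, u⟩ = c (|u|² |v|² - ⟨u, v⟩²)` for all tangent vectors `u`, `v`. -/
def HasConstantSectionalCurvature (g : Metric n M) (c : ℝ) : Prop :=
  ∀ φ ∈ atlas (E n) M, ∀ y ∈ φ.target, ∀ u v : E n,
    let G := chartMetric g φ
    G y (curvature G y u v v) u = c * (G y u u * G y v v - G y u v ^ 2)

end Ambient

/-! ### Surfaces in `M × ℝ`

`f : S → M × ℝ` is an immersion of a two-dimensional manifold; `S` carries the induced metric.
`M × ℝ` carries the product of the metric `g` and the standard metric of `ℝ`.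
In what follows `ψ` is a chart of `S`, `φ` is a chart of `M`, and `x` is a point of `ψ.target`;
a vector tangent to `M × ℝ` at a point over the domain of `φ` is written in `φ` as an element of
`E n × ℝ`. The indices `i`, `j` refer to the coordinate fields `∂_0`, `∂_1` of `ψ`. -/

section Surface

variable {n : ℕ} {M : Type*} [TopologicalSpace M] [ChartedSpace (E n) M]
  [IsManifold 𝓘(ℝ, E n) ∞ M]
  {S : Type*} [TopologicalSpace S] [ChartedSpace (E 2) S]

/-- `f` is a smooth immersion of the surface `S` in `M × ℝ`. -/
def IsImmersedSurface (f : S → M × ℝ) : Prop :=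
  ContMDiff 𝓘(ℝ, E 2) (𝓘(ℝ, E n).prod 𝓘(ℝ, ℝ)) ∞ f ∧
    ∀ p, Function.Injective (mfderiv 𝓘(ℝ, E 2) (𝓘(ℝ, E n).prod 𝓘(ℝ, ℝ)) f p)

/-- The component in `ℝ` of `f ∘ ψ⁻¹`. -/
def height (f : S → M × ℝ) (ψ : OpenPartialHomeomorph S (E 2)) (x : E 2) : ℝ :=
  (f (ψ.symm x)).2

/-- `⟨∂_i, T⟩ = ⟨∂_i, ξ⟩`, where `ξ` is the unit field tangent to `ℝ` and `T` is its
tangential part. -/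
def tComp (f : S → M × ℝ) (ψ : OpenPartialHomeomorph S (E 2)) (i : Fin 2) (x : E 2) : ℝ :=
  fderiv ℝ (height f ψ) x (e i)

/-- The induced metric `⟨∂_i, ∂_j⟩` (first fundamental form). -/
def firstForm (g : Metric n M) (f : S → M × ℝ) (ψ : OpenPartialHomeomorph S (E 2)) (x : E 2) :
    Matrix (Fin 2) (Fin 2) ℝ :=
  Matrix.of fun i j =>
    g.inner (f (ψ.symm x)).1
        (mfderiv 𝓘(ℝ, E 2) 𝓘(ℝ, E n) (fun z => (f (ψ.symm z)).1) x (e i))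
        (mfderiv 𝓘(ℝ, E 2) 𝓘(ℝ, E n) (fun z => (f (ψ.symm z)).1) x (e j))
      + tComp f ψ i x * tComp f ψ j x

/-- The density `√(det ⟨∂_i, ∂_j⟩)` of the area element of the induced metric. -/
def areaDensity (g : Metric n M) (f : S → M × ℝ) (ψ : OpenPartialHomeomorph S (E 2))
    (x : E 2) : ℝ :=
  √(firstForm g f ψ x).det

/-- The Laplace-Beltrami operator `Δ = div grad` of the induced metric in the chart `ψ`,
applied to a function `v` of the coordinates. -/
def laplacian (g : Metric n M) (f : S → M × ℝ) (ψ : OpenPartialHomeomorph S (E 2))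
    (v : E 2 → ℝ) (x : E 2) : ℝ :=
  (areaDensity g f ψ x)⁻¹ * ∑ i, ∑ j,
    fderiv ℝ (fun z => areaDensity g f ψ z * (firstForm g f ψ z)⁻¹ i j * fderiv ℝ v z (e j)) x (e i)

/-- The component in `M` of `f ∘ ψ⁻¹`, written in the chart `φ`. -/
def baseMap (f : S → M × ℝ) (ψ : OpenPartialHomeomorph S (E 2))
    (φ : OpenPartialHomeomorph M (E n)) (x : E 2) : E n :=
  φ (f (ψ.symm x)).1

/-- The coordinate field `∂_i` as a field along `f` tangent to `M × ℝ`. -/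
def coordField (f : S → M × ℝ) (ψ : OpenPartialHomeomorph S (E 2))
    (φ : OpenPartialHomeomorph M (E n)) (i : Fin 2) (x : E 2) : E n × ℝ :=
  (fderiv ℝ (baseMap f ψ φ) x (e i), fderiv ℝ (height f ψ) x (e i))

/-- The product metric of `M × ℝ` at the image of `x`. -/
def ambInner (g : Metric n M) (f : S → M × ℝ) (ψ : OpenPartialHomeomorph S (E 2))
    (φ : OpenPartialHomeomorph M (E n)) (x : E 2) (a b : E n × ℝ) : ℝ :=
  chartMetric g φ (baseMap f ψ φ x) a.1 b.1 + a.2 * b.2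

/-- The covariant derivative in the direction `∂_i`, for the Levi-Civita connection of `M × ℝ`,
of a field `V` along `f` tangent to `M × ℝ`. -/
def ambCov (g : Metric n M) (f : S → M × ℝ) (ψ : OpenPartialHomeomorph S (E 2))
    (φ : OpenPartialHomeomorph M (E n)) (i : Fin 2) (V : E 2 → E n × ℝ) (x : E 2) : E n × ℝ :=
  (fderiv ℝ (fun z => (V z).1) x (e i)
      + christoffel (chartMetric g φ) (baseMap f ψ φ x) (fderiv ℝ (baseMap f ψ φ) x (e i)) (V x).1,
    fderiv ℝ (fun z => (V z).2) x (e i))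

/-- The part of a vector `a` that is normal to the surface. -/
def normalPart (g : Metric n M) (f : S → M × ℝ) (ψ : OpenPartialHomeomorph S (E 2))
    (φ : OpenPartialHomeomorph M (E n)) (x : E 2) (a : E n × ℝ) : E n × ℝ :=
  a - ∑ i, ∑ j, ((firstForm g f ψ x)⁻¹ i j * ambInner g f ψ φ x a (coordField f ψ φ j x)) •
    coordField f ψ φ i x

/-- The second fundamental form `σ(∂_i, ∂_j)`, the normal part of `∇̄_{∂_i} ∂_j`. -/
def secondForm (g : Metric n M) (f : S → M × ℝ) (ψ : OpenPartialHomeomorph S (E 2))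
    (φ : OpenPartialHomeomorph M (E n)) (i j : Fin 2) (x : E 2) : E n × ℝ :=
  normalPart g f ψ φ x (ambCov g f ψ φ i (coordField f ψ φ j) x)

/-- The mean curvature vector field `½ trace σ`. -/
def meanCurvatureVector (g : Metric n M) (f : S → M × ℝ) (ψ : OpenPartialHomeomorph S (E 2))
    (φ : OpenPartialHomeomorph M (E n)) (x : E 2) : E n × ℝ :=
  (1 / 2 : ℝ) • ∑ i, ∑ j, (firstForm g f ψ x)⁻¹ i j • secondForm g f ψ φ i j x

/-- The mean curvature vector field is parallel in the normal bundle: the normal part of its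
covariant derivative vanishes in all directions. -/
def HasParallelMeanCurvature (g : Metric n M) (f : S → M × ℝ) : Prop :=
  ∀ ψ ∈ atlas (E 2) S, ∀ φ ∈ atlas (E n) M, ∀ x ∈ ψ.target, (f (ψ.symm x)).1 ∈ φ.source →
    ∀ i, normalPart g f ψ φ x (ambCov g f ψ φ i (meanCurvatureVector g f ψ φ) x) = 0

/-- `|H⃗|` in charts. -/
def meanCurvatureIn (g : Metric n M) (f : S → M × ℝ) (ψ : OpenPartialHomeomorph S (E 2))
    (φ : OpenPartialHomeomorph M (E n)) (x : E 2) : ℝ :=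
  √(ambInner g f ψ φ x (meanCurvatureVector g f ψ φ x) (meanCurvatureVector g f ψ φ x))

/-- `|σ|²` in charts. -/
def normSqSecondFormIn (g : Metric n M) (f : S → M × ℝ) (ψ : OpenPartialHomeomorph S (E 2))
    (φ : OpenPartialHomeomorph M (E n)) (x : E 2) : ℝ :=
  ∑ i, ∑ j, ∑ k, ∑ l, (firstForm g f ψ x)⁻¹ i k * (firstForm g f ψ x)⁻¹ j l *
    ambInner g f ψ φ x (secondForm g f ψ φ i j x) (secondForm g f ψ φ k l x)

/-- The operator `A_{H⃗}`, through `⟨A_{H⃗} ∂_i, ∂_j⟩ = ⟨σ(∂_i, ∂_j), H⃗⟩`. -/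
def shapeForm (g : Metric n M) (f : S → M × ℝ) (ψ : OpenPartialHomeomorph S (E 2))
    (φ : OpenPartialHomeomorph M (E n)) (x : E 2) : Matrix (Fin 2) (Fin 2) ℝ :=
  Matrix.of fun i j =>
    ambInner g f ψ φ x (secondForm g f ψ φ i j x) (meanCurvatureVector g f ψ φ x)

/-- `Q(∂_i, ∂_j) = 2 ⟨σ(∂_i, ∂_j), H⃗⟩ - c ⟨∂_i, ξ⟩ ⟨∂_j, ξ⟩`. -/
def formQ (g : Metric n M) (c : ℝ) (f : S → M × ℝ) (ψ : OpenPartialHomeomorph S (E 2))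
    (φ : OpenPartialHomeomorph M (E n)) (x : E 2) : Matrix (Fin 2) (Fin 2) ℝ :=
  Matrix.of fun i j => 2 * shapeForm g f ψ φ x i j - c * tComp f ψ i x * tComp f ψ j x

/-- The operator `S`, through
`2 |H⃗| ⟨S ∂_i, ∂_j⟩ = Q(∂_i, ∂_j) - ½ (trace Q) ⟨∂_i, ∂_j⟩`. -/
def formS (g : Metric n M) (c : ℝ) (f : S → M × ℝ) (ψ : OpenPartialHomeomorph S (E 2))
    (φ : OpenPartialHomeomorph M (E n)) (x : E 2) : Matrix (Fin 2) (Fin 2) ℝ :=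
  (2 * meanCurvatureIn g f ψ φ x)⁻¹ •
    (formQ g c f ψ φ x - (((firstForm g f ψ x)⁻¹ * formQ g c f ψ φ x).trace / 2) •
      firstForm g f ψ x)

/-- The squared Hilbert-Schmidt norm, with respect to the induced metric, of the endomorphism `B`
of the tangent plane with `⟨B ∂_i, ∂_j⟩ = b i j`. -/
def hsNormSq (g : Metric n M) (f : S → M × ℝ) (ψ : OpenPartialHomeomorph S (E 2)) (x : E 2)
    (b : Matrix (Fin 2) (Fin 2) ℝ) : ℝ :=
  ∑ i, ∑ j, ∑ k, ∑ l, (firstForm g f ψ x)⁻¹ i k * (firstForm g f ψ x)⁻¹ j l * b i j * b k l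

/-! The scalars above do not depend on the charts. As functions on `S` they are evaluated in the
preferred charts at `p` and at `f p`. -/

/-- The mean curvature `|H⃗|`. -/
def meanCurvature (g : Metric n M) (f : S → M × ℝ) (p : S) : ℝ :=
  meanCurvatureIn g f (chartAt (E 2) p) (chartAt (E n) (f p).1) (chartAt (E 2) p p)

/-- `|σ|²`. -/
def normSqSecondForm (g : Metric n M) (f : S → M × ℝ) (p : S) : ℝ :=
  normSqSecondFormIn g f (chartAt (E 2) p) (chartAt (E n) (f p).1) (chartAt (E 2) p p)

/-- `|A_{H⃗}|²`. -/
def normSqShape (g : Metric n M) (f : S → M × ℝ) (p : S) : ℝ :=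
  hsNormSq g f (chartAt (E 2) p) (chartAt (E 2) p p)
    (shapeForm g f (chartAt (E 2) p) (chartAt (E n) (f p).1) (chartAt (E 2) p p))

/-- `|S|`. -/
def normS (g : Metric n M) (c : ℝ) (f : S → M × ℝ) (p : S) : ℝ :=
  √(hsNormSq g f (chartAt (E 2) p) (chartAt (E 2) p p)
    (formS g c f (chartAt (E 2) p) (chartAt (E n) (f p).1) (chartAt (E 2) p p)))

/-- `u` is smooth near every point where it is positive, and `-Δu ≤ w` there. -/
def NegLaplacianLEWherePos (g : Metric n M) (f : S → M × ℝ) (u w : S → ℝ) : Prop :=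
  ∀ p, 0 < u p → ContMDiffAt 𝓘(ℝ, E 2) 𝓘(ℝ, ℝ) ∞ u p ∧
    ∀ ψ ∈ atlas (E 2) S, p ∈ ψ.source → -laplacian g f ψ (u ∘ ψ.symm) (ψ p) ≤ w p

/-- `-Δu ≤ w` in the sense of distributions: in every chart, for every nonnegative test function
`η` supported in the chart, `∫ u (-Δη) dA ≤ ∫ w η dA`, where `dA` is the area element of the
induced metric. -/
def NegLaplacianLEWeakly (g : Metric n M) (f : S → M × ℝ) (u w : S → ℝ) : Prop :=
  ∀ ψ ∈ atlas (E 2) S, ∀ η : E 2 → ℝ, ContDiff ℝ ∞ η → HasCompactSupport η →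
    tsupport η ⊆ ψ.target → (∀ x, 0 ≤ η x) →
    ∫ x in ψ.target, u (ψ.symm x) * (-laplacian g f ψ η x) * areaDensity g f ψ x ≤
      ∫ x in ψ.target, w (ψ.symm x) * η x * areaDensity g f ψ x

end Surface

end PMC

end

set_option linter.unusedSectionVars false
set_option linter.style.haveILetI false

noncomputable section

namespace PMC

/-! ### Derivatives of smooth maps on open subsets of Euclidean space. -/

section Calculus

variable {m : ℕ} {W : Type*} [NormedAddCommGroup W] [NormedSpace ℝ W]

/-! The form `Q` is built so that its (2,0)-part is holomorphic. When H⃗ is parallel, the Codazzi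
equation for `A_H` has an error term from the curvature of `M × ℝ`, proportional to `c ⟨H⃗, ξ⟩`. The
tensor `T ⊗ T`, with `T` the tangential part of `ξ`, has an error of the same shape because `ξ` is
parallel, and the coefficient `c` in `Q` makes the two cancel. So `S` is a traceless symmetric
Codazzi tensor (`isCodazzi_S`).

In dimension two such a tensor satisfies the Simons formula `Δ|S|² = 2|∇S|² + 4K|S|²`
(`lap_codazzi`) and the Kato identity `|∇|S|²|² = 2|S|²|∇S|²` (`gradSq_codazzi`).

What remains is a lower bound for the Gauss curvature `K` (`neg_two_mul_gaussK_le`). The Gauss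
equation reads `2K = 2c(1 - |T|²) + 4H² - |σ|²`. The definition of `μ` gives `|σ|² ≤ μ + |A_H|²/H²`.
Since `A_H/H = H·id + S + (c/2H)(T ⊗ T)₀`, where the subscript denotes the traceless part, also
`|A_H|²/H² ≤ 2H² + 2|S|² + c²/(4H²)`. Hence `-2K ≤ 2|S|² + b` with `b = 2|c| + μ - 2H² + c²/(4H²)`,
and the theorem holds with this `b` and `a = 2`.

The function `u = |S|` need not be smooth at zeros of `S`, so the estimates are stated for `h =
|S|²` (`simons`) and transferred to `√(h + ε)` (`neg_divForm_sqrt_le`). Taking `ε = 0` on `{u > 0}`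
gives the pointwise inequality. Taking `ε > 0`, applying Green's formula against a test function and
letting `ε → 0` gives the weak one (`integral_sqrt_mul_neg_divForm_le`).

The geometry is carried out in `SurfaceData`, which keeps only the formal properties of the
pulled-back tangent bundle: a metric, a compatible connection, symmetry on coordinate fields, the
parallel field `ξ` and the curvature formula. In the Gram-Schmidt frame of the coordinate fields the
structure equations become scalar identities. `surfaceData` realises the structure in a pair of
charts. Since the invariants on the surface are evaluated in preferred charts that vary with the
point, `invariants_eq` is needed before they can be differentiated. -/

theorem contDiffOn_fderiv_apply {f : E m → W} {U : Set (E m)} (hU : IsOpen U)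
    (hf : ContDiffOn ℝ ∞ f U) (v : E m) : ContDiffOn ℝ ∞ (fun z => fderiv ℝ f z v) U :=
  (hf.fderiv_of_isOpen hU (by simp)).clm_apply contDiffOn_const

theorem differentiableAt_of_contDiffOn {F : Type*} [NormedAddCommGroup F] [NormedSpace ℝ F]
    {f : F → W} {U : Set F} (hU : IsOpen U)
    (hf : ContDiffOn ℝ ∞ f U) {x : F} (hx : x ∈ U) : DifferentiableAt ℝ f x :=
  (hf.contDiffAt (hU.mem_nhds hx)).differentiableAt (by simp)

theorem fderiv_fderiv_apply {f : E m → W} {U : Set (E m)} (hU : IsOpen U)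
    (hf : ContDiffOn ℝ ∞ f U) {x : E m} (hx : x ∈ U) (v w : E m) :
    fderiv ℝ (fun z => fderiv ℝ f z v) x w = fderiv ℝ (fderiv ℝ f) x w v := by
  have h := differentiableAt_of_contDiffOn hU (hf.fderiv_of_isOpen hU (m := ∞) (by simp)) hx
  rw [fderiv_clm_apply h (differentiableAt_const v)]
  simp

theorem fderiv_fderiv_comm {f : E m → W} {U : Set (E m)} (hU : IsOpen U)
    (hf : ContDiffOn ℝ ∞ f U) {x : E m} (hx : x ∈ U) (v w : E m) :
    fderiv ℝ (fun z => fderiv ℝ f z v) x w = fderiv ℝ (fun z => fderiv ℝ f z w) x v := by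
  rw [fderiv_fderiv_apply hU hf hx, fderiv_fderiv_apply hU hf hx]
  exact (hf.contDiffAt (hU.mem_nhds hx)).isSymmSndFDerivAt
    (by simpa using (WithTop.coe_le_coe.2 le_top : ((2 : ℕ∞) : WithTop ℕ∞) ≤ ∞)) w v

theorem fderiv_congr_of_eqOn {F : Type*} [NormedAddCommGroup F] [NormedSpace ℝ F]
    {f g : F → W} {U : Set F} (hU : IsOpen U) (h : Set.EqOn f g U)
    {x : F} (hx : x ∈ U) : fderiv ℝ f x = fderiv ℝ g x :=
  (h.eventuallyEq_of_mem (hU.mem_nhds hx)).fderiv_eq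

end Calculus

/-! ### Levi-Civita connection and curvature of a metric on an open set. -/

section Coordinates

variable {n : ℕ} {G : E n → E n →L[ℝ] E n →L[ℝ] ℝ} {V : Set (E n)}

/-- `G` is a smooth Riemannian metric on the open set `V`. -/
structure IsMetricOn (G : E n → E n →L[ℝ] E n →L[ℝ] ℝ) (V : Set (E n)) : Prop where
  isOpen : IsOpen V
  smooth : ContDiffOn ℝ ∞ G V
  symm : ∀ y ∈ V, ∀ v w, G y v w = G y w v
  pos : ∀ y ∈ V, ∀ v, v ≠ 0 → 0 < G y v v

theorem sum_smul_e (v : E n) : ∑ i, v i • (e i : E n) = v := by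
  ext j
  simp [e, Pi.single_apply]

theorem clm_apply_sum_e {W : Type*} [NormedAddCommGroup W] [NormedSpace ℝ W]
    (L : E n →L[ℝ] W) (v : E n) : L v = ∑ i, v i • L (e i) := by
  conv_lhs => rw [← sum_smul_e v]
  simp [map_sum]

theorem IsMetricOn.ext (hG : IsMetricOn G V) {y : E n} (hy : y ∈ V) {v w : E n}
    (h : ∀ z, G y v z = G y w z) : v = w := by
  by_contra hne
  have := hG.pos y hy (v - w) (sub_ne_zero.2 hne)
  simp [h] at this

theorem IsMetricOn.gram_posDef (hG : IsMetricOn G V) {y : E n} (hy : y ∈ V) :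
    (gram G y).PosDef := by
  refine Matrix.PosDef.of_dotProduct_mulVec_pos ?_ fun x hx => ?_
  · ext i j
    simp [gram, hG.symm y hy (e i) (e j)]
  · have hx' : (WithLp.toLp 2 x : E n) ≠ 0 := fun h => hx (by simpa using congrArg WithLp.ofLp h)
    have := hG.pos y hy _ hx'
    rw [clm_apply_sum_e (G y) (WithLp.toLp 2 x)] at this
    simp only [sum_apply, smul_apply,
      clm_apply_sum_e _ (WithLp.toLp 2 x)] at this
    simpa [dotProduct, Matrix.mulVec, gram, Finset.mul_sum, mul_comm, mul_left_comm,
      hG.symm y hy (e _) (e _)] using this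

theorem IsMetricOn.gram_det_ne_zero (hG : IsMetricOn G V) {y : E n} (hy : y ∈ V) :
    (gram G y).det ≠ 0 := (hG.gram_posDef hy).det_pos.ne'

/-- Against basis vectors the Gram matrix cancels the inverse in the Christoffel symbols; linearity
does the rest. From here on the connection is used only through this characterisation. -/
theorem IsMetricOn.koszul (hG : IsMetricOn G V) {y : E n} (hy : y ∈ V) (v w z : E n) :
    G y (christoffel G y v w) z =
      (1 / 2 : ℝ) * (fderiv ℝ G y v w z + fderiv ℝ G y w v z - fderiv ℝ G y z v w) := by
  have key : ∀ m, G y (christoffel G y v w) (e m) =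
      (1 / 2 : ℝ) * (fderiv ℝ G y v w (e m) + fderiv ℝ G y w v (e m) - fderiv ℝ G y (e m) v w) := by
    intro m
    set c : Fin n → ℝ := fun l =>
      fderiv ℝ G y v w (e l) + fderiv ℝ G y w v (e l) - fderiv ℝ G y (e l) v w with hc
    have h1 : (gram G y * (gram G y)⁻¹).mulVec c = c := by
      rw [Matrix.mul_nonsing_inv _ (hG.gram_det_ne_zero hy).isUnit, Matrix.one_mulVec]
    have h2 := congrFun h1 m
    rw [← Matrix.mulVec_mulVec] at h2
    rw [clm_apply_sum_e (G y)]
    simp only [sum_apply, smul_apply, christoffel]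
    change _ = (1 / 2 : ℝ) * c m
    rw [← h2]
    simp only [Matrix.mulVec, dotProduct, smul_eq_mul, Finset.mul_sum, Finset.sum_mul]
    refine Finset.sum_congr rfl fun k _ => Finset.sum_congr rfl fun l _ => ?_
    rw [hG.symm y hy (e k) (e m)]
    simp only [gram, Matrix.of_apply, hc]
    ring
  rw [clm_apply_sum_e (G y _) z, clm_apply_sum_e (fderiv ℝ G y v w) z,
    clm_apply_sum_e (fderiv ℝ G y w v) z, clm_apply_sum_e (fderiv ℝ G y) z]
  simp only [sum_apply, smul_apply, key, smul_eq_mul,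
    Finset.mul_sum, ← Finset.sum_add_distrib, ← Finset.sum_sub_distrib]
  exact Finset.sum_congr rfl fun k _ => by ring

/-- The derivative of `G` takes values in symmetric forms. -/
theorem IsMetricOn.fderiv_symm (hG : IsMetricOn G V) {y : E n} (hy : y ∈ V) (u v w : E n) :
    fderiv ℝ G y u v w = fderiv ℝ G y u w v := by
  have hd := differentiableAt_of_contDiffOn hG.isOpen hG.smooth hy
  have h : ∀ a b : E n, fderiv ℝ (fun z => G z a b) y u = fderiv ℝ G y u a b := by
    intro a b
    rw [fderiv_clm_apply (hd.clm_apply (differentiableAt_const a)) (differentiableAt_const b),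
      fderiv_clm_apply hd (differentiableAt_const a)]
    simp
  rw [← h, ← h, fderiv_congr_of_eqOn hG.isOpen (fun z hz => hG.symm z hz v w) hy]

theorem IsMetricOn.christoffel_symm (hG : IsMetricOn G V) {y : E n} (hy : y ∈ V) (v w : E n) :
    christoffel G y v w = christoffel G y w v :=
  hG.ext hy fun z => by
    rw [hG.koszul hy, hG.koszul hy, hG.fderiv_symm hy z v w]; ring

theorem IsMetricOn.metric_compat (hG : IsMetricOn G V) {y : E n} (hy : y ∈ V) (u v w : E n) :
    fderiv ℝ G y u v w = G y (christoffel G y u v) w + G y v (christoffel G y u w) := by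
  rw [hG.symm y hy v, hG.koszul hy, hG.koszul hy, hG.fderiv_symm hy w u v,
    hG.fderiv_symm hy v u w, hG.fderiv_symm hy u w v]; ring

theorem christoffel_add_left (y u v w : E n) :
    christoffel G y (u + v) w = christoffel G y u w + christoffel G y v w := by
  ext k
  simp only [christoffel, PiLp.add_apply, ← mul_add, ← Finset.sum_add_distrib, map_add,
    add_apply]
  exact congrArg _ (Finset.sum_congr rfl fun l _ => by ring)

theorem christoffel_add_right (y u v w : E n) :
    christoffel G y u (v + w) = christoffel G y u v + christoffel G y u w := by
  ext k
  simp only [christoffel, PiLp.add_apply, ← mul_add, ← Finset.sum_add_distrib, map_add,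
    add_apply]
  exact congrArg _ (Finset.sum_congr rfl fun l _ => by ring)

theorem christoffel_smul_left (y : E n) (a : ℝ) (v w : E n) :
    christoffel G y (a • v) w = a • christoffel G y v w := by
  ext k
  simp only [christoffel, PiLp.smul_apply, map_smul, smul_apply,
    smul_eq_mul, Finset.mul_sum]
  exact Finset.sum_congr rfl fun l _ => by ring

theorem christoffel_smul_right (y : E n) (a : ℝ) (v w : E n) :
    christoffel G y v (a • w) = a • christoffel G y v w := by
  ext k
  simp only [christoffel, PiLp.smul_apply, map_smul, smul_apply,
    smul_eq_mul, Finset.mul_sum]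
  exact Finset.sum_congr rfl fun l _ => by ring

/-- The Christoffel symbols as a continuous bilinear map. -/
def christoffelCLM (G : E n → E n →L[ℝ] E n →L[ℝ] ℝ) (y : E n) : E n →L[ℝ] E n →L[ℝ] E n :=
  (LinearMap.mk₂ ℝ (christoffel G y) (christoffel_add_left y) (christoffel_smul_left y)
    (christoffel_add_right y) (christoffel_smul_right y)).toContinuousBilinearMap

@[simp] theorem christoffelCLM_apply (y v w : E n) :
    christoffelCLM G y v w = christoffel G y v w := rfl

theorem contDiffOn_det {k : ℕ} {F : Type*} [NormedAddCommGroup F] [NormedSpace ℝ F]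
    {A : F → Matrix (Fin k) (Fin k) ℝ} {U : Set F}
    (hA : ∀ i j, ContDiffOn ℝ ∞ (fun z => A z i j) U) : ContDiffOn ℝ ∞ (fun z => (A z).det) U := by
  simp only [Matrix.det_apply]
  exact ContDiffOn.sum fun σ _ => (contDiffOn_prod fun i _ => hA _ _).const_smul _

theorem contDiffOn_matrix_inv {k : ℕ} {F : Type*} [NormedAddCommGroup F] [NormedSpace ℝ F]
    {A : F → Matrix (Fin k) (Fin k) ℝ} {U : Set F}
    (hA : ∀ i j, ContDiffOn ℝ ∞ (fun z => A z i j) U) (hdet : ∀ z ∈ U, (A z).det ≠ 0)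
    (i j : Fin k) : ContDiffOn ℝ ∞ (fun z => (A z)⁻¹ i j) U := by
  simp only [Matrix.inv_def, Matrix.smul_apply, smul_eq_mul, Ring.inverse_eq_inv',
    Matrix.adjugate_apply]
  refine ((contDiffOn_det hA).inv hdet).mul (contDiffOn_det fun a b => ?_)
  by_cases h : a = j
  · simpa [Matrix.updateRow_apply, h] using contDiffOn_const
  · simpa [Matrix.updateRow_apply, h] using hA a b

theorem IsMetricOn.contDiffOn_christoffelCLM (hG : IsMetricOn G V) :
    ContDiffOn ℝ ∞ (christoffelCLM G) V := by
  have hD := hG.smooth.fderiv_of_isOpen hG.isOpen (m := ∞) (by simp)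
  have h3 : ∀ a b c : E n, ContDiffOn ℝ ∞ (fun y => fderiv ℝ G y a b c) V := fun a b c =>
    ((hD.clm_apply contDiffOn_const).clm_apply contDiffOn_const).clm_apply contDiffOn_const
  refine contDiffOn_clm_apply.2 fun v => contDiffOn_clm_apply.2 fun w => ?_
  simp only [christoffelCLM_apply, christoffel]
  refine contDiffOn_euclidean.2 fun k => ?_
  refine contDiffOn_const.mul (ContDiffOn.sum fun l _ => ContDiffOn.mul ?_ ?_)
  · exact contDiffOn_matrix_inv (fun i j => (hG.smooth.clm_apply contDiffOn_const).clm_apply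
      contDiffOn_const) (fun z hz => hG.gram_det_ne_zero hz) k l
  · exact ((h3 _ _ _).add (h3 _ _ _)).sub (h3 _ _ _)

theorem IsMetricOn.fderiv_christoffel (hG : IsMetricOn G V) {y : E n} (hy : y ∈ V) (u v w : E n) :
    fderiv ℝ (fun z => christoffel G z v w) y u = fderiv ℝ (christoffelCLM G) y u v w := by
  have hd := differentiableAt_of_contDiffOn hG.isOpen hG.contDiffOn_christoffelCLM hy
  change fderiv ℝ (fun z => christoffelCLM G z v w) y u = _
  rw [fderiv_clm_apply (hd.clm_apply (differentiableAt_const v)) (differentiableAt_const w),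
      fderiv_clm_apply hd (differentiableAt_const v)]
  simp

theorem IsMetricOn.curvature_eq (hG : IsMetricOn G V) {y : E n} (hy : y ∈ V) (u v w : E n) :
    curvature G y u v w = fderiv ℝ (christoffelCLM G) y u v w - fderiv ℝ (christoffelCLM G) y v u w
      + christoffelCLM G y u (christoffelCLM G y v w)
      - christoffelCLM G y v (christoffelCLM G y u w) := by
  simp [curvature, hG.fderiv_christoffel hy]

theorem IsMetricOn.fderiv_christoffelCLM_symm (hG : IsMetricOn G V) {y : E n} (hy : y ∈ V)
    (u v w : E n) :
    fderiv ℝ (christoffelCLM G) y u v w = fderiv ℝ (christoffelCLM G) y u w v := by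
  rw [← hG.fderiv_christoffel hy, ← hG.fderiv_christoffel hy,
    fderiv_congr_of_eqOn hG.isOpen (fun z hz => hG.christoffel_symm hz v w) hy]

theorem IsMetricOn.curvature_bianchi (hG : IsMetricOn G V) {y : E n} (hy : y ∈ V) (u v w : E n) :
    curvature G y u v w + curvature G y v w u + curvature G y w u v = 0 := by
  rw [hG.curvature_eq hy, hG.curvature_eq hy, hG.curvature_eq hy,
    hG.fderiv_christoffelCLM_symm hy u w v, hG.fderiv_christoffelCLM_symm hy v w u,
    hG.fderiv_christoffelCLM_symm hy w v u]
  simp only [christoffelCLM_apply, hG.christoffel_symm hy w v, hG.christoffel_symm hy w u,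
    hG.christoffel_symm hy v u]
  abel

/-- The curvature operator is skew with respect to the metric. -/
theorem IsMetricOn.curvature_skew_self (hG : IsMetricOn G V) {y : E n} (hy : y ∈ V) (u v w : E n) :
    G y (curvature G y u v w) w = 0 := by
  have hΓ := hG.contDiffOn_christoffelCLM
  have hGd := differentiableAt_of_contDiffOn hG.isOpen hG.smooth hy
  have hΓd := differentiableAt_of_contDiffOn hG.isOpen hΓ hy
  have h0 : ContDiffOn ℝ ∞ (fun z => G z w w) V :=
    (hG.smooth.clm_apply contDiffOn_const).clm_apply contDiffOn_const
  have h1 : ∀ a, Set.EqOn (fun z => fderiv ℝ (fun z => G z w w) z a)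
      (fun z => 2 * G z (christoffelCLM G z a w) w) V := by
    intro a z hz
    have hd := differentiableAt_of_contDiffOn hG.isOpen hG.smooth hz
    dsimp only
    rw [fderiv_clm_apply (hd.clm_apply (differentiableAt_const w)) (differentiableAt_const w),
      fderiv_clm_apply hd (differentiableAt_const w)]
    simp only [fderiv_fun_const, Pi.zero_apply, ContinuousLinearMap.comp_zero, zero_add,
      ContinuousLinearMap.flip_apply, christoffelCLM_apply]
    rw [hG.metric_compat hz, hG.symm z hz w]; ring
  have h2 : ∀ a b, fderiv ℝ (fun z => 2 * G z (christoffelCLM G z a w) w) y b =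
      2 * (fderiv ℝ G y b (christoffelCLM G y a w) w
        + G y (fderiv ℝ (christoffelCLM G) y b a w) w) := by
    intro a b
    have e2 := (hΓd.hasFDerivAt.clm_apply (hasFDerivAt_const a y)).clm_apply (hasFDerivAt_const w y)
    rw [(((hGd.hasFDerivAt.clm_apply e2).clm_apply (hasFDerivAt_const w y)).const_mul 2).fderiv]
    simp only [add_apply, smul_apply, ContinuousLinearMap.comp_apply,
      ContinuousLinearMap.flip_apply, zero_apply, map_zero, zero_add]
    rw [smul_eq_mul]; ring
  -- The mixed second derivatives of `|w|²` commute. Expanded by metric compatibility, the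
  -- difference of the two sides is `2 ⟨R(u, v)w, w⟩`.
  have h3 := fderiv_fderiv_comm hG.isOpen h0 hy u v
  rw [fderiv_congr_of_eqOn hG.isOpen (h1 u) hy, fderiv_congr_of_eqOn hG.isOpen (h1 v) hy,
    h2, h2, hG.metric_compat hy, hG.metric_compat hy] at h3
  rw [hG.curvature_eq hy]
  simp only [christoffelCLM_apply, map_add, map_sub, add_apply,
    sub_apply] at h3 ⊢
  rw [hG.symm y hy (christoffel G y v w)] at h3
  linarith

theorem IsMetricOn.curvature_add (hG : IsMetricOn G V) {y : E n} (hy : y ∈ V) (u v w z : E n) :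
    curvature G y u v (w + z) = curvature G y u v w + curvature G y u v z := by
  simp only [hG.curvature_eq hy, map_add]; abel

theorem IsMetricOn.curvature_add_left (hG : IsMetricOn G V) {y : E n} (hy : y ∈ V)
    (u v w z : E n) :
    curvature G y (u + z) v w = curvature G y u v w + curvature G y z v w := by
  simp only [hG.curvature_eq hy, map_add, add_apply]; abel

theorem IsMetricOn.curvature_swap (hG : IsMetricOn G V) {y : E n} (hy : y ∈ V) (u v w : E n) :
    curvature G y u v w = - curvature G y v u w := by
  simp only [hG.curvature_eq hy]; abel

/-- Constant sectional curvature determines the curvature tensor. -/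
theorem IsMetricOn.curvature_of_sectional (hG : IsMetricOn G V) {y : E n} (hy : y ∈ V) {c : ℝ}
    (hc : ∀ u v, G y (curvature G y u v v) u = c * (G y u u * G y v v - G y u v ^ 2))
    (u v w z : E n) :
    G y (curvature G y u v w) z = c * (G y v w * G y u z - G y u w * G y v z) := by
  -- `B` is the defect from the constant curvature model. It has all the algebraic symmetries of a
  -- curvature tensor and zero sectional curvature, which forces it to vanish.
  set B : E n → E n → E n → E n → ℝ := fun u v w z =>
    G y (curvature G y u v w) z - c * (G y v w * G y u z - G y u w * G y v z) with hB
  have s := hG.symm y hy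
  have b1 : ∀ u v w z, B u v w z = - B v u w z := fun u v w z => by
    simp only [hB, hG.curvature_swap hy u v, map_neg, neg_apply]; ring
  have b2 : ∀ u v w z, B u v w z = - B u v z w := fun u v w z => by
    have := hG.curvature_skew_self hy u v (w + z)
    have hw := hG.curvature_skew_self hy u v w
    have hz := hG.curvature_skew_self hy u v z
    simp only [hG.curvature_add hy, map_add, add_apply, hw, hz] at this
    simp only [hB]; linarith
  have b3 : ∀ u v w z, B u v w z + B v w u z + B w u v z = 0 := fun u v w z => by
    have := congrArg (fun q => G y q z) (hG.curvature_bianchi hy u v w)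
    simp only [map_add, add_apply, map_zero,
      zero_apply] at this
    simp only [hB, s v u, s w u, s w v]; linarith
  have b4 : ∀ u v, B u v v u = 0 := fun u v => by
    simp only [hB, hc, s v u]; ring
  have b5 : ∀ u u' v w z, B (u + u') v w z = B u v w z + B u' v w z := fun u u' v w z => by
    simp only [hB, hG.curvature_add_left hy, map_add, add_apply]; ring
  have b6 : ∀ u v w z z', B u v w (z + z') = B u v w z + B u v w z' := fun u v w z z' => by
    simp only [hB, map_add]; ring
  have pol : ∀ u u' v, B u v v u' + B u' v v u = 0 := fun u u' v => by
    have := b4 (u + u') v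
    rw [b5, b6, b6, b4, b4] at this; linarith
  -- Pair symmetry is the usual consequence of the Bianchi identity and the two skew symmetries,
  -- summed over four Bianchi relations.
  have pair : ∀ u v w z, B u v w z = B w z u v := fun u v w z => by
    linarith [b3 u v w z, b3 v w z u, b3 w z u v, b3 z u v w, b1 u v w z, b2 u v w z,
      b2 v w u z, b2 w u v z, b2 w z v u, b2 z v w u, b2 z u w v, b2 u w z v, b2 u v z w,
      b1 v z w u, b1 v w z u, b1 w z u v, b1 z u w v, b1 w u v z, b1 w u z v, b1 z u v w,
      b1 v z u w, b1 z v u w, b2 v z u w, b2 u w v z, b1 w z v u, b2 v w z u, b2 w z u v]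
  have b7 : ∀ u u' v, B u v v u' = 0 := fun u u' v => by
    have h1 := pol u u' v
    have h2 := pair u v v u'
    have h3 := b1 v u' u v
    have h4 := b2 u' v u v
    linarith
  -- Polarising `b7` makes `B` skew in its two middle arguments as well.
  have b8 : ∀ u v v' z, B u v v' z + B u v' v z = 0 := fun u v v' z => by
    have h1 := b7 u z (v + v')
    have h2 := b7 u z v
    have h3 := b7 u z v'
    rw [b1, b5, b2 v, b2 v', b6, b6] at h1
    linarith [b1 v u v z, b1 v' u v' z, b1 v u v' z, b1 v' u v z, b2 v u v z, b2 v u v' z,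
      b2 v' u v z, b2 v' u v' z, b2 v u z v, b2 v u z v', b2 v' u z v, b2 v' u z v']
  -- Skewness in the first and in the middle pair makes the three Bianchi terms equal, so `3B = 0`.
  have : B u v w z = 0 := by
    linarith [b3 u v w z, b8 u v w z, b8 v w u z, b8 w u v z, b1 u w v z, b1 v u w z, b1 w v u z]
  simpa [hB, sub_eq_zero] using this

end Coordinates

/-! ### The metric of `M` read in a chart. -/

section Ambient

variable {n : ℕ} {M : Type*} [TopologicalSpace M] [ChartedSpace (E n) M]
  [IsManifold 𝓘(ℝ, E n) ∞ M]

theorem mdifferentiable_of_mem_atlas' {φ : OpenPartialHomeomorph M (E n)}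
    (hφ : φ ∈ atlas (E n) M) : φ.MDifferentiable 𝓘(ℝ, E n) 𝓘(ℝ, E n) := by
  haveI : IsManifold 𝓘(ℝ, E n) 1 M := IsManifold.of_le (n := ∞) (by simp)
  exact mdifferentiable_of_mem_atlas hφ

theorem chart_contMDiffOn_symm {φ : OpenPartialHomeomorph M (E n)} (hφ : φ ∈ atlas (E n) M) :
    ContMDiffOn 𝓘(ℝ, E n) 𝓘(ℝ, E n) ∞ φ.symm φ.target :=
  contMDiffOn_symm_of_mem_maximalAtlas (IsManifold.subset_maximalAtlas hφ)

theorem chart_contMDiffOn {φ : OpenPartialHomeomorph M (E n)} (hφ : φ ∈ atlas (E n) M) :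
    ContMDiffOn 𝓘(ℝ, E n) 𝓘(ℝ, E n) ∞ φ φ.source :=
  contMDiffOn_of_mem_maximalAtlas (IsManifold.subset_maximalAtlas hφ)

theorem chartMetric_apply (g : Metric n M) (φ : OpenPartialHomeomorph M (E n)) (y v w : E n) :
    chartMetric g φ y v w = g.inner (φ.symm y) (mfderiv 𝓘(ℝ, E n) 𝓘(ℝ, E n) φ.symm y v)
      (mfderiv 𝓘(ℝ, E n) 𝓘(ℝ, E n) φ.symm y w) := rfl

theorem mfderiv_chart_symm_injective {φ : OpenPartialHomeomorph M (E n)}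
    (hφ : φ ∈ atlas (E n) M) {y : E n} (hy : y ∈ φ.target) :
    Function.Injective (mfderiv 𝓘(ℝ, E n) 𝓘(ℝ, E n) φ.symm y) :=
  (mdifferentiable_of_mem_atlas' hφ).symm.mfderiv_injective hy

/-- This is the tangent map of `φ.symm` composed with a constant section; it provides the smooth
fields into which the metric is fed. -/
theorem contMDiffOn_symm_tangent {φ : OpenPartialHomeomorph M (E n)}
    (hφ : φ ∈ atlas (E n) M) (v : E n) :
    ContMDiffOn 𝓘(ℝ, E n) (𝓘(ℝ, E n).prod 𝓘(ℝ, E n)) ∞ (fun y : E n =>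
      (Bundle.TotalSpace.mk' (E n) (E := fun x : M => TangentSpace 𝓘(ℝ, E n) x) (φ.symm y)
        (mfderiv 𝓘(ℝ, E n) 𝓘(ℝ, E n) φ.symm y v))) φ.target := by
  have h1 := (chart_contMDiffOn_symm hφ).contMDiffOn_tangentMapWithin (m := ∞) (by simp)
    φ.open_target.uniqueMDiffOn
  have h2 : ContMDiff 𝓘(ℝ, E n) (𝓘(ℝ, E n).prod 𝓘(ℝ, E n)) ∞ (fun y : E n =>
      (Bundle.TotalSpace.mk' (E n) (E := fun x : E n => TangentSpace 𝓘(ℝ, E n) x) y v)) := by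
    intro y
    rw [Bundle.contMDiffAt_totalSpace]
    refine ⟨contMDiffAt_id, ?_⟩
    simpa using contMDiffAt_const
  refine (h1.comp h2.contMDiffOn (fun y hy => hy)).congr fun y hy => ?_
  simp only [Function.comp, tangentMapWithin]
  rw [mfderivWithin_of_isOpen φ.open_target hy]

/-- The metric is a smooth section of a bundle of bilinear forms. Applied to two smooth fields along
`φ.symm` it gives a section of the trivial line bundle, that is, a smooth function. -/
theorem contDiffOn_chartMetric (g : Metric n M) {φ : OpenPartialHomeomorph M (E n)}
    (hφ : φ ∈ atlas (E n) M) : ContDiffOn ℝ ∞ (chartMetric g φ) φ.target := by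
  refine contDiffOn_clm_apply.2 fun v => contDiffOn_clm_apply.2 fun w => ?_
  intro y hy
  have hs := chart_contMDiffOn_symm hφ y hy
  have h1 : ContMDiffWithinAt 𝓘(ℝ, E n) (𝓘(ℝ, E n).prod 𝓘(ℝ, E n →L[ℝ] E n →L[ℝ] ℝ)) ∞
      (fun y : E n => Bundle.TotalSpace.mk' (E n →L[ℝ] E n →L[ℝ] ℝ)
        (E := fun x : M => (TangentSpace 𝓘(ℝ, E n) x →L[ℝ] TangentSpace 𝓘(ℝ, E n) x →L[ℝ] ℝ))
          (φ.symm y) (g.inner (φ.symm y))) φ.target y :=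
    ContMDiffAt.comp_contMDiffWithinAt y g.contMDiff.contMDiffAt hs
  have h2 := ContMDiffWithinAt.clm_bundle_apply₂ (F₁ := E n) (F₂ := E n) (F₃ := ℝ)
    (E₁ := fun x : M => TangentSpace 𝓘(ℝ, E n) x) (E₂ := fun x : M => TangentSpace 𝓘(ℝ, E n) x)
    (E₃ := Bundle.Trivial M ℝ) (b := φ.symm)
    h1 (contMDiffOn_symm_tangent hφ v y hy) (contMDiffOn_symm_tangent hφ w y hy)
  rw [Bundle.contMDiffWithinAt_totalSpace] at h2
  exact h2.2.contDiffWithinAt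

theorem isMetricOn_chartMetric (g : Metric n M) {φ : OpenPartialHomeomorph M (E n)}
    (hφ : φ ∈ atlas (E n) M) : IsMetricOn (chartMetric g φ) φ.target where
  isOpen := φ.open_target
  smooth := contDiffOn_chartMetric g hφ
  symm y hy v w := by
    rw [chartMetric_apply, chartMetric_apply]
    exact g.symm (φ.symm y) _ _
  pos y hy v hv := by
    rw [chartMetric_apply]
    refine g.pos (φ.symm y) _ fun h => hv (mfderiv_chart_symm_injective hφ hy ?_)
    rw [h]
    exact (map_zero _).symm

end Ambient

/-! ### The first fundamental form of the immersion in charts. -/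

section Surface

variable {n : ℕ} {M : Type*} [TopologicalSpace M] [ChartedSpace (E n) M]
  [IsManifold 𝓘(ℝ, E n) ∞ M]
  {S : Type*} [TopologicalSpace S] [ChartedSpace (E 2) S] [IsManifold 𝓘(ℝ, E 2) ∞ S]
  {g : Metric n M} {f : S → M × ℝ} {ψ : OpenPartialHomeomorph S (E 2)}
  {φ : OpenPartialHomeomorph M (E n)}

/-- The part of the chart `ψ` that `f` maps to the domain of `φ`. -/
def overlap (f : S → M × ℝ) (ψ : OpenPartialHomeomorph S (E 2))
    (φ : OpenPartialHomeomorph M (E n)) : Set (E 2) :=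
  ψ.target ∩ {x | (f (ψ.symm x)).1 ∈ φ.source}

theorem contMDiffOn_immersion (hf : IsImmersedSurface (n := n) f) (hψ : ψ ∈ atlas (E 2) S) :
    ContMDiffOn 𝓘(ℝ, E 2) (𝓘(ℝ, E n).prod 𝓘(ℝ, ℝ)) ∞ (fun x => f (ψ.symm x)) ψ.target :=
  hf.1.comp_contMDiffOn (chart_contMDiffOn_symm hψ)

theorem contMDiffOn_base (hf : IsImmersedSurface (n := n) f) (hψ : ψ ∈ atlas (E 2) S) :
    ContMDiffOn 𝓘(ℝ, E 2) 𝓘(ℝ, E n) ∞ (fun x => (f (ψ.symm x)).1) ψ.target :=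
  contMDiff_fst.comp_contMDiffOn (contMDiffOn_immersion hf hψ)

theorem contMDiffOn_height (hf : IsImmersedSurface (n := n) f) (hψ : ψ ∈ atlas (E 2) S) :
    ContMDiffOn 𝓘(ℝ, E 2) 𝓘(ℝ, ℝ) ∞ (height f ψ) ψ.target :=
  contMDiff_snd.comp_contMDiffOn (contMDiffOn_immersion hf hψ)

theorem contDiffOn_height (hf : IsImmersedSurface (n := n) f) (hψ : ψ ∈ atlas (E 2) S) :
    ContDiffOn ℝ ∞ (height f ψ) ψ.target :=
  (contMDiffOn_height hf hψ).contDiffOn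

theorem isOpen_overlap (hf : IsImmersedSurface (n := n) f) (hψ : ψ ∈ atlas (E 2) S) :
    IsOpen (overlap f ψ φ) :=
  (contMDiffOn_base hf hψ).continuousOn.isOpen_inter_preimage ψ.open_target φ.open_source

theorem contDiffOn_baseMap (hf : IsImmersedSurface (n := n) f) (hψ : ψ ∈ atlas (E 2) S)
    (hφ : φ ∈ atlas (E n) M) : ContDiffOn ℝ ∞ (baseMap f ψ φ) (overlap f ψ φ) :=
  ((chart_contMDiffOn hφ).comp ((contMDiffOn_base hf hψ).mono Set.inter_subset_left)
    fun _ hx => hx.2).contDiffOn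

theorem baseMap_mem_target {x : E 2} (hx : x ∈ overlap f ψ φ) : baseMap f ψ φ x ∈ φ.target :=
  φ.map_source hx.2

theorem mfderiv_base (hf : IsImmersedSurface (n := n) f) (hψ : ψ ∈ atlas (E 2) S)
    (hφ : φ ∈ atlas (E n) M) {x : E 2} (hx : x ∈ overlap f ψ φ) (v : E 2) :
    mfderiv 𝓘(ℝ, E 2) 𝓘(ℝ, E n) (fun z => (f (ψ.symm z)).1) x v =
      mfderiv 𝓘(ℝ, E n) 𝓘(ℝ, E n) φ.symm (baseMap f ψ φ x) (fderiv ℝ (baseMap f ψ φ) x v) := by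
  have hU : IsOpen (overlap f ψ φ) := isOpen_overlap hf hψ
  have hd : MDifferentiableAt 𝓘(ℝ, E 2) 𝓘(ℝ, E n) (baseMap f ψ φ) x :=
    (differentiableAt_of_contDiffOn hU (contDiffOn_baseMap hf hψ hφ) hx).mdifferentiableAt
  have hs := (mdifferentiable_of_mem_atlas' hφ).mdifferentiableAt_symm (baseMap_mem_target hx)
  have he : (fun z => (f (ψ.symm z)).1) =ᶠ[𝓝 x] φ.symm ∘ baseMap f ψ φ := by
    filter_upwards [hU.mem_nhds hx] with z hz
    exact (φ.left_inv hz.2).symm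
  have h1 : mfderiv 𝓘(ℝ, E 2) 𝓘(ℝ, E n) (fun z => (f (ψ.symm z)).1) x =
      mfderiv 𝓘(ℝ, E 2) 𝓘(ℝ, E n) (φ.symm ∘ baseMap f ψ φ) x := he.mfderiv_eq
  have h2 := mfderiv_comp x hs hd
  rw [mfderiv_eq_fderiv] at h2
  exact (congrArg (fun L : E 2 →L[ℝ] E n => L v) h1).trans
    (congrArg (fun L : E 2 →L[ℝ] E n => L v) h2)

/-- `firstForm` is defined without an ambient chart, all other quantities through one. The chain
rule for `φ.symm ∘ baseMap` reconciles the two. -/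
theorem firstForm_eq (hf : IsImmersedSurface (n := n) f) (hψ : ψ ∈ atlas (E 2) S)
    (hφ : φ ∈ atlas (E n) M) {x : E 2} (hx : x ∈ overlap f ψ φ) (i j : Fin 2) :
    firstForm g f ψ x i j =
      ambInner g f ψ φ x (coordField f ψ φ i x) (coordField f ψ φ j x) := by
  have hb : φ.symm (baseMap f ψ φ x) = (f (ψ.symm x)).1 := φ.left_inv hx.2
  simp only [firstForm, Matrix.of_apply, ambInner, coordField, chartMetric_apply, tComp]
  rw [hb]
  congr 1
  exact congrArg₂ (fun a b : E n => (g.inner (f (ψ.symm x)).1 : E n →L[ℝ] E n →L[ℝ] ℝ) a b)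
    (mfderiv_base hf hψ hφ hx (e i)) (mfderiv_base hf hψ hφ hx (e j))

/-- The differential of the immersion splits into its two components, so a vector killed by both is
killed by an injective map. -/
theorem immersion_injective (hf : IsImmersedSurface (n := n) f) (hψ : ψ ∈ atlas (E 2) S)
    {x : E 2} (hx : x ∈ ψ.target) {v : E 2}
    (h1 : mfderiv 𝓘(ℝ, E 2) 𝓘(ℝ, E n) (fun z => (f (ψ.symm z)).1) x v = 0)
    (h2 : fderiv ℝ (height f ψ) x v = 0) : v = 0 := by
  have hs := (mdifferentiable_of_mem_atlas' hψ).mdifferentiableAt_symm hx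
  have hfd : MDifferentiableAt 𝓘(ℝ, E 2) (𝓘(ℝ, E n).prod 𝓘(ℝ, ℝ)) f (ψ.symm x) :=
    (hf.1 _).mdifferentiableAt (by simp)
  have hc := mfderiv_comp x hfd hs
  have hb : MDifferentiableAt 𝓘(ℝ, E 2) 𝓘(ℝ, E n) (fun z => (f (ψ.symm z)).1) x :=
    ((contMDiffOn_base hf hψ).contMDiffAt (ψ.open_target.mem_nhds hx)).mdifferentiableAt (by simp)
  have hh : MDifferentiableAt 𝓘(ℝ, E 2) 𝓘(ℝ, ℝ) (height f ψ) x :=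
    ((contMDiffOn_height hf hψ).contMDiffAt (ψ.open_target.mem_nhds hx)).mdifferentiableAt (by simp)
  have hp := hb.mfderiv_prod hh
  have hz : mfderiv 𝓘(ℝ, E 2) (𝓘(ℝ, E n).prod 𝓘(ℝ, ℝ))
      (fun z => ((f (ψ.symm z)).1, height f ψ z)) x v = 0 := by
    rw [hp]
    refine Prod.ext h1 ?_
    change mfderiv 𝓘(ℝ, E 2) 𝓘(ℝ, ℝ) (height f ψ) x v = 0
    rw [mfderiv_eq_fderiv]
    exact h2
  have hz' : mfderiv 𝓘(ℝ, E 2) (𝓘(ℝ, E n).prod 𝓘(ℝ, ℝ)) (f ∘ ψ.symm) x v = 0 := hz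
  rw [hc] at hz'
  have h3 := hf.2 (ψ.symm x) (hz'.trans (map_zero _).symm)
  exact (mdifferentiable_of_mem_atlas' hψ).symm.mfderiv_injective hx
    (h3.trans (map_zero _).symm)

theorem firstForm_posDef (g : Metric n M) (hf : IsImmersedSurface (n := n) f)
    (hψ : ψ ∈ atlas (E 2) S)
    {x : E 2} (hx : x ∈ ψ.target) : (firstForm g f ψ x).PosDef := by
  refine Matrix.PosDef.of_dotProduct_mulVec_pos ?_ fun v hv => ?_
  · ext i j
    simp only [firstForm, Matrix.conjTranspose_apply, Matrix.of_apply, star_trivial]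
    rw [g.symm]; ring
  · set w : E 2 := WithLp.toLp 2 v with hw
    have hw0 : w ≠ 0 := fun h => hv (by simpa [hw] using congrArg WithLp.ofLp h)
    let D : E 2 →L[ℝ] E n := mfderiv 𝓘(ℝ, E 2) 𝓘(ℝ, E n) (fun z => (f (ψ.symm z)).1) x
    let B : E n →L[ℝ] E n →L[ℝ] ℝ := g.inner (f (ψ.symm x)).1
    have key : dotProduct (star v) ((firstForm g f ψ x).mulVec v) =
        B (D w) (D w) + fderiv ℝ (height f ψ) x w * fderiv ℝ (height f ψ) x w := by
      rw [clm_apply_sum_e D w, clm_apply_sum_e (fderiv ℝ (height f ψ) x) w]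
      have hij : ∀ i j, firstForm g f ψ x i j = B (D (e i)) (D (e j)) +
          fderiv ℝ (height f ψ) x (e i) * fderiv ℝ (height f ψ) x (e j) := fun _ _ => rfl
      simp only [dotProduct, Matrix.mulVec, Fin.sum_univ_two, hij,
        map_add, map_smul, add_apply, smul_apply, smul_eq_mul, star_trivial, hw]
      ring
    rw [key]
    by_cases hD : D w = 0
    · have h2 : fderiv ℝ (height f ψ) x w ≠ 0 := fun h2 => hw0 (immersion_injective hf hψ hx hD h2)
      rw [hD, map_zero, zero_add]
      exact mul_self_pos.2 h2
    · have : 0 < B (D w) (D w) := g.pos _ _ hD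
      have := mul_self_nonneg (fderiv ℝ (height f ψ) x w)
      linarith

theorem ambInner_symm (hφ : φ ∈ atlas (E n) M) {x : E 2} (hx : x ∈ overlap f ψ φ)
    (a b : E n × ℝ) : ambInner g f ψ φ x a b = ambInner g f ψ φ x b a := by
  simp only [ambInner]
  rw [(isMetricOn_chartMetric g hφ).symm _ (baseMap_mem_target hx), mul_comm]

theorem ambInner_pos (hφ : φ ∈ atlas (E n) M) {x : E 2} (hx : x ∈ overlap f ψ φ)
    {a : E n × ℝ} (ha : a ≠ 0) : 0 < ambInner g f ψ φ x a a := by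
  simp only [ambInner]
  by_cases h : a.1 = 0
  · have : a.2 ≠ 0 := fun h2 => ha (Prod.ext h h2)
    simpa [h] using this
  · have := (isMetricOn_chartMetric g hφ).pos _ (baseMap_mem_target hx) _ h
    nlinarith [mul_self_nonneg a.2]

end Surface

section ScalarCalculus

variable {U : Set (E 2)} {a b : E 2 → ℝ} {x : E 2}

theorem fderiv_mul_apply (hU : IsOpen U) (ha : ContDiffOn ℝ ∞ a U) (hb : ContDiffOn ℝ ∞ b U)
    (hx : x ∈ U) (v : E 2) : fderiv ℝ (fun z => a z * b z) x v =
      fderiv ℝ a x v * b x + a x * fderiv ℝ b x v := by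
  rw [fderiv_fun_mul (differentiableAt_of_contDiffOn hU ha hx)
    (differentiableAt_of_contDiffOn hU hb hx)]
  simp; ring

theorem fderiv_add_apply (hU : IsOpen U) (ha : ContDiffOn ℝ ∞ a U) (hb : ContDiffOn ℝ ∞ b U)
    (hx : x ∈ U) (v : E 2) : fderiv ℝ (fun z => a z + b z) x v =
      fderiv ℝ a x v + fderiv ℝ b x v := by
  rw [fderiv_fun_add (differentiableAt_of_contDiffOn hU ha hx)
    (differentiableAt_of_contDiffOn hU hb hx)]
  simp

theorem fderiv_sub_apply (hU : IsOpen U) (ha : ContDiffOn ℝ ∞ a U) (hb : ContDiffOn ℝ ∞ b U)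
    (hx : x ∈ U) (v : E 2) : fderiv ℝ (fun z => a z - b z) x v =
      fderiv ℝ a x v - fderiv ℝ b x v := by
  rw [fderiv_fun_sub (differentiableAt_of_contDiffOn hU ha hx)
    (differentiableAt_of_contDiffOn hU hb hx)]
  simp

end ScalarCalculus

/-! ### Abstract surface data and its Gram-Schmidt frame. -/

variable {W : Type*} [NormedAddCommGroup W] [NormedSpace ℝ W]

/-- A surface in a product `M × ℝ` with `M` of constant curvature `c`, seen from a coordinate
domain `U` of the surface: the pull-back of the tangent bundle of the ambient space, trivialised
with fibre `W`, its metric `ip` and connection `D`, the coordinate fields `X i`, the Gram matrix `gm`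
of the coordinate fields, the unit field `ξ` and the functional `ht = ⟨·, ξ⟩`. -/
structure SurfaceData (W : Type*) [NormedAddCommGroup W] [NormedSpace ℝ W] where
  U : Set (E 2)
  c : ℝ
  gm : E 2 → Matrix (Fin 2) (Fin 2) ℝ
  ip : E 2 → W →ₗ[ℝ] W →ₗ[ℝ] ℝ
  D : Fin 2 → (E 2 → W) → E 2 → W
  X : Fin 2 → E 2 → W
  ξ : W
  ht : W →L[ℝ] ℝ
  isOpen : IsOpen U
  gm_eq : ∀ x ∈ U, ∀ i j, gm x i j = ip x (X i x) (X j x)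
  gm_posDef : ∀ x ∈ U, (gm x).PosDef
  ip_symm : ∀ x ∈ U, ∀ v w, ip x v w = ip x w v
  ip_pos : ∀ x ∈ U, ∀ v, v ≠ 0 → 0 < ip x v v
  ip_smooth : ∀ V V' : E 2 → W, ContDiffOn ℝ ∞ V U → ContDiffOn ℝ ∞ V' U →
    ContDiffOn ℝ ∞ (fun z => ip z (V z) (V' z)) U
  X_smooth : ∀ i, ContDiffOn ℝ ∞ (X i) U
  D_smooth : ∀ i V, ContDiffOn ℝ ∞ V U → ContDiffOn ℝ ∞ (D i V) U
  D_congr : ∀ i V V', Set.EqOn V V' U → Set.EqOn (D i V) (D i V') U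
  D_add : ∀ i V V', ContDiffOn ℝ ∞ V U → ContDiffOn ℝ ∞ V' U → ∀ x ∈ U,
    D i (fun z => V z + V' z) x = D i V x + D i V' x
  D_smul : ∀ i (a : E 2 → ℝ) V, ContDiffOn ℝ ∞ a U → ContDiffOn ℝ ∞ V U → ∀ x ∈ U,
    D i (fun z => a z • V z) x = fderiv ℝ a x (e i) • V x + a x • D i V x
  D_compat : ∀ i V V', ContDiffOn ℝ ∞ V U → ContDiffOn ℝ ∞ V' U → ∀ x ∈ U,
    fderiv ℝ (fun z => ip z (V z) (V' z)) x (e i) = ip x (D i V x) (V' x) + ip x (V x) (D i V' x)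
  D_torsion : ∀ x ∈ U, D 0 (X 1) x = D 1 (X 0) x
  D_ht : ∀ i V, ContDiffOn ℝ ∞ V U → ∀ x ∈ U,
    fderiv ℝ (fun z => ht (V z)) x (e i) = ht (D i V x)
  ip_ξ : ∀ x ∈ U, ∀ v, ip x v ξ = ht v
  ht_ξ : ht ξ = 1
  D_curvature : ∀ V, ContDiffOn ℝ ∞ V U → ∀ x ∈ U, ∀ w,
    ip x (D 0 (D 1 V) x) w - ip x (D 1 (D 0 V) x) w =
      c * ((ip x (X 1 x) (V x) - ht (X 1 x) * ht (V x)) * (ip x (X 0 x) w - ht (X 0 x) * ht w)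
        - (ip x (X 0 x) (V x) - ht (X 0 x) * ht (V x)) * (ip x (X 1 x) w - ht (X 1 x) * ht w))

namespace SurfaceData

variable (s : SurfaceData W)

/-- The component of `a` normal to the surface. -/
def nor (x : E 2) (a : W) : W :=
  a - ∑ i, ∑ j, ((s.gm x)⁻¹ i j * s.ip x a (s.X j x)) • s.X i x

/-- The second fundamental form. -/
def sec (i j : Fin 2) (x : E 2) : W := s.nor x (s.D i (s.X j) x)

/-- The mean curvature vector. -/
def mcv (x : E 2) : W := (1 / 2 : ℝ) • ∑ i, ∑ j, (s.gm x)⁻¹ i j • s.sec i j x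

/-- The entries of the triangular matrix of the coordinate fields in the Gram-Schmidt frame. -/
def r (x : E 2) : ℝ := √(s.gm x 0 0)
/-- The Cholesky entry in position `(0, 1)`. -/
def k (x : E 2) : ℝ := s.gm x 0 1 / s.r x
/-- The lower Cholesky diagonal entry. -/
def l (x : E 2) : ℝ := √(s.gm x 1 1 - s.k x ^ 2)

/-- The first vector of the Gram-Schmidt frame of the coordinate fields. -/
def e₁ (x : E 2) : W := (s.r x)⁻¹ • s.X 0 x
/-- The second vector of the Gram-Schmidt frame of the coordinate fields. -/
def e₂ (x : E 2) : W := (s.l x)⁻¹ • (s.X 1 x + (-s.k x) • s.e₁ x)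

/-- The connection form of the Gram-Schmidt frame. -/
def conn (i : Fin 2) (x : E 2) : ℝ := s.ip x (s.D i s.e₁ x) (s.e₂ x)

variable {s} {x : E 2}

theorem gm_smooth (i j : Fin 2) : ContDiffOn ℝ ∞ (fun x => s.gm x i j) s.U :=
  (s.ip_smooth _ _ (s.X_smooth i) (s.X_smooth j)).congr fun x hx => s.gm_eq x hx i j

theorem gm_symm (hx : x ∈ s.U) : s.gm x 1 0 = s.gm x 0 1 := by
  rw [s.gm_eq x hx, s.gm_eq x hx, s.ip_symm x hx]

theorem gm_zero_zero_pos (hx : x ∈ s.U) : 0 < s.gm x 0 0 := (s.gm_posDef x hx).diag_pos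

theorem gm_det_pos (hx : x ∈ s.U) :
    0 < s.gm x 0 0 * s.gm x 1 1 - s.gm x 0 1 * s.gm x 0 1 := by
  have := (s.gm_posDef x hx).det_pos
  rwa [Matrix.det_fin_two, gm_symm hx] at this

theorem r_pos (hx : x ∈ s.U) : 0 < s.r x := Real.sqrt_pos.2 (gm_zero_zero_pos hx)

theorem r_sq (hx : x ∈ s.U) : s.gm x 0 0 = s.r x ^ 2 :=
  (Real.sq_sqrt (gm_zero_zero_pos hx).le).symm

theorem r_mul_k (hx : x ∈ s.U) : s.gm x 0 1 = s.r x * s.k x := by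
  have := (r_pos hx).ne'
  simp only [k]; field_simp

theorem l_sq_pos (hx : x ∈ s.U) : 0 < s.gm x 1 1 - s.k x ^ 2 := by
  have h1 := gm_det_pos hx
  have h2 := r_pos hx
  rw [r_sq hx, r_mul_k hx] at h1
  -- The Gram determinant is `r² (g₁₁ - k²)`.
  have h3 : 0 < s.r x ^ 2 * (s.gm x 1 1 - s.k x ^ 2) := by nlinarith
  exact (pos_iff_pos_of_mul_pos h3).1 (by positivity)

theorem l_pos (hx : x ∈ s.U) : 0 < s.l x := Real.sqrt_pos.2 (l_sq_pos hx)

theorem l_sq (hx : x ∈ s.U) : s.gm x 1 1 = s.k x ^ 2 + s.l x ^ 2 := by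
  rw [l, Real.sq_sqrt (l_sq_pos hx).le]; ring

theorem gm_eq_frame (hx : x ∈ s.U) : s.gm x =
    !![s.r x ^ 2, s.r x * s.k x; s.r x * s.k x, s.k x ^ 2 + s.l x ^ 2] := by
  ext i j
  fin_cases i <;> fin_cases j
  · exact r_sq hx
  · exact r_mul_k hx
  · exact (gm_symm hx).trans (r_mul_k hx)
  · exact l_sq hx

theorem gm_det (hx : x ∈ s.U) : (s.gm x).det = (s.r x * s.l x) ^ 2 := by
  rw [gm_eq_frame hx, Matrix.det_fin_two_of]; ring

theorem gm_inv_eq_frame (hx : x ∈ s.U) : (s.gm x)⁻¹ =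
    !![(s.k x ^ 2 + s.l x ^ 2) / (s.r x * s.l x) ^ 2, -s.k x / (s.r x * s.l x ^ 2);
      -s.k x / (s.r x * s.l x ^ 2), 1 / s.l x ^ 2] := by
  have h1 := (r_pos hx).ne'
  have h2 := (l_pos hx).ne'
  refine Matrix.inv_eq_left_inv ?_
  rw [gm_eq_frame hx]
  ext i j
  fin_cases i <;> fin_cases j <;> simp [Matrix.mul_apply, Fin.sum_univ_two] <;> field_simp <;> ring

theorem r_smooth : ContDiffOn ℝ ∞ s.r s.U :=
  (gm_smooth 0 0).sqrt fun _ hx => (gm_zero_zero_pos hx).ne'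

theorem k_smooth : ContDiffOn ℝ ∞ s.k s.U :=
  (gm_smooth 0 1).div r_smooth fun _ hx => (r_pos hx).ne'

theorem l_smooth : ContDiffOn ℝ ∞ s.l s.U :=
  ((gm_smooth 1 1).sub (k_smooth.pow 2)).sqrt fun _ hx => (l_sq_pos hx).ne'

theorem e₁_smooth : ContDiffOn ℝ ∞ s.e₁ s.U :=
  (r_smooth.inv fun _ hx => (r_pos hx).ne').smul (s.X_smooth 0)

theorem e₂_smooth : ContDiffOn ℝ ∞ s.e₂ s.U :=
  (l_smooth.inv fun _ hx => (l_pos hx).ne').smul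
    ((s.X_smooth 1).add (k_smooth.neg.smul e₁_smooth))

theorem conn_smooth (i : Fin 2) : ContDiffOn ℝ ∞ (s.conn i) s.U :=
  s.ip_smooth _ _ (s.D_smooth i _ e₁_smooth) e₂_smooth

theorem X_zero (hx : x ∈ s.U) : s.X 0 x = s.r x • s.e₁ x := by
  rw [e₁, smul_smul, mul_inv_cancel₀ (r_pos hx).ne', one_smul]

theorem X_one (hx : x ∈ s.U) : s.X 1 x = s.k x • s.e₁ x + s.l x • s.e₂ x := by
  rw [e₂, smul_smul, mul_inv_cancel₀ (l_pos hx).ne', one_smul]; module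

theorem ip_e₁_e₁ (hx : x ∈ s.U) : s.ip x (s.e₁ x) (s.e₁ x) = 1 := by
  have h1 := (r_pos hx).ne'
  simp only [e₁, map_smul, LinearMap.smul_apply, smul_eq_mul, ← s.gm_eq x hx, r_sq hx]
  field_simp

theorem ip_e₁_X_one (hx : x ∈ s.U) : s.ip x (s.e₁ x) (s.X 1 x) = s.k x := by
  have h1 := (r_pos hx).ne'
  simp only [e₁, map_smul, LinearMap.smul_apply, smul_eq_mul, ← s.gm_eq x hx, r_mul_k hx]
  field_simp

theorem ip_e₁_e₂ (hx : x ∈ s.U) : s.ip x (s.e₁ x) (s.e₂ x) = 0 := by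
  simp only [e₂, map_smul, map_add, smul_eq_mul, ip_e₁_e₁ hx, ip_e₁_X_one hx]
  ring

theorem ip_e₂_e₁ (hx : x ∈ s.U) : s.ip x (s.e₂ x) (s.e₁ x) = 0 := by
  rw [s.ip_symm x hx, ip_e₁_e₂ hx]

theorem ip_e₂_e₂ (hx : x ∈ s.U) : s.ip x (s.e₂ x) (s.e₂ x) = 1 := by
  have h2 := (l_pos hx).ne'
  have h : s.ip x (s.X 1 x) (s.X 1 x) = s.k x ^ 2 + s.l x ^ 2 := by
    rw [← s.gm_eq x hx, l_sq hx]
  rw [X_one hx] at h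
  simp only [map_smul, map_add, smul_eq_mul, LinearMap.add_apply, LinearMap.smul_apply,
    ip_e₁_e₁ hx, ip_e₁_e₂ hx, ip_e₂_e₁ hx] at h
  have h3 : s.l x ^ 2 * (s.ip x (s.e₂ x) (s.e₂ x) - 1) = 0 := by linear_combination h
  have := (mul_eq_zero.1 h3).resolve_left (pow_ne_zero 2 h2)
  linarith

/-- The orthogonal decomposition in the frame. -/
theorem nor_eq (hx : x ∈ s.U) (a : W) : s.nor x a =
    a - (s.ip x a (s.e₁ x) • s.e₁ x + s.ip x a (s.e₂ x) • s.e₂ x) := by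
  have h1 := (r_pos hx).ne'
  have h2 := (l_pos hx).ne'
  rw [nor]
  congr 1
  simp only [Fin.sum_univ_two, gm_inv_eq_frame hx, X_zero hx, X_one hx, map_add, map_smul,
    smul_eq_mul, Matrix.of_apply, Matrix.cons_val', Matrix.cons_val_zero, Matrix.cons_val_one,
    Matrix.cons_val_fin_one]
  match_scalars <;> field_simp <;> ring

theorem nor_add (x : E 2) (a b : W) : s.nor x (a + b) = s.nor x a + s.nor x b := by
  simp only [nor, Fin.sum_univ_two, map_add, LinearMap.add_apply]; module

theorem nor_smul (x : E 2) (t : ℝ) (a : W) : s.nor x (t • a) = t • s.nor x a := by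
  simp only [nor, Fin.sum_univ_two, map_smul, LinearMap.smul_apply, smul_eq_mul]; module

theorem nor_smooth {V : E 2 → W} (hV : ContDiffOn ℝ ∞ V s.U) :
    ContDiffOn ℝ ∞ (fun z => s.nor z (V z)) s.U := by
  have h : ContDiffOn ℝ ∞ (fun z => V z - (s.ip z (V z) (s.e₁ z) • s.e₁ z
      + s.ip z (V z) (s.e₂ z) • s.e₂ z)) s.U :=
    hV.sub (((s.ip_smooth _ _ hV e₁_smooth).smul e₁_smooth).add
      ((s.ip_smooth _ _ hV e₂_smooth).smul e₂_smooth))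
  exact h.congr fun z hz => nor_eq hz _

theorem ip_nor_e₁ (hx : x ∈ s.U) (a : W) : s.ip x (s.nor x a) (s.e₁ x) = 0 := by
  rw [nor_eq hx]
  simp only [map_sub, map_add, map_smul, LinearMap.sub_apply, LinearMap.add_apply,
    LinearMap.smul_apply, smul_eq_mul, ip_e₁_e₁ hx, ip_e₂_e₁ hx]
  ring

theorem ip_nor_e₂ (hx : x ∈ s.U) (a : W) : s.ip x (s.nor x a) (s.e₂ x) = 0 := by
  rw [nor_eq hx]
  simp only [map_sub, map_add, map_smul, LinearMap.sub_apply, LinearMap.add_apply,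
    LinearMap.smul_apply, smul_eq_mul, ip_e₁_e₂ hx, ip_e₂_e₂ hx]
  ring

theorem nor_e₁ (hx : x ∈ s.U) : s.nor x (s.e₁ x) = 0 := by
  rw [nor_eq hx, ip_e₁_e₁ hx, ip_e₁_e₂ hx]; module

theorem nor_e₂ (hx : x ∈ s.U) : s.nor x (s.e₂ x) = 0 := by
  rw [nor_eq hx, ip_e₂_e₁ hx, ip_e₂_e₂ hx]; module

/-- Differentiate `⟨e₁, e₁⟩ = 1`. With the two analogues below, the tangential parts of the
derivatives of the frame are governed by the single form `conn`. -/
theorem ip_D_e₁_e₁ (hx : x ∈ s.U) (i : Fin 2) : s.ip x (s.D i s.e₁ x) (s.e₁ x) = 0 := by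
  have h := s.D_compat i _ _ e₁_smooth e₁_smooth x hx
  rw [fderiv_congr_of_eqOn s.isOpen (g := fun _ => (1 : ℝ)) (fun z hz => ip_e₁_e₁ hz) hx,
    s.ip_symm x hx (s.e₁ x)] at h
  simp at h
  linarith

theorem ip_D_e₂_e₂ (hx : x ∈ s.U) (i : Fin 2) : s.ip x (s.D i s.e₂ x) (s.e₂ x) = 0 := by
  have h := s.D_compat i _ _ e₂_smooth e₂_smooth x hx
  rw [fderiv_congr_of_eqOn s.isOpen (g := fun _ => (1 : ℝ)) (fun z hz => ip_e₂_e₂ hz) hx,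
    s.ip_symm x hx (s.e₂ x)] at h
  simp at h
  linarith

theorem ip_D_e₂_e₁ (hx : x ∈ s.U) (i : Fin 2) :
    s.ip x (s.D i s.e₂ x) (s.e₁ x) = - s.conn i x := by
  have h := s.D_compat i _ _ e₁_smooth e₂_smooth x hx
  rw [fderiv_congr_of_eqOn s.isOpen (g := fun _ => (0 : ℝ)) (fun z hz => ip_e₁_e₂ hz) hx,
    s.ip_symm x hx (s.e₁ x)] at h
  simp at h
  simp only [conn]
  linarith

theorem D_e₁ (hx : x ∈ s.U) (i : Fin 2) :
    s.D i s.e₁ x = s.conn i x • s.e₂ x + s.nor x (s.D i s.e₁ x) := by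
  rw [nor_eq hx, ip_D_e₁_e₁ hx, conn]; module

theorem D_e₂ (hx : x ∈ s.U) (i : Fin 2) :
    s.D i s.e₂ x = (-s.conn i x) • s.e₁ x + s.nor x (s.D i s.e₂ x) := by
  rw [nor_eq hx, ip_D_e₂_e₂ hx, ip_D_e₂_e₁ hx]; module

theorem D_X_zero (hx : x ∈ s.U) (i : Fin 2) : s.D i (s.X 0) x =
    fderiv ℝ s.r x (e i) • s.e₁ x + s.r x • s.D i s.e₁ x := by
  rw [s.D_congr i _ (fun z => s.r z • s.e₁ z) (fun z hz => X_zero hz) hx,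
    s.D_smul i _ _ r_smooth e₁_smooth x hx]

theorem D_X_one (hx : x ∈ s.U) (i : Fin 2) : s.D i (s.X 1) x =
    fderiv ℝ s.k x (e i) • s.e₁ x + s.k x • s.D i s.e₁ x
      + (fderiv ℝ s.l x (e i) • s.e₂ x + s.l x • s.D i s.e₂ x) := by
  rw [s.D_congr i _ (fun z => s.k z • s.e₁ z + s.l z • s.e₂ z) (fun z hz => X_one hz) hx,
    s.D_add i (fun z => s.k z • s.e₁ z) (fun z => s.l z • s.e₂ z) (k_smooth.smul e₁_smooth)
      (l_smooth.smul e₂_smooth) x hx,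
    s.D_smul i _ _ k_smooth e₁_smooth x hx, s.D_smul i _ _ l_smooth e₂_smooth x hx]

theorem ip_D_e₁_e₂ (i : Fin 2) : s.ip x (s.D i s.e₁ x) (s.e₂ x) = s.conn i x := rfl

/-- The first structure equation, tested against `e₁`. -/
theorem structure_e₁ (hx : x ∈ s.U) :
    fderiv ℝ s.k x (e 0) - s.l x * s.conn 0 x = fderiv ℝ s.r x (e 1) := by
  have h := congrArg (fun v => s.ip x v (s.e₁ x)) (s.D_torsion x hx)
  simp only [D_X_zero hx, D_X_one hx, map_add, map_smul, LinearMap.add_apply,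
    LinearMap.smul_apply, smul_eq_mul, ip_e₁_e₁ hx, ip_e₂_e₁ hx, ip_D_e₁_e₁ hx, ip_D_e₂_e₁ hx] at h
  linear_combination h

/-- The first structure equation, tested against `e₂`. -/
theorem structure_e₂ (hx : x ∈ s.U) :
    s.k x * s.conn 0 x + fderiv ℝ s.l x (e 0) = s.r x * s.conn 1 x := by
  have h := congrArg (fun v => s.ip x v (s.e₂ x)) (s.D_torsion x hx)
  simp only [D_X_zero hx, D_X_one hx, map_add, map_smul, LinearMap.add_apply,
    LinearMap.smul_apply, smul_eq_mul, ip_e₁_e₂ hx, ip_e₂_e₂ hx, ip_D_e₂_e₂ hx, ip_D_e₁_e₂] at h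
  linear_combination h

variable (s) in
/-- The second fundamental form in the frame. -/
def σ₁₁ (x : E 2) : W := (s.r x)⁻¹ • s.nor x (s.D 0 s.e₁ x)
variable (s) in
/-- The second fundamental form on `(e₁, e₂)`. -/
def σ₁₂ (x : E 2) : W := (s.r x)⁻¹ • s.nor x (s.D 0 s.e₂ x)
variable (s) in
/-- The second fundamental form on `(e₂, e₂)`. -/
def σ₂₂ (x : E 2) : W :=
  (s.l x)⁻¹ • (s.nor x (s.D 1 s.e₂ x) - s.k x • s.σ₁₂ x)

theorem nor_D_zero_e₁ (hx : x ∈ s.U) : s.nor x (s.D 0 s.e₁ x) = s.r x • s.σ₁₁ x := by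
  rw [σ₁₁, smul_smul, mul_inv_cancel₀ (r_pos hx).ne', one_smul]

theorem nor_D_zero_e₂ (hx : x ∈ s.U) : s.nor x (s.D 0 s.e₂ x) = s.r x • s.σ₁₂ x := by
  rw [σ₁₂, smul_smul, mul_inv_cancel₀ (r_pos hx).ne', one_smul]

theorem nor_D_one_e₂ (hx : x ∈ s.U) :
    s.nor x (s.D 1 s.e₂ x) = s.k x • s.σ₁₂ x + s.l x • s.σ₂₂ x := by
  rw [σ₂₂, smul_smul, mul_inv_cancel₀ (l_pos hx).ne', one_smul]; module

/-- This is the symmetry of the second fundamental form: the normal part of the torsion identity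
turns `σ(e₂, e₁)` into `σ₁₂`, which was defined through `D 0 e₂`. -/
theorem nor_D_one_e₁ (hx : x ∈ s.U) :
    s.nor x (s.D 1 s.e₁ x) = s.k x • s.σ₁₁ x + s.l x • s.σ₁₂ x := by
  have h := congrArg (s.nor x) (s.D_torsion x hx)
  simp only [D_X_zero hx, D_X_one hx, nor_add, nor_smul, nor_e₁ hx, nor_e₂ hx, nor_D_zero_e₁ hx,
    nor_D_zero_e₂ hx, smul_zero, zero_add] at h
  have h1 := (r_pos hx).ne'
  have h2 := congrArg (fun v => (s.r x)⁻¹ • v) h.symm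
  simp only [smul_smul, inv_mul_cancel₀ h1, one_smul] at h2
  rw [h2]
  match_scalars <;> field_simp

theorem sec_zero_zero (hx : x ∈ s.U) : s.sec 0 0 x = s.r x ^ 2 • s.σ₁₁ x := by
  simp only [sec, D_X_zero hx, nor_add, nor_smul, nor_e₁ hx, nor_D_zero_e₁ hx]; module

theorem sec_one_zero (hx : x ∈ s.U) :
    s.sec 1 0 x = (s.r x * s.k x) • s.σ₁₁ x + (s.r x * s.l x) • s.σ₁₂ x := by
  simp only [sec, D_X_zero hx, nor_add, nor_smul, nor_e₁ hx, nor_D_one_e₁ hx]; module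

theorem sec_zero_one (hx : x ∈ s.U) :
    s.sec 0 1 x = (s.r x * s.k x) • s.σ₁₁ x + (s.r x * s.l x) • s.σ₁₂ x := by
  rw [← sec_one_zero hx, sec, sec, s.D_torsion x hx]

theorem sec_one_one (hx : x ∈ s.U) : s.sec 1 1 x = s.k x ^ 2 • s.σ₁₁ x
    + (2 * s.k x * s.l x) • s.σ₁₂ x + s.l x ^ 2 • s.σ₂₂ x := by
  simp only [sec, D_X_one hx, nor_add, nor_smul, nor_e₁ hx, nor_e₂ hx, nor_D_one_e₁ hx,
    nor_D_one_e₂ hx]; module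

theorem mcv_eq (hx : x ∈ s.U) : s.mcv x = (1 / 2 : ℝ) • (s.σ₁₁ x + s.σ₂₂ x) := by
  have h1 := (r_pos hx).ne'
  have h2 := (l_pos hx).ne'
  rw [mcv]
  simp only [Fin.sum_univ_two, gm_inv_eq_frame hx, sec_zero_zero hx, sec_zero_one hx,
    sec_one_zero hx, sec_one_one hx, Matrix.of_apply, Matrix.cons_val', Matrix.cons_val_zero,
    Matrix.cons_val_one, Matrix.cons_val_fin_one]
  match_scalars <;> field_simp <;> ring

theorem sec_smooth (i j : Fin 2) : ContDiffOn ℝ ∞ (s.sec i j) s.U :=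
  nor_smooth (s.D_smooth i _ (s.X_smooth j))

theorem mcv_smooth : ContDiffOn ℝ ∞ s.mcv s.U :=
  (ContDiffOn.sum fun i _ => ContDiffOn.sum fun j _ =>
    (contDiffOn_matrix_inv (fun i j => gm_smooth i j)
      (fun _ hz => (s.gm_posDef _ hz).det_pos.ne') i j).smul (sec_smooth i j)).const_smul _

/-- Bilinear forms on the tangent plane in the coordinates and in the frame. -/
theorem trace_eq_frame (hx : x ∈ s.U) {b : Matrix (Fin 2) (Fin 2) ℝ} {b₁₁ b₁₂ b₂₂ : ℝ}
    (h00 : b 0 0 = s.r x ^ 2 * b₁₁) (h01 : b 0 1 = s.r x * (s.k x * b₁₁ + s.l x * b₁₂))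
    (h10 : b 1 0 = s.r x * (s.k x * b₁₁ + s.l x * b₁₂))
    (h11 : b 1 1 = s.k x ^ 2 * b₁₁ + 2 * s.k x * s.l x * b₁₂ + s.l x ^ 2 * b₂₂) :
    ((s.gm x)⁻¹ * b).trace = b₁₁ + b₂₂ := by
  have h1 := (r_pos hx).ne'
  have h2 := (l_pos hx).ne'
  simp only [Matrix.trace_fin_two, Matrix.mul_apply, Fin.sum_univ_two, gm_inv_eq_frame hx, h00, h01,
    h10, h11, Matrix.of_apply, Matrix.cons_val', Matrix.cons_val_zero,
    Matrix.cons_val_one, Matrix.cons_val_fin_one]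
  field_simp
  ring

/-- The four hypotheses say that `b` is the form with entries `b₁₁, b₁₂, b₂₂` in the frame,
conjugated by the triangular change of basis. The frame is orthonormal, so the norm is the sum of
squares. -/
theorem hs_eq_frame (hx : x ∈ s.U) {b : Matrix (Fin 2) (Fin 2) ℝ} {b₁₁ b₁₂ b₂₂ : ℝ}
    (h00 : b 0 0 = s.r x ^ 2 * b₁₁) (h01 : b 0 1 = s.r x * (s.k x * b₁₁ + s.l x * b₁₂))
    (h10 : b 1 0 = s.r x * (s.k x * b₁₁ + s.l x * b₁₂))
    (h11 : b 1 1 = s.k x ^ 2 * b₁₁ + 2 * s.k x * s.l x * b₁₂ + s.l x ^ 2 * b₂₂) :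
    ∑ i, ∑ j, ∑ k, ∑ l, (s.gm x)⁻¹ i k * (s.gm x)⁻¹ j l * b i j * b k l =
      b₁₁ ^ 2 + 2 * b₁₂ ^ 2 + b₂₂ ^ 2 := by
  have h1 := (r_pos hx).ne'
  have h2 := (l_pos hx).ne'
  simp only [Fin.sum_univ_two, gm_inv_eq_frame hx, h00, h01,
    h10, h11, Matrix.of_apply, Matrix.cons_val', Matrix.cons_val_zero,
    Matrix.cons_val_one, Matrix.cons_val_fin_one]
  field_simp
  ring

theorem normSq_sec_eq_frame (hx : x ∈ s.U) :
    ∑ i, ∑ j, ∑ k, ∑ l, (s.gm x)⁻¹ i k * (s.gm x)⁻¹ j l *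
      s.ip x (s.sec i j x) (s.sec k l x) =
      s.ip x (s.σ₁₁ x) (s.σ₁₁ x) + 2 * s.ip x (s.σ₁₂ x) (s.σ₁₂ x)
        + s.ip x (s.σ₂₂ x) (s.σ₂₂ x) := by
  have h1 := (r_pos hx).ne'
  have h2 := (l_pos hx).ne'
  simp only [Fin.sum_univ_two, gm_inv_eq_frame hx, sec_zero_zero hx, sec_zero_one hx,
    sec_one_zero hx, sec_one_one hx, Matrix.of_apply, Matrix.cons_val', Matrix.cons_val_zero,
    Matrix.cons_val_one, Matrix.cons_val_fin_one, map_add, map_smul, LinearMap.add_apply,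
    LinearMap.smul_apply, smul_eq_mul, s.ip_symm x hx (s.σ₁₂ x) (s.σ₁₁ x),
    s.ip_symm x hx (s.σ₂₂ x) (s.σ₁₁ x), s.ip_symm x hx (s.σ₂₂ x) (s.σ₁₂ x)]
  field_simp
  ring

end SurfaceData

namespace SurfaceData

variable {W : Type*} [NormedAddCommGroup W] [NormedSpace ℝ W]

/-! ### Simons formula for traceless Codazzi tensors on a surface. -/

section Simons

variable (s : SurfaceData W)

/-- The Laplace-Beltrami operator. -/
def lap (v : E 2 → ℝ) (x : E 2) : ℝ :=
  (√(s.gm x).det)⁻¹ * ∑ i, ∑ j,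
    fderiv ℝ (fun z => √(s.gm z).det * (s.gm z)⁻¹ i j * fderiv ℝ v z (e j)) x (e i)

/-- The squared norm of the gradient. -/
def gradSq (v : E 2 → ℝ) (x : E 2) : ℝ :=
  ∑ i, ∑ j, (s.gm x)⁻¹ i j * fderiv ℝ v x (e i) * fderiv ℝ v x (e j)

variable {s} {x : E 2} {p q : E 2 → ℝ}

theorem sqrt_det (hx : x ∈ s.U) : √(s.gm x).det = s.r x * s.l x := by
  rw [gm_det hx, Real.sqrt_sq (mul_pos (r_pos hx) (l_pos hx)).le]

theorem det_smooth : ContDiffOn ℝ ∞ (fun z => √(s.gm z).det) s.U :=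
  (contDiffOn_det gm_smooth).sqrt fun _ hz => (s.gm_posDef _ hz).det_pos.ne'

theorem gm_inv_smooth (i j : Fin 2) : ContDiffOn ℝ ∞ (fun z => (s.gm z)⁻¹ i j) s.U :=
  contDiffOn_matrix_inv gm_smooth (fun _ hz => (s.gm_posDef _ hz).det_pos.ne') i j

theorem lap_congr {v v' : E 2 → ℝ} {U : Set (E 2)} (hU : IsOpen U) (h : Set.EqOn v v' U)
    (hx : x ∈ U) : s.lap v x = s.lap v' x := by
  simp only [lap]
  congr 1
  refine Finset.sum_congr rfl fun i _ => Finset.sum_congr rfl fun j _ => ?_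
  rw [fderiv_congr_of_eqOn hU (fun z hz => ?_) hx]
  rw [fderiv_congr_of_eqOn hU h hz]

/-- Since `√det g = r l`, the factor in front is the inverse area density and the two differentiated
expressions are the components of the flux of the gradient. In this form the Codazzi equations can
be substituted. -/
theorem lap_eq_div {v : E 2 → ℝ} (hv : ContDiffOn ℝ ∞ v s.U) (hx : x ∈ s.U) :
    s.lap v x = (s.r x * s.l x)⁻¹ * (fderiv ℝ (fun z => (s.l z ^ 2 + s.k z ^ 2) / (s.r z * s.l z)
        * fderiv ℝ v z (e 0) - s.k z / s.l z * fderiv ℝ v z (e 1)) x (e 0)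
      + fderiv ℝ (fun z => s.r z / s.l z * fderiv ℝ v z (e 1)
        - s.k z / s.l z * fderiv ℝ v z (e 0)) x (e 1)) := by
  have hs : ∀ i j, ContDiffOn ℝ ∞
      (fun z => √(s.gm z).det * (s.gm z)⁻¹ i j * fderiv ℝ v z (e j)) s.U := fun i j =>
    (det_smooth.mul (gm_inv_smooth i j)).mul (contDiffOn_fderiv_apply s.isOpen hv _)
  rw [lap, sqrt_det hx]
  simp only [Fin.sum_univ_two]
  rw [← fderiv_add_apply s.isOpen (hs 0 0) (hs 0 1) hx,
    ← fderiv_add_apply s.isOpen (hs 1 0) (hs 1 1) hx]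
  congr 2
  · refine congrArg (fun L : E 2 →L[ℝ] ℝ => L (e 0))
      (fderiv_congr_of_eqOn s.isOpen (fun z hz => ?_) hx)
    have h1 := (r_pos hz).ne'
    have h2 := (l_pos hz).ne'
    simp only [sqrt_det hz, gm_inv_eq_frame hz, Matrix.of_apply, Matrix.cons_val',
      Matrix.cons_val_zero, Matrix.cons_val_one, Matrix.cons_val_fin_one]
    field_simp
    ring
  · refine congrArg (fun L : E 2 →L[ℝ] ℝ => L (e 1))
      (fderiv_congr_of_eqOn s.isOpen (fun z hz => ?_) hx)
    have h1 := (r_pos hz).ne'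
    have h2 := (l_pos hz).ne'
    simp only [sqrt_det hz, gm_inv_eq_frame hz, Matrix.of_apply, Matrix.cons_val',
      Matrix.cons_val_zero, Matrix.cons_val_one, Matrix.cons_val_fin_one]
    field_simp
    ring

variable (s) in
/-- The Cauchy-Riemann equations in the frame for the components `p`, `q` of a traceless symmetric
Codazzi tensor. -/
def IsCodazzi (p q : E 2 → ℝ) : Prop := ∀ x ∈ s.U,
  s.r x * (fderiv ℝ p x (e 1) - 2 * s.conn 1 x * q x)
      - s.k x * (fderiv ℝ p x (e 0) - 2 * s.conn 0 x * q x) =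
    s.l x * (fderiv ℝ q x (e 0) + 2 * s.conn 0 x * p x) ∧
  s.r x * (fderiv ℝ q x (e 1) + 2 * s.conn 1 x * p x)
      - s.k x * (fderiv ℝ q x (e 0) + 2 * s.conn 0 x * p x) =
    -(s.l x * (fderiv ℝ p x (e 0) - 2 * s.conn 0 x * q x))

variable (hp : ContDiffOn ℝ ∞ p s.U) (hq : ContDiffOn ℝ ∞ q s.U)

include hp hq in
theorem fderiv_two_mul_sq_add_sq (hx : x ∈ s.U) (v : E 2) :
    fderiv ℝ (fun z => 2 * (p z ^ 2 + q z ^ 2)) x v =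
      4 * (p x * fderiv ℝ p x v + q x * fderiv ℝ q x v) := by
  have h1 := (differentiableAt_of_contDiffOn s.isOpen hp hx).hasFDerivAt
  have h2 := (differentiableAt_of_contDiffOn s.isOpen hq hx).hasFDerivAt
  refine (congrArg (fun L : E 2 →L[ℝ] ℝ => L v)
    (((h1.pow 2).add (h2.pow 2)).const_mul 2).fderiv).trans ?_
  simp
  ring

include hp hq in
-- The last factor is `2|∇S|²`: the Codazzi equations express the covariant derivative along `e₂` by
-- the one along `e₁`, and tracelessness leaves two components. Thus the Kato inequality becomes an
-- identity with a better constant.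
theorem gradSq_codazzi (hc : s.IsCodazzi p q) (hx : x ∈ s.U) :
    s.gradSq (fun z => 2 * (p z ^ 2 + q z ^ 2)) x = 2 * (p x ^ 2 + q x ^ 2) *
      (8 * ((fderiv ℝ p x (e 0) - 2 * s.conn 0 x * q x) ^ 2 +
        (fderiv ℝ q x (e 0) + 2 * s.conn 0 x * p x) ^ 2) / s.r x ^ 2) := by
  have h1 := (r_pos hx).ne'
  have h2 := (l_pos hx).ne'
  obtain ⟨c1, c2⟩ := hc x hx
  have e1 : fderiv ℝ p x (e 1) = (s.k x * (fderiv ℝ p x (e 0) - 2 * s.conn 0 x * q x)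
      + s.l x * (fderiv ℝ q x (e 0) + 2 * s.conn 0 x * p x)) / s.r x + 2 * s.conn 1 x * q x := by
    field_simp; linear_combination c1
  have e2 : fderiv ℝ q x (e 1) = (s.k x * (fderiv ℝ q x (e 0) + 2 * s.conn 0 x * p x)
      - s.l x * (fderiv ℝ p x (e 0) - 2 * s.conn 0 x * q x)) / s.r x - 2 * s.conn 1 x * p x := by
    field_simp; linear_combination c2
  simp only [gradSq, Fin.sum_univ_two, fderiv_two_mul_sq_add_sq hp hq hx, gm_inv_eq_frame hx, e1, e2,
    Matrix.of_apply, Matrix.cons_val', Matrix.cons_val_zero, Matrix.cons_val_one,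
    Matrix.cons_val_fin_one]
  field_simp
  ring

include hp hq in
/-- The Simons formula `Δ|S|² = 2|∇S|² + 4K|S|²` for a traceless Codazzi tensor. -/
theorem lap_codazzi (hc : s.IsCodazzi p q) (hx : x ∈ s.U) {K : ℝ}
    (hK : fderiv ℝ (s.conn 1) x (e 0) - fderiv ℝ (s.conn 0) x (e 1) = -(s.r x * s.l x * K)) :
    s.lap (fun z => 2 * (p z ^ 2 + q z ^ 2)) x =
      8 * ((fderiv ℝ p x (e 0) - 2 * s.conn 0 x * q x) ^ 2 +
        (fderiv ℝ q x (e 0) + 2 * s.conn 0 x * p x) ^ 2) / s.r x ^ 2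
      + 4 * K * (2 * (p x ^ 2 + q x ^ 2)) := by
  have hU := s.isOpen
  have hpi : ∀ i, ContDiffOn ℝ ∞ (fun z => fderiv ℝ p z (e i)) s.U := fun i =>
    contDiffOn_fderiv_apply hU hp _
  have hqi : ∀ i, ContDiffOn ℝ ∞ (fun z => fderiv ℝ q z (e i)) s.U := fun i =>
    contDiffOn_fderiv_apply hU hq _
  have hh : ContDiffOn ℝ ∞ (fun z => 2 * (p z ^ 2 + q z ^ 2)) s.U :=
    contDiffOn_const.mul ((hp.pow 2).add (hq.pow 2))
  have hN : ∀ (a : ℝ) (i : Fin 2), HasFDerivAt (fun z => a * (p z * fderiv ℝ q z (e i)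
      - q z * fderiv ℝ p z (e i) + 2 * (s.conn i z * (p z ^ 2 + q z ^ 2)))) _ x := fun a i =>
    ((((differentiableAt_of_contDiffOn hU hp hx).hasFDerivAt.mul
      (differentiableAt_of_contDiffOn hU (hqi i) hx).hasFDerivAt).sub
      ((differentiableAt_of_contDiffOn hU hq hx).hasFDerivAt.mul
      (differentiableAt_of_contDiffOn hU (hpi i) hx).hasFDerivAt)).add
      (((differentiableAt_of_contDiffOn hU (conn_smooth i) hx).hasFDerivAt.mul
      (((differentiableAt_of_contDiffOn hU hp hx).hasFDerivAt.pow 2).add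
      ((differentiableAt_of_contDiffOn hU hq hx).hasFDerivAt.pow 2))).const_mul 2)).const_mul a
  -- By the Codazzi equations the gradient flux of `h = 2(p² + q²)` equals, up to rotation, four
  -- times the one-form `N = p dq - q dp + 2 conn (p² + q²)`. So `Δh` is `-4 dN` over the area
  -- density. The second derivatives of `p` and `q` cancel in `dN`, and `d conn` brings in the
  -- curvature through `hK`.
  have g0 : Set.EqOn (fun z => (s.l z ^ 2 + s.k z ^ 2) / (s.r z * s.l z)
        * fderiv ℝ (fun z => 2 * (p z ^ 2 + q z ^ 2)) z (e 0)
        - s.k z / s.l z * fderiv ℝ (fun z => 2 * (p z ^ 2 + q z ^ 2)) z (e 1))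
      (fun z => -4 * (p z * fderiv ℝ q z (e 1)
      - q z * fderiv ℝ p z (e 1) + 2 * (s.conn 1 z * (p z ^ 2 + q z ^ 2)))) s.U := by
    intro z hz
    have h1 := (r_pos hz).ne'
    have h2 := (l_pos hz).ne'
    obtain ⟨c1, c2⟩ := hc z hz
    simp only [fderiv_two_mul_sq_add_sq hp hq hz]
    field_simp
    linear_combination (-(p z * s.k z) - s.l z * q z) * c1 +
      (-(q z * s.k z) + s.l z * p z) * c2
  have g1 : Set.EqOn (fun z => s.r z / s.l z * fderiv ℝ (fun z => 2 * (p z ^ 2 + q z ^ 2)) z (e 1)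
        - s.k z / s.l z * fderiv ℝ (fun z => 2 * (p z ^ 2 + q z ^ 2)) z (e 0))
      (fun z => 4 * (p z * fderiv ℝ q z (e 0)
      - q z * fderiv ℝ p z (e 0) + 2 * (s.conn 0 z * (p z ^ 2 + q z ^ 2)))) s.U := by
    intro z hz
    have h2 := (l_pos hz).ne'
    obtain ⟨c1, c2⟩ := hc z hz
    simp only [fderiv_two_mul_sq_add_sq hp hq hz]
    field_simp
    linear_combination p z * c1 + q z * c2
  have h1 := (r_pos hx).ne'
  have h2 := (l_pos hx).ne'
  obtain ⟨c1, c2⟩ := hc x hx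
  have sp := fderiv_fderiv_comm hU hp hx (e 0) (e 1)
  have sq := fderiv_fderiv_comm hU hq hx (e 0) (e 1)
  rw [lap_eq_div hh hx, fderiv_congr_of_eqOn hU g0 hx, fderiv_congr_of_eqOn hU g1 hx,
    (hN (-4) 1).fderiv, (hN 4 0).fderiv]
  simp only [add_apply, sub_apply, smul_apply, smul_eq_mul, nsmul_eq_mul, Nat.cast_ofNat,
    Nat.add_one_sub_one, pow_one, Pi.add_apply, sp, sq]
  -- Solving the Codazzi equations for the derivatives along `∂₁` leaves only covariant derivatives
  -- along `∂₀`.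
  have e1 : fderiv ℝ p x (e 1) = (s.k x * (fderiv ℝ p x (e 0) - 2 * s.conn 0 x * q x)
      + s.l x * (fderiv ℝ q x (e 0) + 2 * s.conn 0 x * p x)) / s.r x + 2 * s.conn 1 x * q x := by
    field_simp; linear_combination c1
  have e2 : fderiv ℝ q x (e 1) = (s.k x * (fderiv ℝ q x (e 0) + 2 * s.conn 0 x * p x)
      - s.l x * (fderiv ℝ p x (e 0) - 2 * s.conn 0 x * q x)) / s.r x - 2 * s.conn 1 x * p x := by
    field_simp; linear_combination c2
  have e3 : fderiv ℝ (s.conn 1) x (e 0) = fderiv ℝ (s.conn 0) x (e 1) - s.r x * s.l x * K := by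
    linarith
  rw [e1, e2, e3]
  field_simp
  ring

end Simons

end SurfaceData

namespace SurfaceData

variable {W : Type*} [NormedAddCommGroup W] [NormedSpace ℝ W]

/-! ### Codazzi and Gauss equations for a parallel mean curvature vector, and the operator `S`. -/

section ParallelMeanCurvature

variable (s : SurfaceData W)

/-- `⟨A_H ∂_i, ∂_j⟩`. -/
def shape (x : E 2) : Matrix (Fin 2) (Fin 2) ℝ :=
  Matrix.of fun i j => s.ip x (s.sec i j x) (s.mcv x)

/-- The form `Q`. -/
def qForm (x : E 2) : Matrix (Fin 2) (Fin 2) ℝ :=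
  Matrix.of fun i j => 2 * s.shape x i j - s.c * s.ht (s.X i x) * s.ht (s.X j x)

/-- The form of the traceless operator `S`. -/
def sForm (x : E 2) : Matrix (Fin 2) (Fin 2) ℝ :=
  (2 * √(s.ip x (s.mcv x) (s.mcv x)))⁻¹ •
    (s.qForm x - (((s.gm x)⁻¹ * s.qForm x).trace / 2) • s.gm x)

/-- The squared Hilbert-Schmidt norm. -/
def hsSq (x : E 2) (b : Matrix (Fin 2) (Fin 2) ℝ) : ℝ :=
  ∑ i, ∑ j, ∑ k, ∑ l, (s.gm x)⁻¹ i k * (s.gm x)⁻¹ j l * b i j * b k l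

/-- `|σ|²`. -/
def secSq (x : E 2) : ℝ :=
  ∑ i, ∑ j, ∑ k, ∑ l, (s.gm x)⁻¹ i k * (s.gm x)⁻¹ j l * s.ip x (s.sec i j x) (s.sec k l x)

/-- The mean curvature vector is parallel. -/
def IsParallel : Prop := ∀ x ∈ s.U, ∀ i, s.nor x (s.D i s.mcv x) = 0

variable {s} {x : E 2}

theorem ip_mcv_e₁ (hx : x ∈ s.U) : s.ip x (s.mcv x) (s.e₁ x) = 0 := by
  simp [mcv, sec, ip_nor_e₁ hx]

theorem ip_mcv_e₂ (hx : x ∈ s.U) : s.ip x (s.mcv x) (s.e₂ x) = 0 := by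
  simp [mcv, sec, ip_nor_e₂ hx]

theorem ip_e₁_mcv (hx : x ∈ s.U) : s.ip x (s.e₁ x) (s.mcv x) = 0 := by
  rw [s.ip_symm x hx, ip_mcv_e₁ hx]

theorem ip_e₂_mcv (hx : x ∈ s.U) : s.ip x (s.e₂ x) (s.mcv x) = 0 := by
  rw [s.ip_symm x hx, ip_mcv_e₂ hx]

/-- Weingarten's equation, from differentiating `⟨H⃗, e₁⟩ = 0`. -/
theorem ip_mcv_D_e₁ (hx : x ∈ s.U) (i : Fin 2) :
    s.ip x (s.D i s.mcv x) (s.e₁ x) = -s.ip x (s.D i s.e₁ x) (s.mcv x) := by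
  have h := s.D_compat i _ _ mcv_smooth e₁_smooth x hx
  rw [fderiv_congr_of_eqOn s.isOpen (g := fun _ => (0 : ℝ)) (fun z hz => ip_mcv_e₁ hz) hx,
    s.ip_symm x hx (s.mcv x)] at h
  simp at h
  linarith

theorem ip_mcv_D_e₂ (hx : x ∈ s.U) (i : Fin 2) :
    s.ip x (s.D i s.mcv x) (s.e₂ x) = -s.ip x (s.D i s.e₂ x) (s.mcv x) := by
  have h := s.D_compat i _ _ mcv_smooth e₂_smooth x hx
  rw [fderiv_congr_of_eqOn s.isOpen (g := fun _ => (0 : ℝ)) (fun z hz => ip_mcv_e₂ hz) hx,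
    s.ip_symm x hx (s.mcv x)] at h
  simp at h
  linarith

/-- Parallelism removes the normal part of the derivative, and Weingarten's equation identifies the
tangential part. Thus the ambient derivative of `H⃗` is `-A_H`. -/
theorem D_mcv (hP : s.IsParallel) (hx : x ∈ s.U) (i : Fin 2) : s.D i s.mcv x =
    (-s.ip x (s.D i s.e₁ x) (s.mcv x)) • s.e₁ x
      + (-s.ip x (s.D i s.e₂ x) (s.mcv x)) • s.e₂ x := by
  have h := hP x hx i
  rw [nor_eq hx, sub_eq_zero, ip_mcv_D_e₁ hx, ip_mcv_D_e₂ hx] at h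
  exact h

theorem fderiv_ip_mcv_mcv (hP : s.IsParallel) (hx : x ∈ s.U) (i : Fin 2) :
    fderiv ℝ (fun z => s.ip z (s.mcv z) (s.mcv z)) x (e i) = 0 := by
  rw [s.D_compat i _ _ mcv_smooth mcv_smooth x hx, D_mcv hP hx]
  simp [ip_e₁_mcv hx, ip_e₂_mcv hx, ip_mcv_e₁ hx, ip_mcv_e₂ hx]

variable (s) in
/-- `⟨A_H e₁, e₁⟩`. -/
def h₁₁ (x : E 2) : ℝ := s.ip x (s.σ₁₁ x) (s.mcv x)
variable (s) in
/-- `⟨A_H e₁, e₂⟩`. -/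
def h₁₂ (x : E 2) : ℝ := s.ip x (s.σ₁₂ x) (s.mcv x)
variable (s) in
/-- `⟨e₁, ξ⟩`. -/
def t₁ (x : E 2) : ℝ := s.ht (s.e₁ x)
variable (s) in
/-- `⟨e₂, ξ⟩`. -/
def t₂ (x : E 2) : ℝ := s.ht (s.e₂ x)

theorem h₁₁_smooth : ContDiffOn ℝ ∞ s.h₁₁ s.U :=
  s.ip_smooth _ _ ((r_smooth.inv fun _ hx => (r_pos hx).ne').smul
    (nor_smooth (s.D_smooth 0 _ e₁_smooth))) mcv_smooth

theorem h₁₂_smooth : ContDiffOn ℝ ∞ s.h₁₂ s.U :=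
  s.ip_smooth _ _ ((r_smooth.inv fun _ hx => (r_pos hx).ne').smul
    (nor_smooth (s.D_smooth 0 _ e₂_smooth))) mcv_smooth

theorem t₁_smooth : ContDiffOn ℝ ∞ s.t₁ s.U := s.ht.contDiff.comp_contDiffOn e₁_smooth
theorem t₂_smooth : ContDiffOn ℝ ∞ s.t₂ s.U := s.ht.contDiff.comp_contDiffOn e₂_smooth

variable {H₀ : ℝ} (hH : ∀ x ∈ s.U, s.ip x (s.mcv x) (s.mcv x) = H₀ ^ 2)

include hH in
-- The trace of `A_H` is `2|H⃗|²`; this eliminates the third entry of `A_H` everywhere.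
theorem ip_σ₂₂_mcv (hx : x ∈ s.U) : s.ip x (s.σ₂₂ x) (s.mcv x) = 2 * H₀ ^ 2 - s.h₁₁ x := by
  have h := hH x hx
  have h2 : s.ip x (s.mcv x) (s.mcv x) = s.ip x ((1 / 2 : ℝ) • (s.σ₁₁ x + s.σ₂₂ x)) (s.mcv x) := by
    rw [← mcv_eq hx]
  simp only [map_smul, map_add, LinearMap.add_apply, LinearMap.smul_apply, smul_eq_mul] at h2
  simp only [h₁₁]
  linarith

theorem ip_D_zero_e₁_mcv (hx : x ∈ s.U) :
    s.ip x (s.D 0 s.e₁ x) (s.mcv x) = s.r x * s.h₁₁ x := by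
  rw [D_e₁ hx, nor_D_zero_e₁ hx]
  simp [ip_e₂_mcv hx, h₁₁]

theorem ip_D_zero_e₂_mcv (hx : x ∈ s.U) :
    s.ip x (s.D 0 s.e₂ x) (s.mcv x) = s.r x * s.h₁₂ x := by
  rw [D_e₂ hx, nor_D_zero_e₂ hx]
  simp [ip_e₁_mcv hx, h₁₂]

theorem ip_D_one_e₁_mcv (hx : x ∈ s.U) :
    s.ip x (s.D 1 s.e₁ x) (s.mcv x) = s.k x * s.h₁₁ x + s.l x * s.h₁₂ x := by
  rw [D_e₁ hx, nor_D_one_e₁ hx]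
  simp [ip_e₂_mcv hx, h₁₁, h₁₂]

include hH in
theorem ip_D_one_e₂_mcv (hx : x ∈ s.U) :
    s.ip x (s.D 1 s.e₂ x) (s.mcv x) = s.k x * s.h₁₂ x + s.l x * (2 * H₀ ^ 2 - s.h₁₁ x) := by
  rw [D_e₂ hx, nor_D_one_e₂ hx]
  simp [ip_e₁_mcv hx, h₁₂, ip_σ₂₂_mcv hH hx]

theorem ht_X_zero (hx : x ∈ s.U) : s.ht (s.X 0 x) = s.r x * s.t₁ x := by
  rw [X_zero hx]; simp [t₁]

theorem ht_X_one (hx : x ∈ s.U) : s.ht (s.X 1 x) = s.k x * s.t₁ x + s.l x * s.t₂ x := by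
  rw [X_one hx]; simp [t₁, t₂]

theorem ht_mcv (hx : x ∈ s.U) : s.ht (s.mcv x) = (s.ht (s.σ₁₁ x) + s.ht (s.σ₂₂ x)) / 2 := by
  rw [mcv_eq hx]; simp; ring

/-- As `ξ` is parallel, differentiating `⟨e₁, ξ⟩` only differentiates `e₁`. This and the three
analogues below are the covariant derivative of `T`. -/
theorem fderiv_t₁_zero (hx : x ∈ s.U) : fderiv ℝ s.t₁ x (e 0) =
    s.conn 0 x * s.t₂ x + s.r x * s.ht (s.σ₁₁ x) := by
  have h := s.D_ht 0 _ e₁_smooth x hx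
  rw [D_e₁ hx, nor_D_zero_e₁ hx] at h
  simp only [map_add, map_smul, smul_eq_mul] at h
  exact h

theorem fderiv_t₁_one (hx : x ∈ s.U) : fderiv ℝ s.t₁ x (e 1) =
    s.conn 1 x * s.t₂ x + (s.k x * s.ht (s.σ₁₁ x) + s.l x * s.ht (s.σ₁₂ x)) := by
  have h := s.D_ht 1 _ e₁_smooth x hx
  rw [D_e₁ hx, nor_D_one_e₁ hx] at h
  simp only [map_add, map_smul, smul_eq_mul] at h
  exact h

theorem fderiv_t₂_zero (hx : x ∈ s.U) : fderiv ℝ s.t₂ x (e 0) =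
    -(s.conn 0 x * s.t₁ x) + s.r x * s.ht (s.σ₁₂ x) := by
  have h := s.D_ht 0 _ e₂_smooth x hx
  rw [D_e₂ hx, nor_D_zero_e₂ hx] at h
  simp only [map_add, map_smul, smul_eq_mul, neg_mul] at h
  exact h

theorem fderiv_t₂_one (hx : x ∈ s.U) : fderiv ℝ s.t₂ x (e 1) =
    -(s.conn 1 x * s.t₁ x) + (s.k x * s.ht (s.σ₁₂ x) + s.l x * s.ht (s.σ₂₂ x)) := by
  have h := s.D_ht 1 _ e₂_smooth x hx
  rw [D_e₂ hx, nor_D_one_e₂ hx] at h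
  simp only [map_add, map_smul, smul_eq_mul, neg_mul] at h
  exact h

theorem ip_X_zero (hx : x ∈ s.U) (v : W) : s.ip x (s.X 0 x) v = s.r x * s.ip x (s.e₁ x) v := by
  rw [X_zero hx]; simp

theorem ip_X_one (hx : x ∈ s.U) (v : W) :
    s.ip x (s.X 1 x) v = s.k x * s.ip x (s.e₁ x) v + s.l x * s.ip x (s.e₂ x) v := by
  rw [X_one hx]; simp

include hH in
/-- The Codazzi equation for `A_H` in the direction `e₁`. -/
theorem codazzi_e₁ (hP : s.IsParallel) (hx : x ∈ s.U) :
    s.k x * fderiv ℝ s.h₁₁ x (e 0) + s.l x * fderiv ℝ s.h₁₂ x (e 0)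
        - s.r x * fderiv ℝ s.h₁₁ x (e 1) =
      s.c * s.r x * s.l x * s.t₂ x * s.ht (s.mcv x)
        + 2 * s.conn 0 x * (s.k x * s.h₁₂ x + s.l x * (H₀ ^ 2 - s.h₁₁ x))
        - 2 * s.conn 1 x * (s.r x * s.h₁₂ x) := by
  have hU := s.isOpen
  -- `h0` and `h1` express `⟨D₀ D₁ e₁, H⃗⟩` and `⟨D₁ D₀ e₁, H⃗⟩` by derivatives of entries of `A_H`;
  -- `hR` gives their difference through the curvature. The structure equations remove the
  -- derivatives of `r`, `k`, `l`.
  have h0 := s.D_compat 0 _ _ (s.D_smooth 1 _ e₁_smooth) mcv_smooth x hx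
  have h1 := s.D_compat 1 _ _ (s.D_smooth 0 _ e₁_smooth) mcv_smooth x hx
  have hR := s.D_curvature _ e₁_smooth x hx (s.mcv x)
  rw [fderiv_congr_of_eqOn hU (fun z hz => ip_D_one_e₁_mcv hz) hx,
    fderiv_add_apply hU (k_smooth.mul h₁₁_smooth) (l_smooth.mul h₁₂_smooth) hx,
    fderiv_mul_apply hU k_smooth h₁₁_smooth hx, fderiv_mul_apply hU l_smooth h₁₂_smooth hx,
    D_mcv hP hx, ip_D_zero_e₁_mcv hx, ip_D_zero_e₂_mcv hx] at h0
  rw [fderiv_congr_of_eqOn hU (fun z hz => ip_D_zero_e₁_mcv hz) hx,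
    fderiv_mul_apply hU r_smooth h₁₁_smooth hx,
    D_mcv hP hx, ip_D_one_e₁_mcv hx, ip_D_one_e₂_mcv hH hx] at h1
  simp only [map_smul, map_add, smul_eq_mul, ip_D_e₁_e₁ hx, ip_D_e₁_e₂] at h0 h1
  simp only [ip_X_zero hx, ip_X_one hx, ip_e₁_e₁ hx, ip_e₂_e₁ hx, ip_e₁_mcv hx, ip_e₂_mcv hx,
    ht_X_zero hx, ht_X_one hx] at hR
  have a1 := structure_e₁ hx
  have a2 := structure_e₂ hx
  change _ = _ * ((_ - _ * s.t₁ x) * _ - (_ - _ * s.t₁ x) * _) at hR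
  linear_combination h0 - h1 + hR - s.h₁₁ x * a1 - s.h₁₂ x * a2

include hH in
/-- The Codazzi equation for `A_H` in the direction `e₂`. -/
theorem codazzi_e₂ (hP : s.IsParallel) (hx : x ∈ s.U) :
    s.k x * fderiv ℝ s.h₁₂ x (e 0) - s.l x * fderiv ℝ s.h₁₁ x (e 0)
        - s.r x * fderiv ℝ s.h₁₂ x (e 1) =
      -(s.c * s.r x * s.l x * s.t₁ x * s.ht (s.mcv x))
        + 2 * s.conn 0 x * (s.k x * (H₀ ^ 2 - s.h₁₁ x) - s.l x * s.h₁₂ x)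
        - 2 * s.conn 1 x * (s.r x * (H₀ ^ 2 - s.h₁₁ x)) := by
  have hU := s.isOpen
  have h0 := s.D_compat 0 _ _ (s.D_smooth 1 _ e₂_smooth) mcv_smooth x hx
  have h1 := s.D_compat 1 _ _ (s.D_smooth 0 _ e₂_smooth) mcv_smooth x hx
  have hR := s.D_curvature _ e₂_smooth x hx (s.mcv x)
  have hc : ContDiffOn ℝ ∞ (fun z => 2 * H₀ ^ 2 - s.h₁₁ z) s.U :=
    contDiffOn_const.sub h₁₁_smooth
  rw [fderiv_congr_of_eqOn hU (fun z hz => ip_D_one_e₂_mcv hH hz) hx,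
    fderiv_add_apply hU (k_smooth.mul h₁₂_smooth) (l_smooth.mul hc) hx,
    fderiv_mul_apply hU k_smooth h₁₂_smooth hx, fderiv_mul_apply hU l_smooth hc hx,
    fderiv_const_sub,
    D_mcv hP hx, ip_D_zero_e₁_mcv hx, ip_D_zero_e₂_mcv hx] at h0
  rw [fderiv_congr_of_eqOn hU (fun z hz => ip_D_zero_e₂_mcv hz) hx,
    fderiv_mul_apply hU r_smooth h₁₂_smooth hx,
    D_mcv hP hx, ip_D_one_e₁_mcv hx, ip_D_one_e₂_mcv hH hx] at h1
  simp only [map_smul, map_add, smul_eq_mul, ip_D_e₂_e₁ hx, ip_D_e₂_e₂ hx, neg_apply] at h0 h1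
  simp only [ip_X_zero hx, ip_X_one hx, ip_e₁_e₂ hx, ip_e₂_e₂ hx, ip_e₁_mcv hx, ip_e₂_mcv hx,
    ht_X_zero hx, ht_X_one hx] at hR
  have a1 := structure_e₁ hx
  have a2 := structure_e₂ hx
  change _ = _ * ((_ - _ * s.t₂ x) * _ - (_ - _ * s.t₂ x) * _) at hR
  linear_combination h0 - h1 + hR - s.h₁₂ x * a1 - (2 * H₀ ^ 2 - s.h₁₁ x) * a2

variable (s) in
/-- The Gauss curvature, by the Gauss equation. -/
def gaussK (x : E 2) : ℝ := s.c * (1 - s.t₁ x ^ 2 - s.t₂ x ^ 2)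
  + s.ip x (s.σ₁₁ x) (s.σ₂₂ x) - s.ip x (s.σ₁₂ x) (s.σ₁₂ x)

/-- The Gauss equation. -/
theorem gauss (hx : x ∈ s.U) :
    fderiv ℝ (s.conn 1) x (e 0) - fderiv ℝ (s.conn 0) x (e 1) =
      -(s.r x * s.l x * s.gaussK x) := by
  have h0 := s.D_compat 0 _ _ (s.D_smooth 1 _ e₁_smooth) e₂_smooth x hx
  have h1 := s.D_compat 1 _ _ (s.D_smooth 0 _ e₁_smooth) e₂_smooth x hx
  have hR := s.D_curvature _ e₁_smooth x hx (s.e₂ x)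
  simp only [ip_X_zero hx, ip_X_one hx, ip_e₁_e₁ hx, ip_e₁_e₂ hx, ip_e₂_e₂ hx, ip_e₂_e₁ hx,
    ht_X_zero hx, ht_X_one hx] at hR
  change _ = _ * ((_ - _ * s.t₁ x) * (_ - _ * s.t₂ x) - (_ - _ * s.t₁ x) * (_ - _ * s.t₂ x)) at hR
  -- The tangential parts of the derivatives of `e₁` and `e₂` point along `e₂` and `e₁`, so only the
  -- normal parts meet. There is no quadratic term in `conn`, the rotation group of the plane being
  -- abelian.
  have hn : ∀ a b, s.ip x (s.D a s.e₁ x) (s.D b s.e₂ x) =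
      s.ip x (s.nor x (s.D a s.e₁ x)) (s.nor x (s.D b s.e₂ x)) := by
    intro a b
    conv_lhs => rw [D_e₁ hx a, D_e₂ hx b]
    simp only [map_add, map_smul, LinearMap.add_apply, LinearMap.smul_apply, smul_eq_mul,
      ip_e₂_e₁ hx, s.ip_symm x hx (s.e₂ x) (s.nor x _), ip_nor_e₁ hx, ip_nor_e₂ hx]
    ring
  rw [hn, nor_D_one_e₁ hx, nor_D_zero_e₂ hx] at h0
  rw [hn, nor_D_zero_e₁ hx, nor_D_one_e₂ hx] at h1
  simp only [map_add, map_smul, LinearMap.add_apply, LinearMap.smul_apply, smul_eq_mul] at h0 h1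
  change fderiv ℝ (s.conn 1) x (e 0) = _ at h0
  change fderiv ℝ (s.conn 0) x (e 1) = _ at h1
  rw [gaussK]
  linear_combination h0 - h1 + hR

variable (s) in
/-- The component `⟨S e₁, e₁⟩`. -/
def pS (H₀ : ℝ) (x : E 2) : ℝ :=
  H₀⁻¹ * (s.h₁₁ x - s.c / 4 * (s.t₁ x * s.t₁ x - s.t₂ x * s.t₂ x)) - H₀

variable (s) in
/-- The component `⟨S e₁, e₂⟩`. -/
def qS (H₀ : ℝ) (x : E 2) : ℝ := H₀⁻¹ * (s.h₁₂ x - s.c / 2 * (s.t₁ x * s.t₂ x))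

theorem pS_smooth : ContDiffOn ℝ ∞ (s.pS H₀) s.U :=
  (contDiffOn_const.mul (h₁₁_smooth.sub (contDiffOn_const.mul
    ((t₁_smooth.mul t₁_smooth).sub (t₂_smooth.mul t₂_smooth))))).sub contDiffOn_const

theorem qS_smooth : ContDiffOn ℝ ∞ (s.qS H₀) s.U :=
  contDiffOn_const.mul (h₁₂_smooth.sub (contDiffOn_const.mul (t₁_smooth.mul t₂_smooth)))

theorem fderiv_pS (hx : x ∈ s.U) (v : E 2) : fderiv ℝ (s.pS H₀) x v =
    H₀⁻¹ * (fderiv ℝ s.h₁₁ x v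
      - s.c / 2 * (s.t₁ x * fderiv ℝ s.t₁ x v - s.t₂ x * fderiv ℝ s.t₂ x v)) := by
  have a := (differentiableAt_of_contDiffOn s.isOpen h₁₁_smooth hx).hasFDerivAt
  have b := (differentiableAt_of_contDiffOn s.isOpen t₁_smooth hx).hasFDerivAt
  have c := (differentiableAt_of_contDiffOn s.isOpen t₂_smooth hx).hasFDerivAt
  refine (congrArg (fun L : E 2 →L[ℝ] ℝ => L v)
    (((a.sub (((b.mul b).sub (c.mul c)).const_mul (s.c / 4))).const_mul H₀⁻¹).sub_const
      H₀).fderiv).trans ?_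
  simp only [smul_apply, sub_apply, add_apply, smul_eq_mul]
  ring

theorem fderiv_qS (hx : x ∈ s.U) (v : E 2) : fderiv ℝ (s.qS H₀) x v =
    H₀⁻¹ * (fderiv ℝ s.h₁₂ x v
      - s.c / 2 * (s.t₁ x * fderiv ℝ s.t₂ x v + s.t₂ x * fderiv ℝ s.t₁ x v)) := by
  have a := (differentiableAt_of_contDiffOn s.isOpen h₁₂_smooth hx).hasFDerivAt
  have b := (differentiableAt_of_contDiffOn s.isOpen t₁_smooth hx).hasFDerivAt
  have c := (differentiableAt_of_contDiffOn s.isOpen t₂_smooth hx).hasFDerivAt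
  refine (congrArg (fun L : E 2 →L[ℝ] ℝ => L v)
    ((a.sub ((b.mul c).const_mul (s.c / 2))).const_mul H₀⁻¹).fderiv).trans ?_
  simp only [smul_apply, sub_apply, add_apply, smul_eq_mul]

include hH in
-- Neither `A_H` nor `T ⊗ T` is Codazzi by itself. The traceless part of `T ⊗ T` fails by terms in
-- `ht σ₁₁ + ht σ₂₂ = 2⟨H⃗, ξ⟩`, and with coefficient `c/2` they cancel the curvature term in
-- `codazzi_e₁` and `codazzi_e₂`. This is the reason for the definition of `Q`.
theorem isCodazzi_S (h0 : H₀ ≠ 0) (hP : s.IsParallel) : s.IsCodazzi (s.pS H₀) (s.qS H₀) := by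
  intro x hx
  have c1 := codazzi_e₁ hH hP hx
  have c2 := codazzi_e₂ hH hP hx
  rw [ht_mcv hx] at c1 c2
  simp only [fderiv_pS hx, fderiv_qS hx, fderiv_t₁_zero hx, fderiv_t₁_one hx, fderiv_t₂_zero hx,
    fderiv_t₂_one hx, pS, qS]
  constructor
  · field_simp
    linear_combination (-8) * c1
  · field_simp
    linear_combination (-8) * c2

include hH in
/-- The entries of `S` in the frame. -/
theorem hsSq_sForm (h0 : 0 < H₀) (hx : x ∈ s.U) :
    s.hsSq x (s.sForm x) = 2 * (s.pS H₀ x ^ 2 + s.qS H₀ x ^ 2) := by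
  have hsh : ∀ i j, s.shape x i j = s.ip x (s.sec i j x) (s.mcv x) := fun _ _ => rfl
  have s22 := ip_σ₂₂_mcv hH hx
  have q00 : s.qForm x 0 0 = s.r x ^ 2 * (2 * s.h₁₁ x - s.c * s.t₁ x ^ 2) := by
    simp only [qForm, Matrix.of_apply, hsh, sec_zero_zero hx, ht_X_zero hx, map_smul,
      LinearMap.smul_apply, smul_eq_mul]
    simp only [h₁₁]
    ring
  have q01 : s.qForm x 0 1 = s.r x * (s.k x * (2 * s.h₁₁ x - s.c * s.t₁ x ^ 2)
      + s.l x * (2 * s.h₁₂ x - s.c * s.t₁ x * s.t₂ x)) := by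
    simp only [qForm, Matrix.of_apply, hsh, sec_zero_one hx, ht_X_zero hx, ht_X_one hx, map_smul,
      map_add, LinearMap.add_apply, LinearMap.smul_apply, smul_eq_mul]
    simp only [h₁₁, h₁₂]
    ring
  have q10 : s.qForm x 1 0 = s.r x * (s.k x * (2 * s.h₁₁ x - s.c * s.t₁ x ^ 2)
      + s.l x * (2 * s.h₁₂ x - s.c * s.t₁ x * s.t₂ x)) := by
    simp only [qForm, Matrix.of_apply, hsh, sec_one_zero hx, ht_X_zero hx, ht_X_one hx, map_smul,
      map_add, LinearMap.add_apply, LinearMap.smul_apply, smul_eq_mul]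
    simp only [h₁₁, h₁₂]
    ring
  have q11 : s.qForm x 1 1 = s.k x ^ 2 * (2 * s.h₁₁ x - s.c * s.t₁ x ^ 2)
      + 2 * s.k x * s.l x * (2 * s.h₁₂ x - s.c * s.t₁ x * s.t₂ x)
      + s.l x ^ 2 * (2 * (2 * H₀ ^ 2 - s.h₁₁ x) - s.c * s.t₂ x ^ 2) := by
    simp only [qForm, Matrix.of_apply, hsh, sec_one_one hx, ht_X_one hx, map_smul,
      map_add, LinearMap.add_apply, LinearMap.smul_apply, smul_eq_mul, s22]
    simp only [h₁₁, h₁₂]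
    ring
  have htr := trace_eq_frame hx q00 q01 q10 q11
  have hne := h0.ne'
  have hS : ∀ i j, s.sForm x i j = (2 * H₀)⁻¹ * (s.qForm x i j - (2 * s.h₁₁ x - s.c * s.t₁ x ^ 2
      + (2 * (2 * H₀ ^ 2 - s.h₁₁ x) - s.c * s.t₂ x ^ 2)) / 2 * s.gm x i j) := by
    intro i j
    rw [sForm, hH x hx, Real.sqrt_sq h0.le, htr]
    simp
  -- The last entry is `-pS` because `S` is traceless.
  rw [hsSq, hs_eq_frame hx (b₁₁ := s.pS H₀ x) (b₁₂ := s.qS H₀ x) (b₂₂ := -s.pS H₀ x)]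
  · ring
  · rw [hS, q00, r_sq hx, pS]; field_simp; ring
  · rw [hS, q01, r_mul_k hx, pS, qS]; field_simp; ring
  · rw [hS, q10, gm_symm hx, r_mul_k hx, pS, qS]; field_simp; ring
  · rw [hS, q11, l_sq hx, pS, qS]; field_simp; ring

include hH in
theorem hsSq_shape (hx : x ∈ s.U) :
    s.hsSq x (s.shape x) = s.h₁₁ x ^ 2 + 2 * s.h₁₂ x ^ 2 + (2 * H₀ ^ 2 - s.h₁₁ x) ^ 2 := by
  have hsh : ∀ i j, s.shape x i j = s.ip x (s.sec i j x) (s.mcv x) := fun _ _ => rfl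
  rw [hsSq, hs_eq_frame hx (b₁₁ := s.h₁₁ x) (b₁₂ := s.h₁₂ x) (b₂₂ := 2 * H₀ ^ 2 - s.h₁₁ x)]
  · rw [hsh, sec_zero_zero hx]; simp [h₁₁]
  · rw [hsh, sec_zero_one hx]; simp [h₁₁, h₁₂]; ring
  · rw [hsh, sec_one_zero hx]; simp [h₁₁, h₁₂]; ring
  · rw [hsh, sec_one_one hx]; simp [h₁₁, h₁₂, ip_σ₂₂_mcv hH hx]

/-- Bessel's inequality for the unit vector `ξ`: the squared length of its normal part is `1 -
|T|²`. -/
theorem t_sq_le (hx : x ∈ s.U) : s.t₁ x ^ 2 + s.t₂ x ^ 2 ≤ 1 := by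
  have h : 0 ≤ s.ip x (s.nor x s.ξ) (s.nor x s.ξ) := by
    by_cases h : s.nor x s.ξ = 0
    · simp [h]
    · exact (s.ip_pos x hx _ h).le
  rw [nor_eq hx] at h
  simp only [map_sub, map_add, map_smul, LinearMap.sub_apply, LinearMap.add_apply,
    LinearMap.smul_apply, smul_eq_mul, ip_e₁_e₁ hx, ip_e₂_e₁ hx, ip_e₁_e₂ hx, ip_e₂_e₂ hx,
    s.ip_symm x hx s.ξ (s.e₁ x), s.ip_symm x hx s.ξ (s.e₂ x), s.ip_ξ x hx, s.ht_ξ] at h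
  simp only [t₁, t₂]
  nlinarith

include hH in
/-- The lower bound of the Gauss curvature. -/
theorem neg_two_mul_gaussK_le (h0 : 0 < H₀) {μ : ℝ} (hx : x ∈ s.U)
    (hμ : s.secSq x - (1 / H₀) ^ 2 * s.hsSq x (s.shape x) ≤ μ) :
    -2 * s.gaussK x ≤ 2 * s.hsSq x (s.sForm x) +
      (2 * |s.c| + μ - 2 * H₀ ^ 2 + s.c ^ 2 / (4 * H₀ ^ 2)) := by
  -- Expanding `|σ₁₁ + σ₂₂|² = 4H²` turns the extrinsic part of `2K` into `4H² - |σ|²`.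
  have hH4 : s.ip x (s.σ₁₁ x) (s.σ₁₁ x) + 2 * s.ip x (s.σ₁₁ x) (s.σ₂₂ x)
      + s.ip x (s.σ₂₂ x) (s.σ₂₂ x) = 4 * H₀ ^ 2 := by
    have h := hH x hx
    rw [mcv_eq hx] at h
    simp only [map_add, map_smul, LinearMap.add_apply,
      LinearMap.smul_apply, smul_eq_mul, s.ip_symm x hx (s.σ₂₂ x) (s.σ₁₁ x)] at h
    linarith
  rw [secSq, normSq_sec_eq_frame hx, hsSq_shape hH hx] at hμ
  rw [hsSq_sForm hH h0 hx, gaussK]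
  have ht := t_sq_le hx
  have hc : -(s.c * (1 - s.t₁ x ^ 2 - s.t₂ x ^ 2)) ≤ |s.c| := by
    have h1 : 0 ≤ 1 - s.t₁ x ^ 2 - s.t₂ x ^ 2 := by linarith
    have h2 : 1 - s.t₁ x ^ 2 - s.t₂ x ^ 2 ≤ 1 := by nlinarith [sq_nonneg (s.t₁ x), sq_nonneg (s.t₂ x)]
    nlinarith [neg_abs_le s.c, abs_nonneg s.c]
  set p := s.pS H₀ x with hp
  set q := s.qS H₀ x with hq
  set d := s.c / (4 * H₀) with hd
  have hne := h0.ne'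
  have e1 : s.h₁₁ x = H₀ * (H₀ + p + d * (s.t₁ x ^ 2 - s.t₂ x ^ 2)) := by
    rw [hp, pS, hd]; field_simp; ring
  have e2 : s.h₁₂ x = H₀ * (q + d * (2 * s.t₁ x * s.t₂ x)) := by
    rw [hq, qS, hd]; field_simp; ring
  -- `A_H/H` is `H·id` plus a traceless tensor, the sum of `S` and a multiple of the traceless part
  -- of `T ⊗ T`; hence the squared norms add.
  have e3 : (1 / H₀) ^ 2 * (s.h₁₁ x ^ 2 + 2 * s.h₁₂ x ^ 2 + (2 * H₀ ^ 2 - s.h₁₁ x) ^ 2) =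
      2 * H₀ ^ 2 + 2 * (p + d * (s.t₁ x ^ 2 - s.t₂ x ^ 2)) ^ 2
        + 2 * (q + d * (2 * s.t₁ x * s.t₂ x)) ^ 2 := by
    rw [e1, e2]; field_simp; ring
  have e4 : s.c ^ 2 / (4 * H₀ ^ 2) = 4 * d ^ 2 := by rw [hd]; field_simp
  -- Use `(a + b)² ≤ 2a² + 2b²` in each component; the entries of the `T` part have squares summing
  -- to `d² |T|⁴ ≤ d²`.
  have e5 : 2 * (p + d * (s.t₁ x ^ 2 - s.t₂ x ^ 2)) ^ 2
        + 2 * (q + d * (2 * s.t₁ x * s.t₂ x)) ^ 2 ≤ 4 * (p ^ 2 + q ^ 2) + 4 * d ^ 2 := by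
    have h1 : (s.t₁ x ^ 2 + s.t₂ x ^ 2) ^ 2 ≤ 1 := by
      have : 0 ≤ s.t₁ x ^ 2 + s.t₂ x ^ 2 := by positivity
      nlinarith
    have h2 : d ^ 2 * (s.t₁ x ^ 2 + s.t₂ x ^ 2) ^ 2 ≤ d ^ 2 := by nlinarith [sq_nonneg d]
    nlinarith [sq_nonneg (p - d * (s.t₁ x ^ 2 - s.t₂ x ^ 2)),
      sq_nonneg (q - d * (2 * s.t₁ x * s.t₂ x))]
  rw [e3] at hμ
  rw [e4]
  linarith

include hH in
/-- The Simons inequalities for `|S|²`: with `w = 2|S|² + b`, both `Δ|S|² + 2w|S|² ≥ 0` and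
`|∇|S|²|² ≤ |S|² (Δ|S|² + 2w|S|²)`. -/
theorem simons (h0 : 0 < H₀) (hP : s.IsParallel) {μ : ℝ}
    (hμ : ∀ x ∈ s.U, s.secSq x - (1 / H₀) ^ 2 * s.hsSq x (s.shape x) ≤ μ) :
    ContDiffOn ℝ ∞ (fun z => s.hsSq z (s.sForm z)) s.U ∧ ∀ x ∈ s.U,
      0 ≤ s.hsSq x (s.sForm x) ∧
      0 ≤ s.lap (fun z => s.hsSq z (s.sForm z)) x + 2 * (2 * s.hsSq x (s.sForm x) +
        (2 * |s.c| + μ - 2 * H₀ ^ 2 + s.c ^ 2 / (4 * H₀ ^ 2))) * s.hsSq x (s.sForm x) ∧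
      s.gradSq (fun z => s.hsSq z (s.sForm z)) x ≤ s.hsSq x (s.sForm x) *
        (s.lap (fun z => s.hsSq z (s.sForm z)) x + 2 * (2 * s.hsSq x (s.sForm x) +
        (2 * |s.c| + μ - 2 * H₀ ^ 2 + s.c ^ 2 / (4 * H₀ ^ 2))) * s.hsSq x (s.sForm x)) := by
  have hEq : Set.EqOn (fun z => s.hsSq z (s.sForm z))
      (fun z => 2 * (s.pS H₀ z ^ 2 + s.qS H₀ z ^ 2)) s.U := fun z hz => hsSq_sForm hH h0 hz
  have hsm : ContDiffOn ℝ ∞ (fun z => 2 * (s.pS H₀ z ^ 2 + s.qS H₀ z ^ 2)) s.U :=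
    contDiffOn_const.mul ((pS_smooth.pow 2).add (qS_smooth.pow 2))
  have hsm' := hsm.congr hEq
  refine ⟨hsm', fun x hx => ?_⟩
  have hK := neg_two_mul_gaussK_le hH h0 hx (hμ x hx)
  have hC := isCodazzi_S hH h0.ne' hP
  have hL : s.lap (fun z => s.hsSq z (s.sForm z)) x =
      s.lap (fun z => 2 * (s.pS H₀ z ^ 2 + s.qS H₀ z ^ 2)) x := lap_congr s.isOpen hEq hx
  have hGr : s.gradSq (fun z => s.hsSq z (s.sForm z)) x =
      s.gradSq (fun z => 2 * (s.pS H₀ z ^ 2 + s.qS H₀ z ^ 2)) x := by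
    simp only [gradSq]
    rw [fderiv_congr_of_eqOn s.isOpen hEq hx]
  rw [hL, hGr, lap_codazzi pS_smooth qS_smooth hC hx (gauss hx),
    gradSq_codazzi pS_smooth qS_smooth hC hx]
  rw [hsSq_sForm hH h0 hx] at hK ⊢
  set h := 2 * (s.pS H₀ x ^ 2 + s.qS H₀ x ^ 2) with hh
  set B := 2 * h + (2 * |s.c| + μ - 2 * H₀ ^ 2 + s.c ^ 2 / (4 * H₀ ^ 2)) with hB
  set P := 8 * ((fderiv ℝ (s.pS H₀) x (e 0) - 2 * s.conn 0 x * s.qS H₀ x) ^ 2 +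
        (fderiv ℝ (s.qS H₀) x (e 0) + 2 * s.conn 0 x * s.pS H₀ x) ^ 2) / s.r x ^ 2 with hPd
  have hh0 : 0 ≤ h := by positivity
  have hP0 : 0 ≤ P := by positivity
  -- The curvature bound is `-2K ≤ B`. It absorbs the curvature term of the Simons formula, after
  -- which both inequalities reduce to `|∇S|² ≥ 0` and the Kato identity.
  have h1 : 0 ≤ (4 * s.gaussK x + 2 * B) * h := mul_nonneg (by linarith) hh0
  refine ⟨hh0, by linarith, ?_⟩
  have : P ≤ P + 4 * s.gaussK x * h + 2 * B * h := by linarith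
  exact mul_le_mul_of_nonneg_left this hh0

end ParallelMeanCurvature

end SurfaceData

/-! ### The Levi-Civita connection pulled back by a map. -/

section PullBackConnection

variable {n : ℕ} {G : E n → E n →L[ℝ] E n →L[ℝ] ℝ} {V : Set (E n)} {U : Set (E 2)}
  {β : E 2 → E n} {A B : E 2 → E n} {x : E 2}

/-- The pull-back by `β` of the Levi-Civita connection. -/
def mapCov (G : E n → E n →L[ℝ] E n →L[ℝ] ℝ) (β : E 2 → E n) (v : E 2) (A : E 2 → E n) (x : E 2) :
    E n :=
  fderiv ℝ A x v + christoffel G (β x) (fderiv ℝ β x v) (A x)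

variable (hG : IsMetricOn G V) (hU : IsOpen U) (hβ : ContDiffOn ℝ ∞ β U) (hm : Set.MapsTo β U V)
  (hA : ContDiffOn ℝ ∞ A U) (hB : ContDiffOn ℝ ∞ B U)

include hG hβ hm hA in
theorem contDiffOn_christoffel_map (hB : ContDiffOn ℝ ∞ B U) :
    ContDiffOn ℝ ∞ (fun z => christoffel G (β z) (A z) (B z)) U :=
  ((hG.contDiffOn_christoffelCLM.comp hβ hm).clm_apply hA).clm_apply hB

include hG hU hβ hm hA in
theorem contDiffOn_mapCov (v : E 2) : ContDiffOn ℝ ∞ (mapCov G β v A) U :=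
  (contDiffOn_fderiv_apply hU hA v).add
    (contDiffOn_christoffel_map hG hβ hm (contDiffOn_fderiv_apply hU hβ v) hA)

include hG hU hβ hm hA in
theorem fderiv_christoffel_map (hB : ContDiffOn ℝ ∞ B U) (hx : x ∈ U) (v : E 2) :
    fderiv ℝ (fun z => christoffel G (β z) (A z) (B z)) x v =
      fderiv ℝ (christoffelCLM G) (β x) (fderiv ℝ β x v) (A x) (B x)
      + christoffelCLM G (β x) (fderiv ℝ A x v) (B x)
      + christoffelCLM G (β x) (A x) (fderiv ℝ B x v) := by
  have h1 := (differentiableAt_of_contDiffOn hG.isOpen hG.contDiffOn_christoffelCLM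
    (hm hx)).hasFDerivAt
  have h2 := (differentiableAt_of_contDiffOn hU hβ hx).hasFDerivAt
  have h3 := (differentiableAt_of_contDiffOn hU hA hx).hasFDerivAt
  have h4 := (differentiableAt_of_contDiffOn hU hB hx).hasFDerivAt
  refine (congrArg (fun L : E 2 →L[ℝ] E n => L v)
    (((h1.comp x h2).clm_apply h3).clm_apply h4).fderiv).trans ?_
  simp only [add_apply, ContinuousLinearMap.comp_apply, ContinuousLinearMap.flip_apply,
    Function.comp_apply]
  abel

include hG hU hβ hm hA in
-- The second derivatives of `A` and of `β` are symmetric and drop out of the commutator; the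
-- remaining terms are the coordinate expression of the curvature. The coordinate fields commute, so
-- no bracket term appears.
theorem mapCov_comm (hx : x ∈ U) (v w : E 2) :
    mapCov G β v (mapCov G β w A) x - mapCov G β w (mapCov G β v A) x =
      curvature G (β x) (fderiv ℝ β x v) (fderiv ℝ β x w) (A x) := by
  have h : ∀ v w : E 2, mapCov G β v (mapCov G β w A) x =
      fderiv ℝ (fun z => fderiv ℝ A z w) x v
      + (fderiv ℝ (christoffelCLM G) (β x) (fderiv ℝ β x v) (fderiv ℝ β x w) (A x)
      + christoffelCLM G (β x) (fderiv ℝ (fun z => fderiv ℝ β z w) x v) (A x)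
      + christoffelCLM G (β x) (fderiv ℝ β x w) (fderiv ℝ A x v))
      + (christoffelCLM G (β x) (fderiv ℝ β x v) (fderiv ℝ A x w)
      + christoffelCLM G (β x) (fderiv ℝ β x v)
        (christoffelCLM G (β x) (fderiv ℝ β x w) (A x))) := by
    intro v w
    have h1 := contDiffOn_fderiv_apply hU hA w
    have h2 := contDiffOn_fderiv_apply hU hβ w
    have e1 : fderiv ℝ (mapCov G β w A) x v = fderiv ℝ (fun z => fderiv ℝ A z w) x v
        + fderiv ℝ (fun z => christoffel G (β z) (fderiv ℝ β z w) (A z)) x v := by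
      have := fderiv_fun_add (differentiableAt_of_contDiffOn hU h1 hx)
        (differentiableAt_of_contDiffOn hU (contDiffOn_christoffel_map hG hβ hm h2 hA) hx)
      exact congrArg (fun L : E 2 →L[ℝ] E n => L v) this
    rw [mapCov, e1, fderiv_christoffel_map hG hU hβ hm h2 hA hx, ← map_add]
    rfl
  rw [h, h, hG.curvature_eq (hm hx), fderiv_fderiv_comm hU hA hx w v,
    fderiv_fderiv_comm hU hβ hx w v]
  abel

include hG hU hβ hm hA in
theorem mapCov_compat (hB : ContDiffOn ℝ ∞ B U) (hx : x ∈ U) (v : E 2) :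
    fderiv ℝ (fun z => G (β z) (A z) (B z)) x v =
      G (β x) (mapCov G β v A x) (B x) + G (β x) (A x) (mapCov G β v B x) := by
  have h1 := (differentiableAt_of_contDiffOn hG.isOpen hG.smooth (hm hx)).hasFDerivAt
  have h2 := (differentiableAt_of_contDiffOn hU hβ hx).hasFDerivAt
  have h3 := (differentiableAt_of_contDiffOn hU hA hx).hasFDerivAt
  have h4 := (differentiableAt_of_contDiffOn hU hB hx).hasFDerivAt
  refine (congrArg (fun L : E 2 →L[ℝ] ℝ => L v)
    (((h1.comp x h2).clm_apply h3).clm_apply h4).fderiv).trans ?_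
  simp only [add_apply, ContinuousLinearMap.comp_apply, ContinuousLinearMap.flip_apply,
    Function.comp_apply, mapCov, map_add, hG.metric_compat (hm hx)]
  ring

end PullBackConnection

/-! ### Immersed surfaces as instances of `SurfaceData`. -/

section Surface

variable {n : ℕ} {M : Type*} [TopologicalSpace M] [ChartedSpace (E n) M]
  [IsManifold 𝓘(ℝ, E n) ∞ M]
  {S : Type*} [TopologicalSpace S] [ChartedSpace (E 2) S] [IsManifold 𝓘(ℝ, E 2) ∞ S]
  {g : Metric n M} {f : S → M × ℝ} {ψ : OpenPartialHomeomorph S (E 2)}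
  {φ : OpenPartialHomeomorph M (E n)} {c : ℝ}

theorem ambCov_eq (i : Fin 2) (A : E 2 → E n × ℝ) (x : E 2) : ambCov g f ψ φ i A x =
    (mapCov (chartMetric g φ) (baseMap f ψ φ) (e i) (fun z => (A z).1) x,
      fderiv ℝ (fun z => (A z).2) x (e i)) := rfl

/-- The product metric as a bilinear map. -/
def ambInnerₗ (g : Metric n M) (f : S → M × ℝ) (ψ : OpenPartialHomeomorph S (E 2))
    (φ : OpenPartialHomeomorph M (E n)) (x : E 2) : E n × ℝ →ₗ[ℝ] E n × ℝ →ₗ[ℝ] ℝ :=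
  LinearMap.mk₂ ℝ (ambInner g f ψ φ x)
    (fun a b d => by simp only [ambInner, Prod.fst_add, Prod.snd_add, map_add, add_apply]; ring)
    (fun t a b => by
      simp only [ambInner, Prod.smul_fst, Prod.smul_snd, map_smul, smul_apply, smul_eq_mul]; ring)
    (fun a b d => by simp only [ambInner, Prod.fst_add, Prod.snd_add, map_add]; ring)
    (fun t a b => by
      simp only [ambInner, Prod.smul_fst, Prod.smul_snd, map_smul, smul_eq_mul]; ring)

theorem ambInnerₗ_apply (x : E 2) (a b : E n × ℝ) :
    ambInnerₗ g f ψ φ x a b = chartMetric g φ (baseMap f ψ φ x) a.1 b.1 + a.2 * b.2 := rfl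

/-- An immersed surface in `M × ℝ` in a pair of charts. -/
def surfaceData (hsc : HasConstantSectionalCurvature g c) (hf : IsImmersedSurface (n := n) f)
    (hψ : ψ ∈ atlas (E 2) S) (hφ : φ ∈ atlas (E n) M) : SurfaceData (E n × ℝ) :=
  have hG := isMetricOn_chartMetric g hφ
  have hU : IsOpen (overlap f ψ φ) := isOpen_overlap hf hψ
  have hβ := contDiffOn_baseMap hf hψ hφ
  have hη : ContDiffOn ℝ ∞ (height f ψ) (overlap f ψ φ) :=
    (contDiffOn_height hf hψ).mono Set.inter_subset_left
  have hm : Set.MapsTo (baseMap f ψ φ) (overlap f ψ φ) φ.target := fun _ hx => baseMap_mem_target hx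
  have hfst : ∀ {A : E 2 → E n × ℝ}, ContDiffOn ℝ ∞ A (overlap f ψ φ) →
    ContDiffOn ℝ ∞ (fun z => (A z).1) (overlap f ψ φ) := fun hA => contDiff_fst.comp_contDiffOn hA
  have hsnd : ∀ {A : E 2 → E n × ℝ}, ContDiffOn ℝ ∞ A (overlap f ψ φ) →
    ContDiffOn ℝ ∞ (fun z => (A z).2) (overlap f ψ φ) := fun hA => contDiff_snd.comp_contDiffOn hA
  { U := overlap f ψ φ
    c := c
    gm := firstForm g f ψ
    ip := ambInnerₗ g f ψ φ
    D := ambCov g f ψ φ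
    X := coordField f ψ φ
    ξ := (0, 1)
    ht := ContinuousLinearMap.snd ℝ (E n) ℝ
    isOpen := hU
    gm_eq := fun x hx i j => firstForm_eq hf hψ hφ hx i j
    gm_posDef := fun x hx => firstForm_posDef g hf hψ hx.1
    ip_symm := fun x hx v w => ambInner_symm hφ hx v w
    ip_pos := fun x hx v hv => ambInner_pos hφ hx hv
    ip_smooth := fun A B hA hB =>
      (((hG.smooth.comp hβ hm).clm_apply (hfst hA)).clm_apply (hfst hB)).add
        ((hsnd hA).mul (hsnd hB))
    X_smooth := fun i => (contDiffOn_fderiv_apply hU hβ _).prodMk (contDiffOn_fderiv_apply hU hη _)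
    D_smooth := fun i A hA => (contDiffOn_mapCov hG hU hβ hm (hfst hA) (e i)).prodMk
      (contDiffOn_fderiv_apply hU (hsnd hA) _)
    D_congr := fun i A B h x hx => by
      have h1 := fderiv_congr_of_eqOn hU (fun z hz => congrArg Prod.fst (h hz)) hx
      have h2 := fderiv_congr_of_eqOn hU (fun z hz => congrArg Prod.snd (h hz)) hx
      simp only [ambCov, h1, h2, h hx]
    D_add := fun i A B hA hB x hx => by
      have h1 := fderiv_fun_add (differentiableAt_of_contDiffOn hU (hfst hA) hx)
        (differentiableAt_of_contDiffOn hU (hfst hB) hx)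
      have h2 := fderiv_fun_add (differentiableAt_of_contDiffOn hU (hsnd hA) hx)
        (differentiableAt_of_contDiffOn hU (hsnd hB) hx)
      simp only [ambCov, Prod.fst_add, Prod.snd_add, h1, h2, add_apply, christoffel_add_right,
        Prod.mk_add_mk, Prod.mk.injEq, and_true]
      abel
    D_smul := fun i a A ha hA x hx => by
      have h1 := fderiv_fun_smul (differentiableAt_of_contDiffOn hU ha hx)
        (differentiableAt_of_contDiffOn hU (hfst hA) hx)
      have h2 := fderiv_fun_smul (differentiableAt_of_contDiffOn hU ha hx)
        (differentiableAt_of_contDiffOn hU (hsnd hA) hx)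
      simp only [ambCov, Prod.smul_fst, Prod.smul_snd, h1, h2, add_apply, smul_apply,
        ContinuousLinearMap.smulRight_apply, christoffel_smul_right]
      ext1
      · simp only [Prod.fst_add, Prod.smul_fst, smul_add]; abel
      · simp only [Prod.snd_add, Prod.smul_snd, smul_eq_mul]; ring
    D_compat := fun i A B hA hB x hx => by
      have h1 := mapCov_compat hG hU hβ hm (hfst hA) (hfst hB) hx (e i)
      have h2 := fderiv_mul_apply hU (hsnd hA) (hsnd hB) hx (e i)
      have h3 := fderiv_add_apply hU
        (((hG.smooth.comp hβ hm).clm_apply (hfst hA)).clm_apply (hfst hB))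
        ((hsnd hA).mul (hsnd hB)) hx (e i)
      refine h3.trans ?_
      simp only [ambInnerₗ_apply, ambCov_eq, Function.comp_apply]
      rw [h1, h2]
      ring
    -- Symmetry of second derivatives together with symmetry of the Christoffel symbols.
    D_torsion := fun x hx => by
      simp only [ambCov, coordField]
      rw [fderiv_fderiv_comm hU hβ hx, fderiv_fderiv_comm hU hη hx,
        hG.christoffel_symm (hm hx)]
    D_ht := fun i A hA x hx => rfl
    ip_ξ := fun x hx v => by simp [ambInnerₗ_apply]
    ht_ξ := rfl
    -- The `ℝ` component is flat by symmetry of second derivatives. On the `M` component the metric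
    -- is the product metric minus `ht ⊗ ht`, which explains the shape of the curvature formula.
    D_curvature := fun A hA x hx w => by
      have h1 := mapCov_comm hG hU hβ hm (hfst hA) hx (e 0) (e 1)
      have h2 := fderiv_fderiv_comm hU (hsnd hA) hx (e 1) (e 0)
      have h3 := hG.curvature_of_sectional (hm hx) (fun u v => hsc φ hφ _ (hm hx) u v)
        (fderiv ℝ (baseMap f ψ φ) x (e 0)) (fderiv ℝ (baseMap f ψ φ) x (e 1)) (A x).1 w.1
      rw [← h1] at h3
      simp only [map_sub, sub_apply] at h3
      simp only [ambInnerₗ_apply, ambCov_eq, ContinuousLinearMap.coe_snd', coordField]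
      rw [h2]
      linear_combination h3 }

end Surface

/-! ### Transformation of the invariants under changes of charts. -/

namespace SurfaceData

variable {W : Type*} [NormedAddCommGroup W] [NormedSpace ℝ W]

/-- The data `s` at `x` and `s'` at `x'` describe the same point of a surface in different charts:
`J` is the Jacobian matrix of the change of coordinates of the surface, `L` is the differential of
the change of coordinates of the ambient space. -/
structure Related (s : SurfaceData W) (x : E 2) (s' : SurfaceData W) (x' : E 2)
    (J : Matrix (Fin 2) (Fin 2) ℝ) (L : W →ₗ[ℝ] W) : Prop where
  mem : x ∈ s.U
  mem' : x' ∈ s'.U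
  c_eq : s'.c = s.c
  ip_map : ∀ a b, s'.ip x' (L a) (L b) = s.ip x a b
  ht_map : ∀ a, s'.ht (L a) = s.ht a
  X_map : ∀ j, s'.X j x' = ∑ i, J i j • L (s.X i x)
  D_map : ∀ i j, ∃ a : Fin 2 → ℝ, s'.D i (s'.X j) x' =
    ∑ k, ∑ l, (J k i * J l j) • L (s.D k (s.X l) x) + ∑ m, a m • L (s.X m x)

/-- Invertibility of `J` need not be assumed: invertibility of `P'` yields a right inverse of `Jᵀ`,
which for square matrices is two-sided. -/
theorem inv_transform {P P' J : Matrix (Fin 2) (Fin 2) ℝ} (h : P' = J.transpose * P * J)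
    (h' : IsUnit P'.det) : P⁻¹ = J * P'⁻¹ * J.transpose := by
  have h1 : J.transpose * (P * J * P'⁻¹) = 1 := by
    rw [← Matrix.mul_nonsing_inv P' h']
    nth_rewrite 2 [h]
    simp only [Matrix.mul_assoc]
  have h2 := mul_eq_one_comm.1 h1
  exact Matrix.inv_eq_right_inv (by simpa only [Matrix.mul_assoc] using h2)

theorem nor_X {s : SurfaceData W} {x : E 2} (hx : x ∈ s.U) (i : Fin 2) :
    s.nor x (s.X i x) = 0 := by
  fin_cases i
  · change s.nor x (s.X 0 x) = 0
    rw [X_zero hx, nor_smul, nor_e₁ hx, smul_zero]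
  · change s.nor x (s.X 1 x) = 0
    rw [X_one hx, nor_add, nor_smul, nor_smul, nor_e₁ hx, nor_e₂ hx, smul_zero, smul_zero, add_zero]

namespace Related

variable {s s' : SurfaceData W} {x x' : E 2} {J : Matrix (Fin 2) (Fin 2) ℝ} {L : W →ₗ[ℝ] W}

theorem gm_eq (h : Related s x s' x' J L) : s'.gm x' = J.transpose * s.gm x * J := by
  ext i j
  rw [s'.gm_eq x' h.mem', h.X_map, h.X_map]
  simp only [Matrix.mul_apply, Matrix.transpose_apply, Fin.sum_univ_two, map_add, map_smul,
    LinearMap.add_apply, LinearMap.smul_apply, smul_eq_mul, h.ip_map, s.gm_eq x h.mem]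
  ring

theorem gm_inv (h : Related s x s' x' J L) (a b : Fin 2) :
    (s.gm x)⁻¹ a b = ∑ i, ∑ k, (s'.gm x')⁻¹ i k * J a i * J b k := by
  rw [inv_transform h.gm_eq (s'.gm_posDef x' h.mem').det_pos.ne'.isUnit]
  simp only [Matrix.mul_apply, Matrix.transpose_apply, Fin.sum_univ_two]
  ring

theorem nor_map (h : Related s x s' x' J L) (a : W) : s'.nor x' (L a) = L (s.nor x a) := by
  simp only [nor, h.X_map, h.gm_inv, Fin.sum_univ_two, map_smul, map_add, map_sub, smul_eq_mul,
    h.ip_map]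
  module

/-- The correction terms in `D_map`, left unspecified there, are tangent to the surface and are
killed by the normal projection. Hence `σ` is tensorial. -/
theorem sec_map (h : Related s x s' x' J L) (i j : Fin 2) :
    s'.sec i j x' = ∑ k, ∑ l, (J k i * J l j) • L (s.sec k l x) := by
  obtain ⟨a, ha⟩ := h.D_map i j
  rw [sec, ha]
  simp only [Fin.sum_univ_two, nor_add, nor_smul, h.nor_map, nor_X h.mem, map_zero, smul_zero,
    add_zero]
  rfl

theorem mcv (h : Related s x s' x' J L) : s'.mcv x' = L (s.mcv x) := by
  simp only [SurfaceData.mcv, h.sec_map, h.gm_inv, Fin.sum_univ_two, map_smul, map_add]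
  module

theorem ip_mcv (h : Related s x s' x' J L) :
    s'.ip x' (s'.mcv x') (s'.mcv x') = s.ip x (s.mcv x) (s.mcv x) := by
  rw [h.mcv, h.ip_map]

theorem secSq (h : Related s x s' x' J L) : s'.secSq x' = s.secSq x := by
  simp only [SurfaceData.secSq, h.sec_map, h.gm_inv, Fin.sum_univ_two, map_smul, map_add,
    LinearMap.add_apply, LinearMap.smul_apply, smul_eq_mul, h.ip_map]
  ring

theorem hsSq (h : Related s x s' x' J L) {b b' : Matrix (Fin 2) (Fin 2) ℝ}
    (hb : ∀ i j, b' i j = ∑ k, ∑ l, J k i * J l j * b k l) : s'.hsSq x' b' = s.hsSq x b := by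
  simp only [SurfaceData.hsSq, hb, h.gm_inv, Fin.sum_univ_two]
  ring

theorem shape (h : Related s x s' x' J L) (i j : Fin 2) :
    s'.shape x' i j = ∑ k, ∑ l, J k i * J l j * s.shape x k l := by
  simp only [SurfaceData.shape, Matrix.of_apply, h.sec_map, h.mcv, Fin.sum_univ_two, map_smul,
    map_add, LinearMap.add_apply, LinearMap.smul_apply, smul_eq_mul, h.ip_map]

theorem qForm (h : Related s x s' x' J L) (i j : Fin 2) :
    s'.qForm x' i j = ∑ k, ∑ l, J k i * J l j * s.qForm x k l := by
  simp only [SurfaceData.qForm, Matrix.of_apply, h.shape, h.X_map, h.c_eq, Fin.sum_univ_two,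
    map_smul, map_add, smul_eq_mul, h.ht_map]
  ring

theorem sForm (h : Related s x s' x' J L) (i j : Fin 2) :
    s'.sForm x' i j = ∑ k, ∑ l, J k i * J l j * s.sForm x k l := by
  have ht : ((s'.gm x')⁻¹ * s'.qForm x').trace = ((s.gm x)⁻¹ * s.qForm x).trace := by
    simp only [Matrix.trace_fin_two, Matrix.mul_apply, Fin.sum_univ_two, h.qForm, h.gm_inv]
    ring
  simp only [SurfaceData.sForm]
  rw [ht]
  simp only [h.ip_mcv, Matrix.smul_apply, Matrix.sub_apply, smul_eq_mul,
    h.qForm, h.gm_eq, Matrix.mul_apply, Matrix.transpose_apply, Fin.sum_univ_two]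
  ring

end Related

end SurfaceData

/-! ### Change of chart in `M`. -/

section AmbientCharts

variable {n : ℕ} {G G' : E n → E n →L[ℝ] E n →L[ℝ] ℝ} {V V' O : Set (E n)} {Θ : E n → E n}
  {U : Set (E 2)} {β β' : E 2 → E n}

/-- The transformation law of the Christoffel symbols under a local isometry. -/
theorem christoffel_transform (hG : IsMetricOn G V) (hG' : IsMetricOn G' V') (hO : IsOpen O)
    (hΘ : ContDiffOn ℝ ∞ Θ O) (hOV : O ⊆ V) (hm : Set.MapsTo Θ O V')
    (hiso : ∀ y ∈ O, ∀ v w, G y v w = G' (Θ y) (fderiv ℝ Θ y v) (fderiv ℝ Θ y w))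
    {y : E n} (hy : y ∈ O) (v w : E n) :
    christoffel G' (Θ y) (fderiv ℝ Θ y v) (fderiv ℝ Θ y w) =
      fderiv ℝ Θ y (christoffel G y v w) - fderiv ℝ (fderiv ℝ Θ) y v w := by
  have hΘd := (differentiableAt_of_contDiffOn hO hΘ hy).hasFDerivAt
  have hDd := (differentiableAt_of_contDiffOn hO (hΘ.fderiv_of_isOpen hO (m := ∞) (by simp))
    hy).hasFDerivAt
  have hGd := (differentiableAt_of_contDiffOn hG.isOpen hG.smooth (hOV hy)).hasFDerivAt
  have hGd' := (differentiableAt_of_contDiffOn hG'.isOpen hG'.smooth (hm hy)).hasFDerivAt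
  have hsymm : ∀ a b, fderiv ℝ (fderiv ℝ Θ) y a b = fderiv ℝ (fderiv ℝ Θ) y b a := fun a b => by
    rw [← fderiv_fderiv_apply hO hΘ hy, ← fderiv_fderiv_apply hO hΘ hy, fderiv_fderiv_comm hO hΘ hy]
  -- A map preserving a definite metric has injective differential, hence surjective by equality of
  -- dimensions. Test vectors may therefore be taken of the form `DΘ z`.
  have hinj : Function.Injective (fderiv ℝ Θ y : E n →ₗ[ℝ] E n) := by
    rw [← LinearMap.ker_eq_bot, LinearMap.ker_eq_bot']
    intro a ha
    by_contra hne
    have h1 := hG.pos y (hOV hy) a hne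
    have h2 : fderiv ℝ Θ y a = 0 := ha
    rw [hiso y hy, h2] at h1
    simp at h1
  have hsurj : Function.Surjective (fderiv ℝ Θ y) := LinearMap.injective_iff_surjective.1 hinj
  -- Differentiating the isometry relation expresses the derivative of `G` by that of `G'` and the
  -- Hessian of `Θ`. In the Koszul combination only the Hessian paired with the test vector
  -- survives.
  have hder : ∀ a b d, fderiv ℝ G y a b d =
      fderiv ℝ G' (Θ y) (fderiv ℝ Θ y a) (fderiv ℝ Θ y b) (fderiv ℝ Θ y d)
      + G' (Θ y) (fderiv ℝ (fderiv ℝ Θ) y a b) (fderiv ℝ Θ y d)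
      + G' (Θ y) (fderiv ℝ Θ y b) (fderiv ℝ (fderiv ℝ Θ) y a d) := by
    intro a b d
    have h1 := (hGd.clm_apply (hasFDerivAt_const b y)).clm_apply (hasFDerivAt_const d y)
    have h2 := ((hGd'.comp y hΘd).clm_apply (hDd.clm_apply (hasFDerivAt_const b y))).clm_apply
      (hDd.clm_apply (hasFDerivAt_const d y))
    have h3 := (h1.congr_of_eventuallyEq (f₁ := fun z => G' (Θ z) (fderiv ℝ Θ z b) (fderiv ℝ Θ z d))
      (by filter_upwards [hO.mem_nhds hy] with z hz using (hiso z hz b d).symm)).unique h2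
    have h4 := congrArg (fun L : E n →L[ℝ] ℝ => L a) h3
    simp only [add_apply, ContinuousLinearMap.comp_apply, ContinuousLinearMap.flip_apply,
      zero_apply, map_zero, zero_add, Function.comp_apply] at h4
    rw [h4]
    ring
  refine hG'.ext (hm hy) fun z' => ?_
  obtain ⟨z, rfl⟩ := hsurj z'
  have hk := hG.koszul (hOV hy) v w z
  rw [hiso y hy] at hk
  rw [hG'.koszul (hm hy), map_sub, sub_apply, hk, hder, hder, hder, hsymm w v, hsymm z v, hsymm z w]
  have s1 := hG'.symm _ (hm hy) (fderiv ℝ Θ y v) (fderiv ℝ (fderiv ℝ Θ) y w z)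
  have s2 := hG'.symm _ (hm hy) (fderiv ℝ Θ y w) (fderiv ℝ (fderiv ℝ Θ) y v z)
  rw [s1, s2]
  ring

/-- Covariant derivatives of coordinate fields along a map, after a local isometry. -/
theorem mapCov_transform (hG : IsMetricOn G V) (hG' : IsMetricOn G' V') (hO : IsOpen O)
    (hΘ : ContDiffOn ℝ ∞ Θ O) (hOV : O ⊆ V) (hm : Set.MapsTo Θ O V')
    (hiso : ∀ y ∈ O, ∀ v w, G y v w = G' (Θ y) (fderiv ℝ Θ y v) (fderiv ℝ Θ y w))
    (hU : IsOpen U) (hβ : ContDiffOn ℝ ∞ β U) (hβO : Set.MapsTo β U O)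
    (hβ' : Set.EqOn β' (fun z => Θ (β z)) U) {x : E 2} (hx : x ∈ U) (v w : E 2) :
    fderiv ℝ β' x v = fderiv ℝ Θ (β x) (fderiv ℝ β x v) ∧
    mapCov G' β' v (fun z => fderiv ℝ β' z w) x =
      fderiv ℝ Θ (β x) (mapCov G β v (fun z => fderiv ℝ β z w) x) := by
  have hβd : ∀ z ∈ U, HasFDerivAt β (fderiv ℝ β z) z := fun z hz =>
    (differentiableAt_of_contDiffOn hU hβ hz).hasFDerivAt
  have h1 : ∀ z ∈ U, ∀ u, fderiv ℝ β' z u = fderiv ℝ Θ (β z) (fderiv ℝ β z u) := by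
    intro z hz u
    rw [fderiv_congr_of_eqOn hU hβ' hz]
    have := (differentiableAt_of_contDiffOn hO hΘ (hβO hz)).hasFDerivAt.comp z (hβd z hz)
    exact congrArg (fun L : E 2 →L[ℝ] E n => L u) this.fderiv
  refine ⟨h1 x hx v, ?_⟩
  have hDd := (differentiableAt_of_contDiffOn hO (hΘ.fderiv_of_isOpen hO (m := ∞) (by simp))
    (hβO hx)).hasFDerivAt
  have hA := (differentiableAt_of_contDiffOn hU (contDiffOn_fderiv_apply hU hβ w) hx).hasFDerivAt
  have h2 : fderiv ℝ (fun z => fderiv ℝ β' z w) x v =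
      fderiv ℝ Θ (β x) (fderiv ℝ (fun z => fderiv ℝ β z w) x v)
      + fderiv ℝ (fderiv ℝ Θ) (β x) (fderiv ℝ β x v) (fderiv ℝ β x w) := by
    rw [fderiv_congr_of_eqOn hU (fun z hz => h1 z hz w) hx]
    have := congrArg (fun L : E 2 →L[ℝ] E n => L v)
      (((hDd.comp x (hβd x hx)).clm_apply hA).fderiv)
    refine this.trans ?_
    simp only [add_apply, ContinuousLinearMap.comp_apply, ContinuousLinearMap.flip_apply,
      Function.comp_apply]
  rw [mapCov, mapCov, h2, h1 x hx, h1 x hx, hβ' hx, map_add,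
    christoffel_transform hG hG' hO hΘ hOV hm hiso (hβO hx)]
  abel

end AmbientCharts

/-! ### Change of chart on the surface. -/

section SurfaceCharts

variable {n : ℕ} {G : E n → E n →L[ℝ] E n →L[ℝ] ℝ} {U T : Set (E 2)} {F : Type*}
  [NormedAddCommGroup F] [NormedSpace ℝ F]
  {β β' : E 2 → F} {τ : E 2 → E 2}

theorem fderiv_reparam (hU : IsOpen U) (hβ : ContDiffOn ℝ ∞ β U) (hT : IsOpen T)
    (hτ : ContDiffOn ℝ ∞ τ T) (hm : Set.MapsTo τ T U) (hβ' : Set.EqOn β' (fun z => β (τ z)) T)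
    {x : E 2} (hx : x ∈ T) (v : E 2) :
    fderiv ℝ β' x v = ∑ i, fderiv ℝ τ x v i • fderiv ℝ β (τ x) (e i) := by
  rw [fderiv_congr_of_eqOn hT hβ' hx, ← clm_apply_sum_e]
  exact congrArg (fun L : E 2 →L[ℝ] F => L v)
    ((differentiableAt_of_contDiffOn hU hβ (hm hx)).hasFDerivAt.comp x
      (differentiableAt_of_contDiffOn hT hτ hx).hasFDerivAt).fderiv

/-- The first sum is tensorial. The second, with the Hessian of `τ`, is a combination of first
derivatives and becomes the tangential correction in `Related.D_map`. -/
theorem fderiv_fderiv_reparam (hU : IsOpen U) (hβ : ContDiffOn ℝ ∞ β U) (hT : IsOpen T)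
    (hτ : ContDiffOn ℝ ∞ τ T) (hm : Set.MapsTo τ T U) (hβ' : Set.EqOn β' (fun z => β (τ z)) T)
    {x : E 2} (hx : x ∈ T) (v w : E 2) :
    fderiv ℝ (fun z => fderiv ℝ β' z w) x v =
      (∑ k, ∑ l, (fderiv ℝ τ x v k * fderiv ℝ τ x w l) •
        fderiv ℝ (fun z => fderiv ℝ β z (e l)) (τ x) (e k))
      + ∑ i, fderiv ℝ (fderiv ℝ τ) x v w i • fderiv ℝ β (τ x) (e i) := by
  have hτd := (differentiableAt_of_contDiffOn hT hτ hx).hasFDerivAt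
  have hDτ := (differentiableAt_of_contDiffOn hT (hτ.fderiv_of_isOpen hT (m := ∞) (by simp))
    hx).hasFDerivAt
  have hDβ := (differentiableAt_of_contDiffOn hU (hβ.fderiv_of_isOpen hU (m := ∞) (by simp))
    (hm hx)).hasFDerivAt
  have h1 : Set.EqOn (fun z => fderiv ℝ β' z w) (fun z => fderiv ℝ β (τ z) (fderiv ℝ τ z w)) T :=
    fun z hz => (fderiv_reparam hU hβ hT hτ hm hβ' hz w).trans (clm_apply_sum_e _ _).symm
  rw [fderiv_congr_of_eqOn hT h1 hx]
  refine (congrArg (fun L : E 2 →L[ℝ] F => L v)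
    ((hDβ.comp x hτd).clm_apply (hDτ.clm_apply (hasFDerivAt_const w x))).fderiv).trans ?_
  simp only [add_apply, ContinuousLinearMap.comp_apply, ContinuousLinearMap.flip_apply,
    Function.comp_apply, zero_apply, map_zero, zero_add]
  rw [clm_apply_sum_e (fderiv ℝ β (τ x)), clm_apply_sum_e (fderiv ℝ (fderiv ℝ β) (τ x)), add_comm]
  congr 1
  simp only [sum_apply, smul_apply]
  refine Finset.sum_congr rfl fun k _ => ?_
  rw [clm_apply_sum_e (fderiv ℝ (fderiv ℝ β) (τ x) (e k)), Finset.smul_sum]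
  refine Finset.sum_congr rfl fun l _ => ?_
  rw [smul_smul, fderiv_fderiv_apply hU hβ (hm hx)]

end SurfaceCharts

/-! ### Chart independence of the scalar invariants. -/

section Surface

variable {n : ℕ} {M : Type*} [TopologicalSpace M] [ChartedSpace (E n) M]
  [IsManifold 𝓘(ℝ, E n) ∞ M]
  {S : Type*} [TopologicalSpace S] [ChartedSpace (E 2) S] [IsManifold 𝓘(ℝ, E 2) ∞ S]
  {g : Metric n M} {f : S → M × ℝ} {ψ ψ' : OpenPartialHomeomorph S (E 2)}
  {φ φ' : OpenPartialHomeomorph M (E n)} {c : ℝ}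

theorem sum_one_mul_one_smul {W : Type*} [AddCommGroup W] [Module ℝ W] (F : Fin 2 → Fin 2 → W)
    (i j : Fin 2) : ∑ k, ∑ l, ((1 : Matrix (Fin 2) (Fin 2) ℝ) k i *
      (1 : Matrix (Fin 2) (Fin 2) ℝ) l j) • F k l = F i j := by
  revert i j
  simp [Fin.forall_fin_two, Fin.sum_univ_two]

theorem contDiffOn_transition (hφ : φ ∈ atlas (E n) M) (hφ' : φ' ∈ atlas (E n) M) :
    ContDiffOn ℝ ∞ (fun y => φ' (φ.symm y)) (φ.symm.trans φ').source :=
  ((chart_contMDiffOn hφ').comp ((chart_contMDiffOn_symm hφ).mono Set.inter_subset_left)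
    fun _ hx => hx.2).contDiffOn

/-- Both sides pull back the same metric of `M`, since `φ.symm` is locally `φ'.symm` after the
transition map. -/
theorem chartMetric_transition (hφ : φ ∈ atlas (E n) M) (hφ' : φ' ∈ atlas (E n) M)
    {y : E n} (hy : y ∈ (φ.symm.trans φ').source) (v w : E n) :
    chartMetric g φ y v w = chartMetric g φ' (φ' (φ.symm y))
      (fderiv ℝ (fun y => φ' (φ.symm y)) y v) (fderiv ℝ (fun y => φ' (φ.symm y)) y w) := by
  have hd : MDifferentiableAt 𝓘(ℝ, E n) 𝓘(ℝ, E n) (fun y => φ' (φ.symm y)) y :=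
    (differentiableAt_of_contDiffOn (φ.symm.trans φ').open_source
      (contDiffOn_transition hφ hφ') hy).mdifferentiableAt
  have hs := (mdifferentiable_of_mem_atlas' hφ').mdifferentiableAt_symm (φ'.map_source hy.2)
  have he : φ.symm =ᶠ[𝓝 y] φ'.symm ∘ fun y => φ' (φ.symm y) := by
    filter_upwards [(φ.symm.trans φ').open_source.mem_nhds hy] with z hz
    exact (φ'.left_inv hz.2).symm
  have h1 : mfderiv 𝓘(ℝ, E n) 𝓘(ℝ, E n) φ.symm y =
      mfderiv 𝓘(ℝ, E n) 𝓘(ℝ, E n) (φ'.symm ∘ fun y => φ' (φ.symm y)) y := he.mfderiv_eq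
  have h2 := mfderiv_comp y hs hd
  rw [mfderiv_eq_fderiv] at h2
  have h3 : ∀ u : E n, (mfderiv 𝓘(ℝ, E n) 𝓘(ℝ, E n) φ.symm y : E n →L[ℝ] E n) u =
      (mfderiv 𝓘(ℝ, E n) 𝓘(ℝ, E n) φ'.symm (φ' (φ.symm y)) : E n →L[ℝ] E n)
        (fderiv ℝ (fun y => φ' (φ.symm y)) y u) := fun u =>
    (congrArg (fun L : E n →L[ℝ] E n => L u) h1).trans
    (congrArg (fun L : E n →L[ℝ] E n => L u) h2)
  have hb : φ'.symm (φ' (φ.symm y)) = φ.symm y := φ'.left_inv hy.2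
  rw [chartMetric_apply, chartMetric_apply, hb]
  exact congrArg₂ (fun a b : E n => (g.inner (φ.symm y) : E n →L[ℝ] E n →L[ℝ] ℝ) a b) (h3 v) (h3 w)

variable (hsc : HasConstantSectionalCurvature g c) (hf : IsImmersedSurface (n := n) f)
  (hψ : ψ ∈ atlas (E 2) S) (hφ : φ ∈ atlas (E n) M)

/-- Two charts of `M` give related data. -/
theorem related_of_base_charts (hφ' : φ' ∈ atlas (E n) M) {x : E 2} (hx : x ∈ overlap f ψ φ)
    (hx' : x ∈ overlap f ψ φ') :
    SurfaceData.Related (surfaceData hsc hf hψ hφ) x (surfaceData hsc hf hψ hφ') x 1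
      ((fderiv ℝ (fun y => φ' (φ.symm y)) (baseMap f ψ φ x) : E n →ₗ[ℝ] E n).prodMap
        LinearMap.id) := by
  have hU : IsOpen (overlap f ψ φ ∩ overlap f ψ φ') :=
    (isOpen_overlap hf hψ).inter (isOpen_overlap hf hψ)
  have hb : ∀ z ∈ overlap f ψ φ, φ.symm (baseMap f ψ φ z) = (f (ψ.symm z)).1 :=
    fun z hz => φ.left_inv hz.2
  have hbO : Set.MapsTo (baseMap f ψ φ) (overlap f ψ φ ∩ overlap f ψ φ')
      (φ.symm.trans φ').source := fun z hz => ⟨baseMap_mem_target hz.1, by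
    change φ.symm (baseMap f ψ φ z) ∈ φ'.source
    rw [hb z hz.1]; exact hz.2.2⟩
  have hβ' : Set.EqOn (baseMap f ψ φ') (fun z => φ' (φ.symm (baseMap f ψ φ z)))
      (overlap f ψ φ ∩ overlap f ψ φ') := fun z hz => by
    dsimp only
    rw [hb z hz.1]; rfl
  have key := fun v w => mapCov_transform (isMetricOn_chartMetric g hφ)
    (isMetricOn_chartMetric g hφ') (φ.symm.trans φ').open_source (contDiffOn_transition hφ hφ')
    Set.inter_subset_left (fun y hy => φ'.map_source hy.2)
    (fun y hy v w => chartMetric_transition hφ hφ' hy v w) hU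
    ((contDiffOn_baseMap hf hψ hφ).mono Set.inter_subset_left) hbO hβ' ⟨hx, hx'⟩ v w
  refine ⟨hx, hx', rfl, fun a b => ?_, fun a => rfl, fun j => ?_, fun i j => ⟨0, ?_⟩⟩
  · change ambInner g f ψ φ' x _ _ = ambInner g f ψ φ x _ _
    simp only [ambInner]
    rw [chartMetric_transition hφ hφ' (hbO ⟨hx, hx'⟩), hβ' ⟨hx, hx'⟩]
    rfl
  · simp only [Matrix.one_apply, ite_smul, one_smul, zero_smul, Finset.sum_ite_eq',
      Finset.mem_univ, if_true]
    exact Prod.ext (key (e j) (e j)).1 rfl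
  · rw [sum_one_mul_one_smul (fun k l => (LinearMap.prodMap _ _)
      ((surfaceData hsc hf hψ hφ).D k ((surfaceData hsc hf hψ hφ).X l) x))]
    simp only [Pi.zero_apply, zero_smul, Finset.sum_const_zero, add_zero]
    exact Prod.ext (key (e i) (e j)).2 rfl

/-- Two charts of the surface give related data. -/
theorem related_of_surface_charts (hψ' : ψ' ∈ atlas (E 2) S) {x : E 2} (hx : x ∈ overlap f ψ' φ)
    (hx' : ψ'.symm x ∈ ψ.source) :
    SurfaceData.Related (surfaceData hsc hf hψ hφ) (ψ (ψ'.symm x))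
      (surfaceData hsc hf hψ' hφ) x
      (Matrix.of fun i j => fderiv ℝ (fun z => ψ (ψ'.symm z)) x (e j) i) LinearMap.id := by
  have hU : IsOpen (overlap f ψ φ) := isOpen_overlap hf hψ
  have hT : IsOpen (overlap f ψ' φ ∩ (ψ'.symm.trans ψ).source) :=
    (isOpen_overlap hf hψ').inter (ψ'.symm.trans ψ).open_source
  have hxT : x ∈ overlap f ψ' φ ∩ (ψ'.symm.trans ψ).source := ⟨hx, hx.1, hx'⟩
  have hτ : ContDiffOn ℝ ∞ (fun z => ψ (ψ'.symm z))
      (overlap f ψ' φ ∩ (ψ'.symm.trans ψ).source) :=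
    (contDiffOn_transition hψ' hψ).mono Set.inter_subset_right
  have hl : ∀ z ∈ overlap f ψ' φ ∩ (ψ'.symm.trans ψ).source,
      ψ.symm (ψ (ψ'.symm z)) = ψ'.symm z := fun z hz => ψ.left_inv hz.2.2
  have hm : Set.MapsTo (fun z => ψ (ψ'.symm z))
      (overlap f ψ' φ ∩ (ψ'.symm.trans ψ).source) (overlap f ψ φ) := fun z hz =>
    ⟨ψ.map_source hz.2.2, by
      change (f (ψ.symm (ψ (ψ'.symm z)))).1 ∈ φ.source
      rw [hl z hz]; exact hz.1.2⟩
  have hβ := contDiffOn_baseMap hf hψ hφ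
  have hη : ContDiffOn ℝ ∞ (height f ψ) (overlap f ψ φ) :=
    (contDiffOn_height hf hψ).mono Set.inter_subset_left
  have hβ' : Set.EqOn (baseMap f ψ' φ) (fun z => baseMap f ψ φ (ψ (ψ'.symm z)))
      (overlap f ψ' φ ∩ (ψ'.symm.trans ψ).source) := fun z hz => by
    simp only [baseMap]; rw [hl z hz]
  have hη' : Set.EqOn (height f ψ') (fun z => height f ψ (ψ (ψ'.symm z)))
      (overlap f ψ' φ ∩ (ψ'.symm.trans ψ).source) := fun z hz => by
    simp only [height]; rw [hl z hz]
  have b1 := fun v => fderiv_reparam hU hβ hT hτ hm hβ' hxT v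
  have b2 := fun v => fderiv_reparam hU hη hT hτ hm hη' hxT v
  -- The tangential correction is given by the Hessian of the transition map.
  refine ⟨hm hxT, hx, rfl, fun a b => ?_, fun a => rfl, fun j => ?_, fun i j =>
    ⟨fun m => fderiv ℝ (fderiv ℝ (fun z => ψ (ψ'.symm z))) x (e i) (e j) m, ?_⟩⟩
  · change ambInner g f ψ' φ x _ _ = ambInner g f ψ φ _ _ _
    simp only [ambInner, LinearMap.id_apply]
    rw [hβ' hxT]
  · change coordField f ψ' φ j x = _
    simp only [coordField, b1, b2]
    ext1
    · simp only [Fin.sum_univ_two]; rfl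
    · simp only [Fin.sum_univ_two]; rfl
  · change ambCov g f ψ' φ i (coordField f ψ' φ j) x = _
    have c1 := fderiv_fderiv_reparam hU hβ hT hτ hm hβ' hxT (e i) (e j)
    have c2 := fderiv_fderiv_reparam hU hη hT hτ hm hη' hxT (e i) (e j)
    have e1 : ambCov g f ψ' φ i (coordField f ψ' φ j) x =
      (fderiv ℝ (fun z => fderiv ℝ (baseMap f ψ' φ) z (e j)) x (e i) +
        christoffel (chartMetric g φ) (baseMap f ψ' φ x) (fderiv ℝ (baseMap f ψ' φ) x (e i))
          (fderiv ℝ (baseMap f ψ' φ) x (e j)),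
        fderiv ℝ (fun z => fderiv ℝ (height f ψ') z (e j)) x (e i)) := rfl
    rw [e1, c1, c2, b1, b1, hβ' hxT]
    have e2 : ∀ k l, (surfaceData hsc hf hψ hφ).D k ((surfaceData hsc hf hψ hφ).X l)
        (ψ (ψ'.symm x)) =
      (fderiv ℝ (fun z => fderiv ℝ (baseMap f ψ φ) z (e l)) (ψ (ψ'.symm x)) (e k) +
        christoffel (chartMetric g φ) (baseMap f ψ φ (ψ (ψ'.symm x)))
          (fderiv ℝ (baseMap f ψ φ) (ψ (ψ'.symm x)) (e k))
          (fderiv ℝ (baseMap f ψ φ) (ψ (ψ'.symm x)) (e l)),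
        fderiv ℝ (fun z => fderiv ℝ (height f ψ) z (e l)) (ψ (ψ'.symm x)) (e k)) := fun _ _ => rfl
    have e3 : ∀ m, (surfaceData hsc hf hψ hφ).X m (ψ (ψ'.symm x)) =
      (fderiv ℝ (baseMap f ψ φ) (ψ (ψ'.symm x)) (e m),
        fderiv ℝ (height f ψ) (ψ (ψ'.symm x)) (e m)) := fun _ => rfl
    simp only [LinearMap.id_apply, e2, e3, Fin.sum_univ_two, Matrix.of_apply,
      christoffel_add_left, christoffel_add_right, christoffel_smul_left, christoffel_smul_right]
    ext1
    · simp only [Prod.fst_add, Prod.smul_fst]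
      module
    · simp only [Prod.snd_add, Prod.smul_snd]

include hsc hf hψ hφ in
/-- The scalar invariants do not depend on the charts. -/
theorem invariants_eq (hψ' : ψ' ∈ atlas (E 2) S) (hφ' : φ' ∈ atlas (E n) M) {p : S}
    (hp : p ∈ ψ.source) (hp' : p ∈ ψ'.source) (hfp : (f p).1 ∈ φ.source)
    (hfp' : (f p).1 ∈ φ'.source) :
    meanCurvatureIn g f ψ' φ' (ψ' p) = meanCurvatureIn g f ψ φ (ψ p) ∧
    normSqSecondFormIn g f ψ' φ' (ψ' p) = normSqSecondFormIn g f ψ φ (ψ p) ∧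
    hsNormSq g f ψ' (ψ' p) (shapeForm g f ψ' φ' (ψ' p)) =
      hsNormSq g f ψ (ψ p) (shapeForm g f ψ φ (ψ p)) ∧
    hsNormSq g f ψ' (ψ' p) (formS g c f ψ' φ' (ψ' p)) =
      hsNormSq g f ψ (ψ p) (formS g c f ψ φ (ψ p)) := by
  have l1 : ψ.symm (ψ p) = p := ψ.left_inv hp
  have l2 : ψ'.symm (ψ' p) = p := ψ'.left_inv hp'
  have m1 : ψ p ∈ overlap f ψ φ := ⟨ψ.map_source hp, by
    change (f (ψ.symm (ψ p))).1 ∈ φ.source; rwa [l1]⟩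
  have m2 : ψ p ∈ overlap f ψ φ' := ⟨ψ.map_source hp, by
    change (f (ψ.symm (ψ p))).1 ∈ φ'.source; rwa [l1]⟩
  have m3 : ψ' p ∈ overlap f ψ' φ' := ⟨ψ'.map_source hp', by
    change (f (ψ'.symm (ψ' p))).1 ∈ φ'.source; rwa [l2]⟩
  -- The chart of `M` is changed first, then the chart of the surface.
  have r1 := related_of_base_charts hsc hf hψ hφ hφ' m1 m2
  have r2 := related_of_surface_charts hsc hf hψ hφ' hψ' m3 (by rwa [l2])
  rw [l2] at r2
  refine ⟨congrArg Real.sqrt (r2.ip_mcv.trans r1.ip_mcv), r2.secSq.trans r1.secSq,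
    (r2.hsSq r2.shape).trans (r1.hsSq r1.shape), (r2.hsSq r2.sForm).trans (r1.hsSq r1.sForm)⟩

end Surface

/-! ### From inequalities for `h` to weak inequalities for `√h`, for operators in divergence form.
-/

section DivergenceForm

open MeasureTheory

variable {O K : Set (E 2)} {a : Fin 2 → Fin 2 → E 2 → ℝ} {h v η m : E 2 → ℝ} {x : E 2}

/-- The operator `∑ ∂_i (a_ij ∂_j v)`. -/
def divForm (a : Fin 2 → Fin 2 → E 2 → ℝ) (v : E 2 → ℝ) (x : E 2) : ℝ :=
  ∑ i, ∑ j, fderiv ℝ (fun z => a i j z * fderiv ℝ v z (e j)) x (e i)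

theorem divForm_contDiffOn (hO : IsOpen O) (ha : ∀ i j, ContDiffOn ℝ ∞ (a i j) O)
    (hv : ContDiffOn ℝ ∞ v O) : ContDiffOn ℝ ∞ (divForm a v) O :=
  ContDiffOn.sum fun i _ => ContDiffOn.sum fun j _ =>
    contDiffOn_fderiv_apply hO ((ha i j).mul (contDiffOn_fderiv_apply hO hv _)) _

/-- The operator applied to `√(h + ε)`. -/
theorem divForm_sqrt (hO : IsOpen O) (ha : ∀ i j, ContDiffOn ℝ ∞ (a i j) O)
    (hh : ContDiffOn ℝ ∞ h O) {ε : ℝ} (hε : ∀ z ∈ O, 0 < h z + ε) (hx : x ∈ O) :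
    divForm a (fun z => √(h z + ε)) x = divForm a h x / (2 * √(h x + ε))
      - (∑ i, ∑ j, a i j x * fderiv ℝ h x (e i) * fderiv ℝ h x (e j)) / (4 * √(h x + ε) ^ 3) := by
  have hv : ContDiffOn ℝ ∞ (fun z => √(h z + ε)) O :=
    (hh.add contDiffOn_const).sqrt fun z hz => (hε z hz).ne'
  have hpos : ∀ z ∈ O, √(h z + ε) ≠ 0 := fun z hz => (Real.sqrt_pos.2 (hε z hz)).ne'
  have hw : ContDiffOn ℝ ∞ (fun z => (2 * √(h z + ε))⁻¹) O :=
    (contDiffOn_const.mul hv).inv fun z hz => mul_ne_zero two_ne_zero (hpos z hz)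
  have d1 : ∀ z ∈ O, ∀ u, fderiv ℝ (fun z => √(h z + ε)) z u =
      fderiv ℝ h z u * (2 * √(h z + ε))⁻¹ := by
    intro z hz u
    have hd := (differentiableAt_of_contDiffOn hO hh hz).hasFDerivAt
    rw [((hd.add_const ε).sqrt (hε z hz).ne').fderiv]
    simp only [smul_apply, smul_eq_mul]
    ring
  have d2 : ∀ u, fderiv ℝ (fun z => (2 * √(h z + ε))⁻¹) x u =
      -(fderiv ℝ h x u / (4 * √(h x + ε) ^ 3)) := by
    intro u
    have hd := (differentiableAt_of_contDiffOn hO hv hx).hasFDerivAt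
    refine (congrArg (fun L : E 2 →L[ℝ] ℝ => L u)
      ((hasDerivAt_inv (mul_ne_zero two_ne_zero (hpos x hx))).comp_hasFDerivAt x
        (hd.const_mul 2)).fderiv).trans ?_
    simp only [smul_apply, smul_eq_mul, d1 x hx]
    have := hpos x hx
    field_simp
    ring
  have hf : ∀ i j, ContDiffOn ℝ ∞ (fun z => a i j z * fderiv ℝ h z (e j)) O := fun i j =>
    (ha i j).mul (contDiffOn_fderiv_apply hO hh _)
  simp only [divForm, Finset.sum_div, ← Finset.sum_sub_distrib]
  refine Finset.sum_congr rfl fun i _ => Finset.sum_congr rfl fun j _ => ?_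
  rw [fderiv_congr_of_eqOn hO (g := fun z => a i j z * fderiv ℝ h z (e j) * (2 * √(h z + ε))⁻¹)
    (fun z hz => by dsimp only; rw [d1 z hz]; ring) hx,
    fderiv_mul_apply hO (hf i j) hw hx, d2]
  ring

/-- Simons inequalities for `h` give a differential inequality for `√(h + ε)`. -/
theorem neg_divForm_sqrt_le (hO : IsOpen O) (ha : ∀ i j, ContDiffOn ℝ ∞ (a i j) O)
    (hh : ContDiffOn ℝ ∞ h O) {ε : ℝ} (hε : ∀ z ∈ O, 0 < h z + ε) (hx : x ∈ O)
    (h0 : 0 ≤ h x + 2 * ε)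
    (h1 : 0 ≤ divForm a h x + 2 * m x * h x)
    (h2 : ∑ i, ∑ j, a i j x * fderiv ℝ h x (e i) * fderiv ℝ h x (e j) ≤
      h x * (divForm a h x + 2 * m x * h x)) :
    -divForm a (fun z => √(h z + ε)) x ≤ m x * (h x / √(h x + ε)) := by
  rw [divForm_sqrt hO ha hh hε hx]
  have hs : 0 < √(h x + ε) := Real.sqrt_pos.2 (hε x hx)
  have hsq : √(h x + ε) ^ 2 = h x + ε := Real.sq_sqrt (hε x hx).le
  set s := √(h x + ε)
  set Γ := ∑ i, ∑ j, a i j x * fderiv ℝ h x (e i) * fderiv ℝ h x (e j)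
  set D := divForm a h x
  -- Over the common denominator the difference of the two sides is a sum of two terms, nonnegative
  -- by `h0`, `h1` and by `h2`.
  have key : m x * (h x / s) + (D / (2 * s) - Γ / (4 * s ^ 3)) =
      ((h x + 2 * ε) * (D + 2 * m x * h x) + (h x * (D + 2 * m x * h x) - Γ)) / (4 * s ^ 3) := by
    field_simp
    rw [hsq]
    ring
  have : 0 ≤ m x * (h x / s) + (D / (2 * s) - Γ / (4 * s ^ 3)) := by
    rw [key]
    exact div_nonneg (add_nonneg (mul_nonneg h0 h1) (sub_nonneg.2 h2)) (by positivity)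
  linarith

theorem contDiff_of_contDiffOn_of_eq_zero {F : E 2 → ℝ} (hO : IsOpen O) (hK : IsCompact K)
    (hKO : K ⊆ O) (hF : ContDiffOn ℝ ∞ F O) (h0 : ∀ z ∉ K, F z = 0) : ContDiff ℝ ∞ F := by
  rw [contDiff_iff_contDiffAt]
  intro x
  by_cases hx : x ∈ O
  · exact hF.contDiffAt (hO.mem_nhds hx)
  · have : F =ᶠ[𝓝 x] fun _ => 0 := by
      filter_upwards [hK.isClosed.isOpen_compl.mem_nhds fun h => hx (hKO h)] with z hz using h0 z hz
    exact contDiffAt_const.congr_of_eventuallyEq this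

/-- Integration by parts against the constant function `1`. -/
theorem integral_fderiv_eq_zero_of_compact {F : E 2 → ℝ} (hF : ContDiff ℝ ∞ F)
    (hK : IsCompact K) (h0 : ∀ z ∉ K, F z = 0) (u : E 2) : ∫ x, fderiv ℝ F x u = 0 := by
  have hc : HasCompactSupport F := HasCompactSupport.intro hK fun z hz => h0 z hz
  have hcd : Continuous fun x => fderiv ℝ F x u :=
    (hF.continuous_fderiv (by simp)).clm_apply continuous_const
  have hi := hcd.integrable_of_hasCompactSupport (hc.fderiv_apply ℝ u) (μ := volume)
  have := integral_bilinear_hasLineDerivAt_right_eq_neg_left_of_integrable (μ := volume)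
    (f := fun _ : E 2 => (1 : ℝ)) (f' := fun _ => 0) (g := F) (g' := fun x => fderiv ℝ F x u)
    (v := u) (B := ContinuousLinearMap.mul ℝ ℝ) (by simp) (by simpa using hi)
    (by simpa using hF.continuous.integrable_of_hasCompactSupport hc)
    (fun x _ => (hasFDerivAt_const (1 : ℝ) x).hasLineDerivAt u)
    (fun x _ => (hF.differentiable (by simp) x).hasFDerivAt.hasLineDerivAt u)
  simpa using this

theorem integrableOn_of_continuousOn_of_eq_zero {F : E 2 → ℝ} (hO : IsOpen O) (hK : IsCompact K)
    (hKO : K ⊆ O) (hF : ContinuousOn F O) (h0 : ∀ z ∈ O, z ∉ K → F z = 0) : IntegrableOn F O :=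
  ((hF.mono hKO).integrableOn_compact hK).of_forall_sdiff_eq_zero hO.measurableSet
    fun z hz => h0 z hz.1 hz.2

/-- Simons inequalities for `h` give a weak differential inequality for `√h`. -/
theorem integral_sqrt_mul_neg_divForm_le (hO : IsOpen O) (ha : ∀ i j, ContDiffOn ℝ ∞ (a i j) O)
    (hsymm : ∀ i j, ∀ z ∈ O, a i j z = a j i z)
    (hh : ContDiffOn ℝ ∞ h O) (hm : ContinuousOn m O) (hnn : ∀ z ∈ O, 0 ≤ h z)
    (h1 : ∀ z ∈ O, 0 ≤ divForm a h z + 2 * m z * h z)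
    (h2 : ∀ z ∈ O, ∑ i, ∑ j, a i j z * fderiv ℝ h z (e i) * fderiv ℝ h z (e j) ≤
      h z * (divForm a h z + 2 * m z * h z))
    (hη : ContDiff ℝ ∞ η) (hηc : HasCompactSupport η) (hηO : tsupport η ⊆ O)
    (hη0 : ∀ z, 0 ≤ η z) :
    ∫ x in O, √(h x) * (-divForm a η x) ≤ ∫ x in O, m x * √(h x) * η x := by
  have hηo : ContDiffOn ℝ ∞ η O := hη.contDiffOn
  have zη : ∀ z ∉ tsupport η, η z = 0 := fun z hz => image_eq_zero_of_notMem_tsupport hz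
  have zdη : ∀ z ∉ tsupport η, fderiv ℝ η z = 0 := fun z hz => by
    by_contra hne
    exact hz (support_fderiv_subset ℝ hne)
  have zL : ∀ z ∉ tsupport η, divForm a η z = 0 := by
    intro z hz
    refine Finset.sum_eq_zero fun i _ => Finset.sum_eq_zero fun j _ => ?_
    have : (fun z => a i j z * fderiv ℝ η z (e j)) =ᶠ[𝓝 z] fun _ => 0 := by
      filter_upwards [(isClosed_tsupport η).isOpen_compl.mem_nhds hz] with y hy
      rw [zdη y hy]; simp
    rw [this.fderiv_eq]; simp
  have cη := hη.continuous.continuousOn (s := O)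
  have cL := (divForm_contDiffOn hO ha hηo).continuousOn
  have cs : ContinuousOn (fun z => √(h z)) O := hh.continuousOn.sqrt
  have I1 : IntegrableOn (fun x => √(h x) * (-divForm a η x)) O :=
    integrableOn_of_continuousOn_of_eq_zero hO hηc hηO (cs.mul cL.neg)
      fun z _ hz => by simp [zL z hz]
  have I2 : IntegrableOn (fun x => m x * √(h x) * η x) O :=
    integrableOn_of_continuousOn_of_eq_zero hO hηc hηO ((hm.mul cs).mul cη)
      fun z _ hz => by simp [zη z hz]
  have I3 : IntegrableOn (fun x => |divForm a η x| + |m x * η x|) O :=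
    integrableOn_of_continuousOn_of_eq_zero hO hηc hηO (cL.abs.add (hm.mul cη).abs)
      fun z _ hz => by simp [zL z hz, zη z hz]
  -- `C` controls the cost of replacing `√h` by its regularisation; it does not depend on `δ`.
  set C := ∫ x in O, (|divForm a η x| + |m x * η x|)
  have hC : 0 ≤ C := integral_nonneg fun z => by positivity
  have main : ∀ δ : ℝ, 0 < δ → ∫ x in O, √(h x) * (-divForm a η x) ≤
      (∫ x in O, m x * √(h x) * η x) + δ * C := by
    intro δ hδ
    -- The regularising constant is `δ²`, so that `√h ≤ √(h + δ²) ≤ √h + δ`.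
    have hε : ∀ z ∈ O, 0 < h z + δ ^ 2 := fun z hz => by have := hnn z hz; positivity
    set v : E 2 → ℝ := fun z => √(h z + δ ^ 2) with hvd
    have hv : ContDiffOn ℝ ∞ v O := (hh.add contDiffOn_const).sqrt fun z hz => (hε z hz).ne'
    -- The field of Green's formula. It vanishes off the support of `η`, so it extends smoothly by
    -- zero and its divergence integrates to zero.
    set Y : Fin 2 → E 2 → ℝ := fun i z => ∑ j, (v z * (a i j z * fderiv ℝ η z (e j))
      - η z * (a i j z * fderiv ℝ v z (e j))) with hY
    have fη : ∀ i j, ContDiffOn ℝ ∞ (fun z => a i j z * fderiv ℝ η z (e j)) O := fun i j =>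
      (ha i j).mul (contDiffOn_fderiv_apply hO hηo _)
    have fv : ∀ i j, ContDiffOn ℝ ∞ (fun z => a i j z * fderiv ℝ v z (e j)) O := fun i j =>
      (ha i j).mul (contDiffOn_fderiv_apply hO hv _)
    have zY : ∀ i, ∀ z ∉ tsupport η, Y i z = 0 := fun i z hz => by
      simp [hY, zη z hz, zdη z hz]
    have hYs : ∀ i, ContDiff ℝ ∞ (Y i) := fun i =>
      contDiff_of_contDiffOn_of_eq_zero hO hηc hηO
        (ContDiffOn.sum fun j _ => (hv.mul (fη i j)).sub (hηo.mul (fv i j))) (zY i)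
    have zdY : ∀ i, ∀ z ∉ tsupport η, fderiv ℝ (Y i) z (e i) = 0 := fun i z hz => by
      have : Y i =ᶠ[𝓝 z] fun _ => 0 := by
        filter_upwards [(isClosed_tsupport η).isOpen_compl.mem_nhds hz] with y hy using zY i y hy
      rw [this.fderiv_eq]; simp
    have I4 : ∀ i, Integrable (fun x => fderiv ℝ (Y i) x (e i)) := fun i =>
      (((hYs i).continuous_fderiv (by simp)).clm_apply
        continuous_const).integrable_of_hasCompactSupport (HasCompactSupport.intro hηc (zdY i))
    have hint : ∫ x in O, ∑ i, fderiv ℝ (Y i) x (e i) = 0 := by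
      rw [setIntegral_eq_integral_of_forall_compl_eq_zero fun z hz =>
        Finset.sum_eq_zero fun i _ => zdY i z fun hh => hz (hηO hh),
        integral_finsetSum _ fun i _ => I4 i]
      exact Finset.sum_eq_zero fun i _ =>
        integral_fderiv_eq_zero_of_compact (hYs i) hηc (zY i) _
    have I5 : IntegrableOn (fun x => ∑ i, fderiv ℝ (Y i) x (e i)) O :=
      (integrable_finsetSum _ fun i _ => I4 i).integrableOn
    -- The products of first derivatives of `v` and `η` cancel because the coefficients are
    -- symmetric.
    have hdiv : ∀ x ∈ O, ∑ i, fderiv ℝ (Y i) x (e i) = v x * divForm a η x - η x * divForm a v x := by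
      intro x hx
      have hd : ∀ i j, fderiv ℝ (fun z => v z * (a i j z * fderiv ℝ η z (e j))
          - η z * (a i j z * fderiv ℝ v z (e j))) x (e i) =
          fderiv ℝ v x (e i) * (a i j x * fderiv ℝ η x (e j))
          + v x * fderiv ℝ (fun z => a i j z * fderiv ℝ η z (e j)) x (e i)
          - (fderiv ℝ η x (e i) * (a i j x * fderiv ℝ v x (e j))
          + η x * fderiv ℝ (fun z => a i j z * fderiv ℝ v z (e j)) x (e i)) := fun i j => by
        rw [fderiv_sub_apply hO (hv.mul (fη i j)) (hηo.mul (fv i j)) hx,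
          fderiv_mul_apply hO hv (fη i j) hx, fderiv_mul_apply hO hηo (fv i j) hx]
      have hdY : ∀ i, fderiv ℝ (Y i) x (e i) = ∑ j, (fderiv ℝ v x (e i) * (a i j x * fderiv ℝ η x (e j))
          + v x * fderiv ℝ (fun z => a i j z * fderiv ℝ η z (e j)) x (e i)
          - (fderiv ℝ η x (e i) * (a i j x * fderiv ℝ v x (e j))
          + η x * fderiv ℝ (fun z => a i j z * fderiv ℝ v z (e j)) x (e i))) := fun i => by
        simp only [← hd]
        rw [hY]
        simp only [Fin.sum_univ_two]
        exact fderiv_add_apply hO ((hv.mul (fη i 0)).sub (hηo.mul (fv i 0)))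
          ((hv.mul (fη i 1)).sub (hηo.mul (fv i 1))) hx _
      simp only [hdY, divForm, Fin.sum_univ_two]
      rw [hsymm 1 0 x hx]
      ring
    -- The inequality for `v = √(h + δ²)` is multiplied by `η ≥ 0`; replacing `v` and `h / v` by
    -- `√h` costs at most `δ` times each of the two terms of `C`.
    have hpt : ∀ x ∈ O, √(h x) * (-divForm a η x) ≤ -(∑ i, fderiv ℝ (Y i) x (e i))
        + m x * √(h x) * η x + δ * (|divForm a η x| + |m x * η x|) := by
      intro x hx
      have hL := neg_divForm_sqrt_le hO ha hh hε hx
        (by have := hnn x hx; positivity) (h1 x hx) (h2 x hx)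
      rw [hdiv x hx]
      have hvp : 0 < v x := Real.sqrt_pos.2 (hε x hx)
      have hvsq : v x ^ 2 = h x + δ ^ 2 := Real.sq_sqrt (hε x hx).le
      have hs0 : 0 ≤ √(h x) := Real.sqrt_nonneg _
      have hssq : √(h x) ^ 2 = h x := Real.sq_sqrt (hnn x hx)
      have l1 : √(h x) ≤ v x := Real.sqrt_le_sqrt (by have := sq_nonneg δ; linarith)
      have l2 : v x ≤ √(h x) + δ := by
        refine abs_le_of_sq_le_sq' ?_ (by positivity) |>.2
        nlinarith [mul_nonneg hs0 hδ.le]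
      have l3 : |h x / v x - √(h x)| ≤ δ := by
        have : h x / v x - √(h x) = -(√(h x) / v x * (v x - √(h x))) := by
          field_simp; linear_combination -hssq
        rw [this, abs_neg, abs_of_nonneg (mul_nonneg (by positivity) (by linarith))]
        have l4 : √(h x) / v x ≤ 1 := (div_le_one hvp).2 l1
        have l5 : 0 ≤ √(h x) / v x := by positivity
        nlinarith
      have k1 : (v x - √(h x)) * divForm a η x ≤ δ * |divForm a η x| := by
        refine (le_abs_self _).trans ?_
        rw [abs_mul, abs_of_nonneg (by linarith : 0 ≤ v x - √(h x))]
        exact mul_le_mul_of_nonneg_right (by linarith) (abs_nonneg _)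
      have k2 : m x * (h x / v x) * η x - m x * √(h x) * η x ≤ δ * |m x * η x| := by
        have : m x * (h x / v x) * η x - m x * √(h x) * η x =
          (h x / v x - √(h x)) * (m x * η x) := by ring
        rw [this]
        refine (le_abs_self _).trans ?_
        rw [abs_mul]
        exact mul_le_mul_of_nonneg_right l3 (abs_nonneg _)
      have k3 := mul_le_mul_of_nonneg_right hL (hη0 x)
      linarith
    calc ∫ x in O, √(h x) * (-divForm a η x)
        ≤ ∫ x in O, (-(∑ i, fderiv ℝ (Y i) x (e i))
          + m x * √(h x) * η x + δ * (|divForm a η x| + |m x * η x|)) :=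
          setIntegral_mono_on I1 ((I5.neg.add I2).add (I3.const_mul δ)) hO.measurableSet hpt
      _ = (∫ x in O, m x * √(h x) * η x) + δ * C := by
          have e1 := integral_add (I5.neg.add I2) (I3.const_mul δ)
          have e2 := integral_add I5.neg I2
          have e3 := integral_neg (μ := volume.restrict O) fun x => ∑ i, fderiv ℝ (Y i) x (e i)
          simp only [Pi.add_apply, Pi.neg_apply] at e1 e2
          rw [e1, e2, e3, hint, integral_const_mul]
          simp [C]
  -- Let `δ` tend to zero; `C + 1` avoids division by zero.
  refine le_of_forall_pos_le_add fun ε hε => ?_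
  refine (main (ε / (C + 1)) (by positivity)).trans ?_
  have : ε / (C + 1) * C ≤ ε := by
    rw [div_mul_eq_mul_div, div_le_iff₀ (by positivity)]
    nlinarith
  linarith

end DivergenceForm

/-! ### The inequalities for `|S|` on the surface. -/

section Main

variable {n : ℕ} {M : Type*} [TopologicalSpace M] [ChartedSpace (E n) M]
  [IsManifold 𝓘(ℝ, E n) ∞ M]
  {S : Type*} [TopologicalSpace S] [ChartedSpace (E 2) S] [IsManifold 𝓘(ℝ, E 2) ∞ S]
  {g : Metric n M} {f : S → M × ℝ} {ψ : OpenPartialHomeomorph S (E 2)}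
  {φ : OpenPartialHomeomorph M (E n)} {c : ℝ}

theorem map_mem_overlap {p : S} (hp : p ∈ ψ.source) (hfp : (f p).1 ∈ φ.source) :
    ψ p ∈ overlap f ψ φ := ⟨ψ.map_source hp, by
  change (f (ψ.symm (ψ p))).1 ∈ φ.source
  rwa [ψ.left_inv hp]⟩

section Invariants

variable (hsc : HasConstantSectionalCurvature g c) (hf : IsImmersedSurface (n := n) f)
  (hψ : ψ ∈ atlas (E 2) S) (hφ : φ ∈ atlas (E n) M)

include hsc hf hψ hφ

theorem meanCurvature_eq {x : E 2} (hx : x ∈ overlap f ψ φ) :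
    meanCurvature g f (ψ.symm x) = meanCurvatureIn g f ψ φ x := by
  have h := (invariants_eq hsc hf hψ hφ (chart_mem_atlas (E 2) (ψ.symm x))
    (chart_mem_atlas (E n) (f (ψ.symm x)).1) (ψ.map_target hx.1) (mem_chart_source _ _) hx.2
    (mem_chart_source _ _)).1
  rwa [ψ.right_inv hx.1] at h

theorem normSqSecondForm_eq {x : E 2} (hx : x ∈ overlap f ψ φ) :
    normSqSecondForm g f (ψ.symm x) = normSqSecondFormIn g f ψ φ x := by
  have h := (invariants_eq hsc hf hψ hφ (chart_mem_atlas (E 2) (ψ.symm x))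
    (chart_mem_atlas (E n) (f (ψ.symm x)).1) (ψ.map_target hx.1) (mem_chart_source _ _) hx.2
    (mem_chart_source _ _)).2.1
  rwa [ψ.right_inv hx.1] at h

theorem normSqShape_eq {x : E 2} (hx : x ∈ overlap f ψ φ) :
    normSqShape g f (ψ.symm x) = hsNormSq g f ψ x (shapeForm g f ψ φ x) := by
  have h := (invariants_eq hsc hf hψ hφ (chart_mem_atlas (E 2) (ψ.symm x))
    (chart_mem_atlas (E n) (f (ψ.symm x)).1) (ψ.map_target hx.1) (mem_chart_source _ _) hx.2
    (mem_chart_source _ _)).2.2.1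
  rwa [ψ.right_inv hx.1] at h

theorem normS_eq {x : E 2} (hx : x ∈ overlap f ψ φ) :
    normS g c f (ψ.symm x) = √(hsNormSq g f ψ x (formS g c f ψ φ x)) := by
  have h := (invariants_eq hsc hf hψ hφ (chart_mem_atlas (E 2) (ψ.symm x))
    (chart_mem_atlas (E n) (f (ψ.symm x)).1) (ψ.map_target hx.1) (mem_chart_source _ _) hx.2
    (mem_chart_source _ _)).2.2.2
  rw [ψ.right_inv hx.1] at h
  exact congrArg Real.sqrt h

theorem isParallel_surfaceData (hP : HasParallelMeanCurvature g f) :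
    (surfaceData hsc hf hψ hφ).IsParallel :=
  fun x hx i => hP ψ hψ φ hφ x hx.1 hx.2 i

end Invariants

/-- The mean curvature of a surface with parallel mean curvature vector is locally constant. -/
theorem isLocallyConstant_meanCurvature (hsc : HasConstantSectionalCurvature g c)
    (hf : IsImmersedSurface (n := n) f) (hP : HasParallelMeanCurvature g f) :
    IsLocallyConstant (meanCurvature g f) := by
  rw [IsLocallyConstant.iff_eventually_eq]
  intro p
  set ψ := chartAt (E 2) p with hψd
  set φ := chartAt (E n) (f p).1 with hφd
  have hψ : ψ ∈ atlas (E 2) S := chart_mem_atlas _ _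
  have hφ : φ ∈ atlas (E n) M := chart_mem_atlas _ _
  have hp : p ∈ ψ.source := mem_chart_source _ _
  have hx : ψ p ∈ overlap f ψ φ := map_mem_overlap hp (mem_chart_source _ _)
  let s := surfaceData hsc hf hψ hφ
  have hs : s.IsParallel := isParallel_surfaceData hsc hf hψ hφ hP
  -- The overlap need not be connected; on a ball a function with zero derivative is constant.
  obtain ⟨ε, hε, hb⟩ := Metric.isOpen_iff.1 (isOpen_overlap hf hψ) (ψ p) hx
  have hsm : ContDiffOn ℝ ∞ (fun z => s.ip z (s.mcv z) (s.mcv z)) s.U :=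
    s.ip_smooth _ _ SurfaceData.mcv_smooth SurfaceData.mcv_smooth
  have hconst : ∀ z ∈ Metric.ball (ψ p) ε,
      s.ip z (s.mcv z) (s.mcv z) = s.ip (ψ p) (s.mcv (ψ p)) (s.mcv (ψ p)) := fun z hz =>
    Metric.isOpen_ball.is_const_of_fderiv_eq_zero (𝕜 := ℝ)
      (f := fun z => s.ip z (s.mcv z) (s.mcv z)) (convex_ball _ _).isPreconnected
      (fun y hy => (differentiableAt_of_contDiffOn s.isOpen hsm (hb hy)).differentiableWithinAt)
      (fun y hy => by
        ext v
        rw [clm_apply_sum_e]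
        simp [SurfaceData.fderiv_ip_mcv_mcv hs (hb hy)])
      hz (Metric.mem_ball_self hε)
  have hc : ContinuousAt ψ p := ψ.continuousAt hp
  filter_upwards [hc.preimage_mem_nhds (Metric.ball_mem_nhds _ hε), ψ.open_source.mem_nhds hp]
    with q hq hqs
  have h1 := meanCurvature_eq hsc hf hψ hφ (hb hq)
  have h2 := meanCurvature_eq hsc hf hψ hφ hx
  rw [ψ.left_inv hqs] at h1
  rw [ψ.left_inv hp] at h2
  rw [h1, h2]
  exact congrArg Real.sqrt (hconst _ hq)

variable (hsc : HasConstantSectionalCurvature g c) (hf : IsImmersedSurface (n := n) f)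
  (hP : HasParallelMeanCurvature g f) {H μ : ℝ} (hH : 0 < H) (hmc : ∀ p, meanCurvature g f p = H)
  (hμ : ∀ p, normSqSecondForm g f p - (1 / H) ^ 2 * normSqShape g f p ≤ μ)
  (hψ : ψ ∈ atlas (E 2) S)

theorem normS_nonneg (p : S) : 0 ≤ normS g c f p := Real.sqrt_nonneg _

include hsc hf hP hH hmc hμ hψ

/-- The Simons inequalities for `|S|²` in a chart. -/
theorem simons_chart {x : E 2} (hx : x ∈ ψ.target) :
    ContDiffAt ℝ ∞ (fun z => normS g c f (ψ.symm z) ^ 2) x ∧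
    0 ≤ laplacian g f ψ (fun z => normS g c f (ψ.symm z) ^ 2) x
      + 2 * (2 * normS g c f (ψ.symm x) ^ 2 + (2 * |c| + μ - 2 * H ^ 2 + c ^ 2 / (4 * H ^ 2)))
        * normS g c f (ψ.symm x) ^ 2 ∧
    ∑ i, ∑ j, (firstForm g f ψ x)⁻¹ i j *
        fderiv ℝ (fun z => normS g c f (ψ.symm z) ^ 2) x (e i) *
        fderiv ℝ (fun z => normS g c f (ψ.symm z) ^ 2) x (e j) ≤
      normS g c f (ψ.symm x) ^ 2 * (laplacian g f ψ (fun z => normS g c f (ψ.symm z) ^ 2) x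
      + 2 * (2 * normS g c f (ψ.symm x) ^ 2 + (2 * |c| + μ - 2 * H ^ 2 + c ^ 2 / (4 * H ^ 2)))
        * normS g c f (ψ.symm x) ^ 2) := by
  -- All assertions are local at `x`, so one chart of `M` around the image of `x` suffices even if
  -- `ψ.target` is not mapped into a single chart.
  set φ := chartAt (E n) (f (ψ.symm x)).1 with hφd
  have hφ : φ ∈ atlas (E n) M := chart_mem_atlas _ _
  have hxo : x ∈ overlap f ψ φ := ⟨hx, mem_chart_source (E n) (f (ψ.symm x)).1⟩
  let s := surfaceData hsc hf hψ hφ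
  have hs : s.IsParallel := isParallel_surfaceData hsc hf hψ hφ hP
  have hip : ∀ z ∈ s.U, s.ip z (s.mcv z) (s.mcv z) = H ^ 2 := by
    intro z hz
    have h1 := meanCurvature_eq hsc hf hψ hφ hz
    rw [hmc] at h1
    have h2 : 0 ≤ s.ip z (s.mcv z) (s.mcv z) := by
      by_cases h : s.mcv z = 0
      · rw [h]; simp
      · exact (s.ip_pos z hz _ h).le
    have h3 : √(s.ip z (s.mcv z) (s.mcv z)) = H := h1.symm
    rw [← h3, Real.sq_sqrt h2]
  have hbd : ∀ z ∈ s.U, s.secSq z - (1 / H) ^ 2 * s.hsSq z (s.shape z) ≤ μ := by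
    intro z hz
    have h1 := hμ (ψ.symm z)
    rw [normSqSecondForm_eq hsc hf hψ hφ hz, normSqShape_eq hsc hf hψ hφ hz] at h1
    exact h1
  obtain ⟨hsm, hall⟩ := SurfaceData.simons hip hH hs hbd
  have hEq : Set.EqOn (fun z => normS g c f (ψ.symm z) ^ 2)
      (fun z => s.hsSq z (s.sForm z)) s.U := by
    intro z hz
    dsimp only
    rw [normS_eq hsc hf hψ hφ hz]
    exact Real.sq_sqrt (hall z hz).1
  obtain ⟨h1, h2, h3⟩ := hall x hxo
  have hL : laplacian g f ψ (fun z => normS g c f (ψ.symm z) ^ 2) x =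
      s.lap (fun z => s.hsSq z (s.sForm z)) x := SurfaceData.lap_congr (s := s) s.isOpen hEq hxo
  have hx2 : normS g c f (ψ.symm x) ^ 2 = s.hsSq x (s.sForm x) := hEq hxo
  refine ⟨(hsm.congr hEq).contDiffAt (s.isOpen.mem_nhds hxo), ?_, ?_⟩
  · rw [hL, hx2]; exact h2
  · rw [fderiv_congr_of_eqOn s.isOpen hEq hxo, hL, hx2]; exact h3

theorem contDiffOn_normS_sq : ContDiffOn ℝ ∞ (fun z => normS g c f (ψ.symm z) ^ 2) ψ.target :=
  fun _ hx => (simons_chart hsc hf hP hH hmc hμ hψ hx).1.contDiffWithinAt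

omit hP hH hmc hμ in
theorem contDiffOn_areaDensity_mul_inv (i j : Fin 2) :
    ContDiffOn ℝ ∞ (fun z => areaDensity g f ψ z * (firstForm g f ψ z)⁻¹ i j) ψ.target := by
  intro x hx
  have hφ : chartAt (E n) (f (ψ.symm x)).1 ∈ atlas (E n) M := chart_mem_atlas _ _
  have hxo : x ∈ overlap f ψ (chartAt (E n) (f (ψ.symm x)).1) :=
    ⟨hx, mem_chart_source (E n) (f (ψ.symm x)).1⟩
  let s := surfaceData hsc hf hψ hφ
  have h : ContDiffOn ℝ ∞ (fun z => √(s.gm z).det * (s.gm z)⁻¹ i j) s.U :=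
    SurfaceData.det_smooth.mul (SurfaceData.gm_inv_smooth i j)
  exact (h.contDiffAt (s.isOpen.mem_nhds hxo)).contDiffWithinAt

omit hsc hP hH hmc hμ in
theorem areaDensity_pos {x : E 2} (hx : x ∈ ψ.target) : 0 < areaDensity g f ψ x :=
  Real.sqrt_pos.2 (firstForm_posDef g hf hψ hx).det_pos

omit hsc hP hH hmc hμ in
-- Multiplication by the area density gives an operator in divergence form with symmetric
-- coefficients, for which Green's formula holds with Lebesgue measure.
theorem areaDensity_mul_laplacian {x : E 2} (hx : x ∈ ψ.target) (v : E 2 → ℝ) :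
    areaDensity g f ψ x * laplacian g f ψ v x =
      divForm (fun i j z => areaDensity g f ψ z * (firstForm g f ψ z)⁻¹ i j) v x := by
  rw [laplacian, ← mul_assoc, mul_inv_cancel₀ (areaDensity_pos hf hψ hx).ne', one_mul]
  rfl

omit hsc hP hH hmc hμ in
theorem continuousOn_areaDensity (hsc : HasConstantSectionalCurvature g c) :
    ContinuousOn (areaDensity g f ψ) ψ.target := by
  intro x hx
  have hφ : chartAt (E n) (f (ψ.symm x)).1 ∈ atlas (E n) M := chart_mem_atlas _ _
  have hxo : x ∈ overlap f ψ (chartAt (E n) (f (ψ.symm x)).1) :=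
    ⟨hx, mem_chart_source (E n) (f (ψ.symm x)).1⟩
  let s := surfaceData hsc hf hψ hφ
  have h : ContDiffOn ℝ ∞ (fun z => √(s.gm z).det) s.U := SurfaceData.det_smooth
  exact (h.continuousOn.continuousAt (s.isOpen.mem_nhds hxo)).continuousWithinAt

/-- The Simons inequalities in divergence form. -/
theorem simons_divForm {x : E 2} (hx : x ∈ ψ.target) :
    0 ≤ divForm (fun i j z => areaDensity g f ψ z * (firstForm g f ψ z)⁻¹ i j)
        (fun z => normS g c f (ψ.symm z) ^ 2) x
      + 2 * ((2 * normS g c f (ψ.symm x) ^ 2 + (2 * |c| + μ - 2 * H ^ 2 + c ^ 2 / (4 * H ^ 2)))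
        * areaDensity g f ψ x) * normS g c f (ψ.symm x) ^ 2 ∧
    ∑ i, ∑ j, areaDensity g f ψ x * (firstForm g f ψ x)⁻¹ i j *
        fderiv ℝ (fun z => normS g c f (ψ.symm z) ^ 2) x (e i) *
        fderiv ℝ (fun z => normS g c f (ψ.symm z) ^ 2) x (e j) ≤
      normS g c f (ψ.symm x) ^ 2 *
        (divForm (fun i j z => areaDensity g f ψ z * (firstForm g f ψ z)⁻¹ i j)
        (fun z => normS g c f (ψ.symm z) ^ 2) x
      + 2 * ((2 * normS g c f (ψ.symm x) ^ 2 + (2 * |c| + μ - 2 * H ^ 2 + c ^ 2 / (4 * H ^ 2)))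
        * areaDensity g f ψ x) * normS g c f (ψ.symm x) ^ 2) := by
  obtain ⟨-, h1, h2⟩ := simons_chart hsc hf hP hH hmc hμ hψ hx
  have hρ := areaDensity_pos (g := g) hf hψ hx
  rw [← areaDensity_mul_laplacian hf hψ hx]
  have h1' := mul_nonneg hρ.le h1
  have h2' := mul_le_mul_of_nonneg_left h2 hρ.le
  refine ⟨by linarith, ?_⟩
  simp only [Finset.mul_sum] at h2'
  simp only [mul_assoc] at h2' ⊢
  refine h2'.trans (le_of_eq ?_)
  ring

/-- On the open set `{h > 0}` no regularisation is needed, so the estimate for `√(h + ε)` is applied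
with `ε = 0`, where `h / √h = |S|`. -/
theorem neg_laplacian_normS_le {x : E 2} (hx : x ∈ ψ.target) (hpos : 0 < normS g c f (ψ.symm x)) :
    -laplacian g f ψ (normS g c f ∘ ψ.symm) x ≤ 2 * normS g c f (ψ.symm x) ^ 3 +
      (2 * |c| + μ - 2 * H ^ 2 + c ^ 2 / (4 * H ^ 2)) * normS g c f (ψ.symm x) := by
  set h : E 2 → ℝ := fun z => normS g c f (ψ.symm z) ^ 2 with hh
  have hsm := contDiffOn_normS_sq hsc hf hP hH hmc hμ hψ
  have hO : IsOpen (ψ.target ∩ {z | 0 < h z}) :=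
    hsm.continuousOn.isOpen_inter_preimage ψ.open_target isOpen_Ioi
  obtain ⟨h1, h2⟩ := simons_divForm hsc hf hP hH hmc hμ hψ hx
  have hx2 : 0 < h x := by positivity
  have key := neg_divForm_sqrt_le (ε := 0) hO
    (fun i j => (contDiffOn_areaDensity_mul_inv hsc hf hψ i j).mono Set.inter_subset_left)
    (hsm.mono Set.inter_subset_left) (fun z hz => by simpa using hz.2) ⟨hx, hx2⟩
    (by have := hx2.le; simpa using this)
    (m := fun z => (2 * normS g c f (ψ.symm z) ^ 2 +
      (2 * |c| + μ - 2 * H ^ 2 + c ^ 2 / (4 * H ^ 2))) * areaDensity g f ψ z) h1 h2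
  have hsq : (fun z => √(normS g c f (ψ.symm z) ^ 2 + 0)) = normS g c f ∘ ψ.symm := by
    funext z
    rw [add_zero, Real.sqrt_sq (normS_nonneg _)]; rfl
  have hsqx := congrFun hsq x
  simp only [Function.comp_apply] at hsqx
  rw [hsq, hsqx, ← areaDensity_mul_laplacian hf hψ hx] at key
  have hρ := areaDensity_pos (g := g) hf hψ hx
  have e1 : normS g c f (ψ.symm x) ^ 2 / normS g c f (ψ.symm x) = normS g c f (ψ.symm x) := by
    field_simp
  rw [e1] at key
  refine le_of_mul_le_mul_left ?_ hρ
  linarith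

/-- The weak estimate is applied with the area density absorbed into the coefficients of the
operator and into `m`; this turns Lebesgue integrals into integrals against the area element. -/
theorem integral_normS_mul_neg_laplacian_le {η : E 2 → ℝ} (hη : ContDiff ℝ ∞ η)
    (hηc : HasCompactSupport η) (hηO : tsupport η ⊆ ψ.target) (hη0 : ∀ z, 0 ≤ η z) :
    ∫ x in ψ.target, normS g c f (ψ.symm x) * (-laplacian g f ψ η x) * areaDensity g f ψ x ≤
      ∫ x in ψ.target, (2 * normS g c f (ψ.symm x) ^ 3 +
        (2 * |c| + μ - 2 * H ^ 2 + c ^ 2 / (4 * H ^ 2)) * normS g c f (ψ.symm x)) * η x *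
          areaDensity g f ψ x := by
  have hsm := contDiffOn_normS_sq hsc hf hP hH hmc hμ hψ
  have key := integral_sqrt_mul_neg_divForm_le ψ.open_target
    (fun i j => contDiffOn_areaDensity_mul_inv hsc hf hψ i j)
    (fun i j z hz => by
      have h := (firstForm_posDef g hf hψ hz).inv.isHermitian.apply i j
      rw [star_trivial] at h
      rw [h])
    hsm (m := fun z => (2 * normS g c f (ψ.symm z) ^ 2 +
      (2 * |c| + μ - 2 * H ^ 2 + c ^ 2 / (4 * H ^ 2))) * areaDensity g f ψ z)
    (((continuousOn_const.mul hsm.continuousOn).add continuousOn_const).mul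
      (continuousOn_areaDensity hf hψ hsc)) (fun z _ => sq_nonneg _)
    (fun z hz => (simons_divForm hsc hf hP hH hmc hμ hψ hz).1)
    (fun z hz => (simons_divForm hsc hf hP hH hmc hμ hψ hz).2) hη hηc hηO hη0
  refine le_of_eq_of_le ?_ (key.trans (le_of_eq ?_))
  · refine MeasureTheory.setIntegral_congr_fun ψ.open_target.measurableSet fun x hx => ?_
    rw [Real.sqrt_sq (normS_nonneg _), ← areaDensity_mul_laplacian hf hψ hx]
    ring
  · refine MeasureTheory.setIntegral_congr_fun ψ.open_target.measurableSet fun x hx => ?_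
    rw [Real.sqrt_sq (normS_nonneg _)]
    ring

omit hψ in
theorem continuous_normS : Continuous (normS g c f) := by
  rw [continuous_iff_continuousAt]
  intro p
  have hp : p ∈ (chartAt (E 2) p).source := mem_chart_source _ _
  have h1 := (contDiffOn_normS_sq hsc hf hP hH hmc hμ (chart_mem_atlas (E 2) p)).continuousOn.sqrt
  have h2 := (h1.continuousAt ((chartAt (E 2) p).open_target.mem_nhds
    ((chartAt (E 2) p).map_source hp))).comp ((chartAt (E 2) p).continuousAt hp)
  refine h2.congr ?_
  filter_upwards [(chartAt (E 2) p).open_source.mem_nhds hp] with q hq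
  simp only [Function.comp_apply]
  rw [(chartAt (E 2) p).left_inv hq, Real.sqrt_sq (normS_nonneg _)]

omit hψ in
theorem contMDiffAt_normS {p : S} (hpos : 0 < normS g c f p) :
    ContMDiffAt 𝓘(ℝ, E 2) 𝓘(ℝ, ℝ) ∞ (normS g c f) p := by
  have hψ := chart_mem_atlas (E 2) p
  have hp : p ∈ (chartAt (E 2) p).source := mem_chart_source _ _
  have h1 := (contDiffOn_normS_sq hsc hf hP hH hmc hμ hψ).contDiffAt
    ((chartAt (E 2) p).open_target.mem_nhds ((chartAt (E 2) p).map_source hp))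
  have h2 := h1.sqrt (by
    rw [(chartAt (E 2) p).left_inv hp]; positivity)
  have h3 := h2.contMDiffAt.comp p
    ((chart_contMDiffOn hψ).contMDiffAt ((chartAt (E 2) p).open_source.mem_nhds hp))
  refine h3.congr_of_eventuallyEq ?_
  filter_upwards [(chartAt (E 2) p).open_source.mem_nhds hp] with q hq
  simp only [Function.comp_apply]
  rw [(chartAt (E 2) p).left_inv hq, Real.sqrt_sq (normS_nonneg _)]

end Main

end PMC

end

theorem mainTheorem11 :
    ∃ a b : ℝ → ℝ → ℝ → ℝ,
      ∀ (n : ℕ) (c : ℝ)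
        (M : Type*) [TopologicalSpace M] [ChartedSpace (PMC.E n) M]
        [IsManifold 𝓘(ℝ, PMC.E n) ∞ M] [SimplyConnectedSpace M]
        (g : PMC.Metric n M)
        (S : Type*) [TopologicalSpace S] [ChartedSpace (PMC.E 2) S]
        [IsManifold 𝓘(ℝ, PMC.E 2) ∞ S] [ConnectedSpace S]
        (f : S → M × ℝ) (μ : ℝ),
        PMC.HasConstantSectionalCurvature g c →
        PMC.IsImmersedSurface (n := n) f →
        PMC.HasParallelMeanCurvature g f →
        (∃ p, PMC.meanCurvature g f p ≠ 0) →
        IsLUB (Set.range fun p => PMC.normSqSecondForm g f p -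
          (1 / PMC.meanCurvature g f p) ^ 2 * PMC.normSqShape g f p) μ →
        ∃ H : ℝ, 0 < H ∧ (∀ p, PMC.meanCurvature g f p = H) ∧
          Continuous (PMC.normS g c f) ∧
          PMC.NegLaplacianLEWherePos g f (PMC.normS g c f)
            (fun p => a c H μ * PMC.normS g c f p ^ 3 + b c H μ * PMC.normS g c f p) ∧
          PMC.NegLaplacianLEWeakly g f (PMC.normS g c f)
            (fun p => a c H μ * PMC.normS g c f p ^ 3 + b c H μ * PMC.normS g c f p) := by
  -- Both constants come from the curvature bound `-2K ≤ 2|S|² + b`: the first is the coefficient of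
  -- `|S|²`, the second is the remaining constant.
  refine ⟨fun _ _ _ => 2, fun c H μ => 2 * |c| + μ - 2 * H ^ 2 + c ^ 2 / (4 * H ^ 2), ?_⟩
  intro n c M _ _ _ _ g S _ _ _ _ f μ hsc hf hP hne hμ
  obtain ⟨p₀, hp₀⟩ := hne
  -- A locally constant function on a connected surface is constant.
  have hmc : ∀ p, PMC.meanCurvature g f p = PMC.meanCurvature g f p₀ := fun p =>
    (PMC.isLocallyConstant_meanCurvature hsc hf hP).apply_eq_of_isPreconnected
      isPreconnected_univ (Set.mem_univ p) (Set.mem_univ p₀)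
  have hH : 0 < PMC.meanCurvature g f p₀ := lt_of_le_of_ne (Real.sqrt_nonneg _) hp₀.symm
  have hμ' : ∀ p, PMC.normSqSecondForm g f p -
      (1 / PMC.meanCurvature g f p₀) ^ 2 * PMC.normSqShape g f p ≤ μ := fun p => by
    rw [← hmc p]
    exact hμ.1 ⟨p, rfl⟩
  refine ⟨_, hH, hmc, PMC.continuous_normS hsc hf hP hH hmc hμ', fun p hp =>
    ⟨PMC.contMDiffAt_normS hsc hf hP hH hmc hμ' hp, fun ψ hψ hpψ => ?_⟩, fun ψ hψ η hη hηc hηO hη0 =>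
    PMC.integral_normS_mul_neg_laplacian_le hsc hf hP hH hmc hμ' hψ hη hηc hηO hη0⟩
  have h := PMC.neg_laplacian_normS_le hsc hf hP hH hmc hμ' hψ (ψ.map_source hpψ)
    (by rwa [ψ.left_inv hpψ])
  rwa [ψ.left_inv hpψ] at h
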